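/- A \emph{measure} $H$ assigns a real number $H(G)$ to every finite simple graph $G$, with isomorphic graphs receiving the same number. It is \emph{additive} if $H(G_1 \oplus G_2) = H(G_1) + H(G_2)$ for all vertex-disjoint graphs $G_1, G_2$, where $G_1\oplus G_2$ denotes their disjoint union. An instance $(G,k,\tau)$ of the problem MinH consists of a graph $G$, an integer $k \ge 1$ and a real target $\tau$; it is a yes-instance if it has a \emph{witness}, that is, a set $S$ of exactly $k$ vertices of $G$ with $H(G-S)\le\tau$. A vertex set $S$ is \emph{$L$-trimming} if every connected component of $G-S$ has at most $L$ vertices. The measure $H$ is \emph{balanced on trees} if there are positive constants $c_H, t_H$ such that every yes-instance $(T,k,\tau)$ of MinH in which $T$ is a tree with $n$ vertices has a witness that is $c_H(n/k)^{t_H}$-trimming. The model of computation is the real RAM: real-valued registers and memory cells, with addition, subtraction, multiplication, division, comparison and indirect memory access (at addresses that are natural numbers) at unit cost, and no rounding. Programs may use integer constants and real constants from an arbitrary set $K\subseteq\mathbb R$, fixed throughout. Graphs are given by their adjacency matrices. \textbf{Theorem.} Suppose that $H$ is a measure on graphs that is additive, balanced on trees, and computable in polynomial time on trees on a real RAM.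 Then MinH on trees is fixed-parameter tractable for the parameter $n/k$: there are a real RAM program, a computable function $f:\mathbb N\to\mathbb N$ and a constant $d$ such that, for every tree $T$ with $n$ vertices, every integer $k\ge 1$ and every $\tau\in\mathbb R$, the program decides whether $(T,k,\tau)$ is a yes-instance of MinH in at most $f(\lceil n/k\rceil)\,(n+1)^{d}$ steps. -/

import Mathlib

/-! ## Measures on graphs and the vertex deletion problem -/

/-- A measure on (unlabelled) finite graphs: a real number assigned to every finite simple graph,
with isomorphic graphs receiving the same number. -/
structure GraphMeasure where
  val : ∀ {V : Type} [Finite V], SimpleGraph V → ℝ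
  val_eq_of_iso : ∀ {V W : Type} [Finite V] [Finite W] (G : SimpleGraph V) (G' : SimpleGraph W),
    Nonempty (G ≃g G') → val G = val G'

/-- `H` is additive if its value on a disjoint union is the sum of its values on the parts. -/
def GraphMeasure.Additive (H : GraphMeasure) : Prop :=
  ∀ (V W : Type) [Finite V] [Finite W] (G : SimpleGraph V) (G' : SimpleGraph W),
    H.val (G.sum G') = H.val G + H.val G'

/-- The graph `G - S`, obtained from `G` by deleting the vertices in `S`. -/
abbrev deleteVertices {V : Type} (G : SimpleGraph V) (S : Finset V) :
    SimpleGraph ((S : Set V)ᶜ : Set V) :=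
  G.induce ((S : Set V)ᶜ)

/-- `S` is a witness for the instance `(G, k, τ)` of MinH: it consists of exactly `k` vertices and
`H (G - S) ≤ τ`. -/
def GraphMeasure.IsWitness (H : GraphMeasure) {V : Type} [Finite V] (G : SimpleGraph V)
    (k : ℕ) (τ : ℝ) (S : Finset V) : Prop :=
  S.card = k ∧ H.val (deleteVertices G S) ≤ τ

/-- `(G, k, τ)` is a yes-instance of MinH. -/
def GraphMeasure.IsYesInstance (H : GraphMeasure) {V : Type} [Finite V] (G : SimpleGraph V)
    (k : ℕ) (τ : ℝ) : Prop :=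
  ∃ S : Finset V, H.IsWitness G k τ S

/-- `S` is `L`-trimming in `G` if no connected component of `G - S` has more than `L` vertices. -/
def IsTrimming {V : Type} (G : SimpleGraph V) (L : ℝ) (S : Finset V) : Prop :=
  ∀ C : (deleteVertices G S).ConnectedComponent, (C.supp.ncard : ℝ) ≤ L

/-- `H` is balanced on trees: for some positive constants `c` and `t`, every yes-instance
`(T, k, τ)` of MinH in which `T` is a tree with `n` vertices (and `k ≥ 1`, so that `n / k` makes
sense) has a witness that is `c * (n / k) ^ t`-trimming. -/
def GraphMeasure.BalancedOnTrees (H : GraphMeasure) : Prop :=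
  ∃ c t : ℝ, 0 < c ∧ 0 < t ∧
    ∀ (V : Type) [Finite V] (T : SimpleGraph V) (k : ℕ) (τ : ℝ),
      T.IsTree → 1 ≤ k → H.IsYesInstance T k τ →
        ∃ S : Finset V, H.IsWitness T k τ S ∧
          IsTrimming T (c * ((Nat.card V : ℝ) / (k : ℝ)) ^ t) S

/-! ## The real RAM

Registers and memory cells hold real numbers.  Addition, subtraction, multiplication, division,
comparison, and indirect reads and writes of memory take one step each.  There is no rounding: an
indirect access is possible only when the address register holds a natural number, and otherwise
the machine is stuck (as it is on a division by zero).  Programs may mention all integers, and the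
real constants from a fixed set `K`. -/

namespace RealRAM

/-- The store of the machine: registers (named in the program) and memory (accessed through
addresses computed by the program). -/
@[ext]
structure Store where
  reg : ℕ → ℝ
  mem : ℕ → ℝ

/-- Overwrite register `r`. -/
def Store.setReg (σ : Store) (r : ℕ) (x : ℝ) : Store :=
  { σ with reg := Function.update σ.reg r x }

/-- Overwrite memory cell `i`. -/
def Store.setMem (σ : Store) (i : ℕ) (x : ℝ) : Store :=
  { σ with mem := Function.update σ.mem i x }

/-- The arithmetic operations of the machine. -/
inductive Op where
  | add
  | sub
  | mul
  | div

/-- The value of an arithmetic operation. -/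
noncomputable def Op.eval : Op → ℝ → ℝ → ℝ
  | .add, x, y => x + y
  | .sub, x, y => x - y
  | .mul, x, y => x * y
  | .div, x, y => x / y

/-- Programs of the real RAM whose real constants are integers or members of `K`. -/
inductive Program (K : Set ℝ) : Type where
  /-- do nothing -/
  | skip : Program K
  /-- register `r` := the integer `z` -/
  | int (r : ℕ) (z : ℤ) : Program K
  /-- register `r` := the real constant `c` -/
  | const (r : ℕ) (c : K) : Program K
  /-- register `r` := register `a` `op` register `b` -/
  | arith (op : Op) (r a b : ℕ) : Program K
  /-- register `r` := the memory cell whose address is in register `a` -/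
  | load (r a : ℕ) : Program K
  /-- the memory cell whose address is in register `a` := register `r` -/
  | store (a r : ℕ) : Program K
  /-- sequential composition -/
  | seq (P Q : Program K) : Program K
  /-- if register `a` ≤ register `b` then `P` else `Q` -/
  | ite (a b : ℕ) (P Q : Program K) : Program K
  /-- while register `a` ≤ register `b` do `P` -/
  | loop (a b : ℕ) (P : Program K) : Program K

/-- `Exec P σ t σ'`: started in the store `σ`, the program `P` halts after exactly `t` steps, in
the store `σ'`.  Each elementary instruction and each evaluation of a comparison is one step. -/
inductive Exec {K : Set ℝ} : Program K → Store → ℕ → Store → Prop where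
  | skip (σ : Store) : Exec .skip σ 1 σ
  | int (σ : Store) (r : ℕ) (z : ℤ) : Exec (.int r z) σ 1 (σ.setReg r (z : ℝ))
  | const (σ : Store) (r : ℕ) (c : K) : Exec (.const r c) σ 1 (σ.setReg r (c : ℝ))
  | arith (σ : Store) (op : Op) (r a b : ℕ) (h : op = Op.div → σ.reg b ≠ 0) :
      Exec (.arith op r a b) σ 1 (σ.setReg r (op.eval (σ.reg a) (σ.reg b)))
  | load (σ : Store) (r a i : ℕ) (h : σ.reg a = (i : ℝ)) :
      Exec (.load r a) σ 1 (σ.setReg r (σ.mem i))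
  | store (σ : Store) (a r i : ℕ) (h : σ.reg a = (i : ℝ)) :
      Exec (.store a r) σ 1 (σ.setMem i (σ.reg r))
  | seq {P Q : Program K} {σ σ' σ'' : Store} {s t : ℕ} (hP : Exec P σ s σ')
      (hQ : Exec Q σ' t σ'') : Exec (.seq P Q) σ (s + t) σ''
  | ite_true {a b : ℕ} {P Q : Program K} {σ σ' : Store} {t : ℕ} (h : σ.reg a ≤ σ.reg b)
      (hP : Exec P σ t σ') : Exec (.ite a b P Q) σ (t + 1) σ'
  | ite_false {a b : ℕ} {P Q : Program K} {σ σ' : Store} {t : ℕ} (h : σ.reg b < σ.reg a)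
      (hQ : Exec Q σ t σ') : Exec (.ite a b P Q) σ (t + 1) σ'
  | loop_true {a b : ℕ} {P : Program K} {σ σ' σ'' : Store} {s t : ℕ} (h : σ.reg a ≤ σ.reg b)
      (hP : Exec P σ s σ') (hL : Exec (.loop a b P) σ' t σ'') :
      Exec (.loop a b P) σ (s + t + 1) σ''
  | loop_false {a b : ℕ} {P : Program K} {σ : Store} (h : σ.reg b < σ.reg a) :
      Exec (.loop a b P) σ 1 σ

end RealRAM

/-! ## Inputs, polynomial time, and fixed-parameter tractability -/

open Classical in
/-- Memory holding the adjacency matrix of `G`, row by row, and zeros elsewhere. -/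
noncomputable def adjacencyMemory {n : ℕ} (G : SimpleGraph (Fin n)) : ℕ → ℝ :=
  fun a => if ∃ i j : Fin n, G.Adj i j ∧ a = (i : ℕ) * n + (j : ℕ) then 1 else 0

/-- `H` is computable in polynomial time on trees, on a real RAM: one program, given the number `n`
of vertices in register `0` and the adjacency matrix of a tree `T` in memory (and zeros elsewhere),
halts within polynomially many steps with `H T` in register `0`.
As `n ≥ 1` for a tree, every polynomial bound in `n` is a bound of the form `(n + 1) ^ d`. -/
def GraphMeasure.PolyTimeOnTrees (K : Set ℝ) (H : GraphMeasure) : Prop :=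
  ∃ (P : RealRAM.Program K) (d : ℕ), ∀ (n : ℕ) (T : SimpleGraph (Fin n)), T.IsTree →
    ∃ (t : ℕ) (σ : RealRAM.Store),
      RealRAM.Exec P ⟨fun r => if r = 0 then (n : ℝ) else 0, adjacencyMemory T⟩ t σ ∧
        t ≤ (n + 1) ^ d ∧ σ.reg 0 = H.val T

/-- A parameterized decision problem whose instances are given to a real RAM as initial stores. -/
structure ParameterizedProblem where
  Instance : Type
  input : Instance → RealRAM.Store
  size : Instance → ℕ
  parameter : Instance → ℚ
  IsYes : Instance → Prop

/-- A parameterized problem is fixed-parameter tractable (on a real RAM) if one program decides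
every instance, with answer `1` or `0` in register `0`, in time `f(parameter) * size ^ O(1)` for
some computable `f`.  A rational parameter enters `f` rounded up, so the bound is
uniform over all instances whose parameter does not exceed a given integer. -/
def ParameterizedProblem.IsFPT (K : Set ℝ) (X : ParameterizedProblem) : Prop :=
  ∃ (P : RealRAM.Program K) (f : ℕ → ℕ) (d : ℕ), Computable f ∧ ∀ x : X.Instance,
    ∃ (t : ℕ) (σ : RealRAM.Store), RealRAM.Exec P (X.input x) t σ ∧
      t ≤ f ⌈X.parameter x⌉₊ * (X.size x + 1) ^ d ∧
      (X.IsYes x → σ.reg 0 = 1) ∧ (¬ X.IsYes x → σ.reg 0 = 0)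

/-- An instance of MinH on trees: a tree with `n` vertices, a budget `k ≥ 1` and a real target. -/
structure TreeInstance where
  n : ℕ
  T : SimpleGraph (Fin n)
  isTree : T.IsTree
  k : ℕ
  one_le_k : 1 ≤ k
  τ : ℝ

/-- MinH on trees, for parameter `n / k`.  The input has `n`, `k`, `τ` in registers `0`, `1`, `2`,
the adjacency matrix of the tree in memory, and zeros elsewhere. -/
noncomputable def GraphMeasure.minOnTrees (H : GraphMeasure) : ParameterizedProblem where
  Instance := TreeInstance
  input x :=
    ⟨fun r => if r = 0 then (x.n : ℝ) else if r = 1 then (x.k : ℝ) else if r = 2 then x.τ else 0,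
      adjacencyMemory x.T⟩
  size x := x.n
  parameter x := (x.n : ℚ) / (x.k : ℚ)
  IsYes x := H.IsYesInstance x.T x.k x.τ

/-! If `k > n`, there is no set of `k` vertices and the answer is no. Otherwise balance provides,
for every yes-instance, a witness that leaves only components with at most `L = ⌈c⌉₊ * ⌈n / k⌉₊ ^
⌈t⌉₊` vertices (`rpow_div_le`). As `L` depends on the parameter alone, the possible shapes of such a
component are bounded in number by a function of the parameter, and a dynamic program over the tree
can afford to remember the shape of the one component that may still grow.

Shapes are rooted trees, built by hanging one tree below the root of another and coded by iterated
pairing. A tree with at most `L` vertices has a code at most `codeBound L` (`code_le`). A tree may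
have several codes, which does no harm: codes are never compared up to isomorphism.

The dynamic program works with pieces, each of which touches the rest of the tree only through one
vertex `v`. If `S` is deleted from a piece `A`, additivity splits the value of `A - S` into the
value of the component of `v` and the value `x` of the rest (`IsPartial.on_sdiff`). Only the
component of `v` can change later, so for each code `R` of this component and each size `j` of `S`
the least known `x` suffices. `IsPartial.merge` describes how these data combine when one piece is
hung below another. The tables satisfy a two-sided invariant (`TableOK.merge`): every entry comes
from an actual set, and every trimming set is matched by an entry that is at least as good. The
first half does not mention trimming. The second half only needs codes below the loop bound `W`, so
the entries with larger codes that may be written are harmless.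

No root is chosen. The vertices that represent the remaining pieces induce a tree, so as long as
there are two of them one is a leaf (`IsPieces.exists_leaf`), and its piece is merged into that of
its neighbor. After `n` rounds over all pairs of vertices one piece is left (`run_mergeAll`), and
the answer is yes if and only if some entry for `k` deletions, plus the value of its component, is
at most `τ` (`run_answer`).

The values of the coded trees come from the given program for `H`, which is run once per nonzero
code below `W` in a private block of memory (`runs_relocate`, `runs_callAll`). Everything else is
written in a small language whose loops are bounded by variables, so that `runs_compile` yields a
running time polynomial in any bound on the variables. With the bound `W = codeBound L + n + 2` the
total is `c * (W + 1) ^ e`, and `W + 1 ≤ (codeBound L + 3) * (n + 1)` separates the parameter from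
the size of the tree. The first factor is primitive recursive in `⌈n / k⌉₊`. -/

/-! ## Hoare-style reasoning about the real RAM -/

namespace RealRAM

variable {K : Set ℝ}

/-- Started in `σ`, the program `P` halts within `c` steps in a store satisfying `Q`. -/
def Runs (P : Program K) (σ : Store) (c : ℕ) (Q : Store → Prop) : Prop :=
  ∃ t σ', Exec P σ t σ' ∧ t ≤ c ∧ Q σ'

theorem Runs.mono {P : Program K} {σ : Store} {c c' : ℕ} {Q Q' : Store → Prop}
    (h : Runs P σ c Q) (hc : c ≤ c') (hQ : ∀ σ', Q σ' → Q' σ') : Runs P σ c' Q' := by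
  obtain ⟨t, σ', he, ht, hq⟩ := h
  exact ⟨t, σ', he, ht.trans hc, hQ _ hq⟩

theorem Runs.skip {σ : Store} {Q : Store → Prop} (h : Q σ) :
    Runs (.skip : Program K) σ 1 Q :=
  ⟨1, σ, .skip σ, le_rfl, h⟩

theorem Runs.int {σ : Store} {Q : Store → Prop} {r : ℕ} {z : ℤ} (h : Q (σ.setReg r z)) :
    Runs (.int r z : Program K) σ 1 Q :=
  ⟨1, _, .int σ r z, le_rfl, h⟩

/-- Division is excluded because the code written here never divides. It can occur only inside the
given program for the measure, whose executions are copied step by step. -/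
theorem Runs.arith {σ : Store} {Q : Store → Prop} {op : Op} {r a b : ℕ} (hop : op ≠ .div)
    (h : Q (σ.setReg r (op.eval (σ.reg a) (σ.reg b)))) :
    Runs (.arith op r a b : Program K) σ 1 Q :=
  ⟨1, _, .arith σ op r a b fun h => absurd h hop, le_rfl, h⟩

theorem Runs.load {σ : Store} {Q : Store → Prop} {r a : ℕ} (i : ℕ) (hi : σ.reg a = i)
    (h : Q (σ.setReg r (σ.mem i))) : Runs (.load r a : Program K) σ 1 Q :=
  ⟨1, _, .load σ r a i hi, le_rfl, h⟩

theorem Runs.store {σ : Store} {Q : Store → Prop} {r a : ℕ} (i : ℕ) (hi : σ.reg a = i)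
    (h : Q (σ.setMem i (σ.reg r))) : Runs (.store a r : Program K) σ 1 Q :=
  ⟨1, _, .store σ a r i hi, le_rfl, h⟩

theorem Runs.seq {P P' : Program K} {σ : Store} {c c' : ℕ} {R Q : Store → Prop}
    (h : Runs P σ c R) (h' : ∀ σ', R σ' → Runs P' σ' c' Q) : Runs (.seq P P') σ (c + c') Q := by
  obtain ⟨t, σ', he, ht, hr⟩ := h
  obtain ⟨t', σ'', he', ht', hq⟩ := h' _ hr
  exact ⟨_, _, .seq he he', add_le_add ht ht', hq⟩

theorem Runs.ite {P P' : Program K} {σ : Store} {c c' : ℕ} {a b : ℕ} {Q : Store → Prop}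
    (h : σ.reg a ≤ σ.reg b → Runs P σ c Q) (h' : σ.reg b < σ.reg a → Runs P' σ c' Q) :
    Runs (.ite a b P P') σ (c + c' + 1) Q := by
  rcases le_or_gt (σ.reg a) (σ.reg b) with hab | hab
  · obtain ⟨t, σ', he, ht, hq⟩ := h hab
    exact ⟨_, _, .ite_true hab he, by omega, hq⟩
  · obtain ⟨t, σ', he, ht, hq⟩ := h' hab
    exact ⟨_, _, .ite_false hab he, by omega, hq⟩

/-- Induction on the number of remaining rounds. Each round pays for the body and one comparison,
and the last `1` is the comparison that fails. -/
theorem Runs.loop {P : Program K} {a b n c : ℕ} (I : ℕ → Store → Prop)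
    (hstep : ∀ i σ, i < n → I i σ → σ.reg a ≤ σ.reg b ∧ Runs P σ c (I (i + 1)))
    (hend : ∀ σ, I n σ → σ.reg b < σ.reg a) {σ : Store} (h0 : I 0 σ) :
    Runs (.loop a b P) σ (n * (c + 1) + 1) (I n) := by
  have key : ∀ j i σ, i + j = n → I i σ → Runs (.loop a b P) σ (j * (c + 1) + 1) (I n) := by
    intro j
    induction j with
    | zero =>
      intro i σ hi h
      obtain rfl : i = n := by omega
      exact ⟨1, σ, .loop_false (hend σ h), by omega, h⟩
    | succ j ih =>
      intro i σ hi h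
      obtain ⟨hab, t, σ', he, ht, hI⟩ := hstep i σ (by omega) h
      obtain ⟨t', σ'', he', ht', hI'⟩ := ih (i + 1) σ' (by omega) hI
      refine ⟨_, _, .loop_true hab he he', ?_, hI'⟩
      have : (j + 1) * (c + 1) = j * (c + 1) + c + 1 := by ring
      omega
  exact key n 0 σ (by omega) h0

@[simp] theorem Store.setReg_mem (σ : Store) (r : ℕ) (x : ℝ) : (σ.setReg r x).mem = σ.mem := rfl

@[simp] theorem Store.setMem_reg (σ : Store) (i : ℕ) (x : ℝ) : (σ.setMem i x).reg = σ.reg := rfl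

theorem Store.setReg_reg (σ : Store) (r s : ℕ) (x : ℝ) :
    (σ.setReg r x).reg s = if s = r then x else σ.reg s := by
  simp [Store.setReg, Function.update_apply]

theorem Store.setMem_mem (σ : Store) (i j : ℕ) (x : ℝ) :
    (σ.setMem i x).mem j = if j = i then x else σ.mem j := by
  simp [Store.setMem, Function.update_apply]

end RealRAM

/-! ## A small typed language -/

/-- Two unbounded arrays, one of natural numbers and one of real numbers. -/
structure Heap where
  nat : ℕ → ℕ
  real : ℕ → ℝ

/-- Expressions with natural values.  `inp` reads the read-only input, `ite a b c d` is `c` if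
`a ≤ b` and `d` otherwise, and `sub` is truncated. -/
inductive NExpr where
  | lit (c : ℕ)
  | var (i : ℕ)
  | get (a : NExpr)
  | inp (a : NExpr)
  | add (a b : NExpr)
  | mul (a b : NExpr)
  | sub (a b : NExpr)
  | ite (a b c d : NExpr)

/-- The value of an expression; `env` lists the values of the variables. -/
def NExpr.value (s : ℕ) (inp : ℕ → ℕ) (env : List ℕ) (m : Heap) : NExpr → ℕ
  | lit c => c
  | var i => env.getD i 0
  | get a => m.nat (a.value s inp env m)
  | .inp a => if a.value s inp env m < s then inp (a.value s inp env m) else 0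
  | add a b => a.value s inp env m + b.value s inp env m
  | mul a b => a.value s inp env m * b.value s inp env m
  | sub a b => a.value s inp env m - b.value s inp env m
  | ite a b c d =>
    if a.value s inp env m ≤ b.value s inp env m then c.value s inp env m else d.value s inp env m

/-- Expressions with real values. -/
inductive RExpr where
  | ofN (a : NExpr)
  | get (a : NExpr)
  | add (a b : RExpr)

/-- The value of a real expression. -/
def RExpr.value (s : ℕ) (inp : ℕ → ℕ) (env : List ℕ) (m : Heap) : RExpr → ℝ
  | ofN a => (a.value s inp env m : ℕ)
  | get a => m.real (a.value s inp env m)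
  | add a b => a.value s inp env m + b.value s inp env m

/-- Commands.  `loop y c` runs `c` for each value of a fresh innermost variable below the value of
the variable `y`. -/
inductive Cmd where
  | skip
  | setN (a e : NExpr)
  | setR (a : NExpr) (e : RExpr)
  | seq (c c' : Cmd)
  | ifN (a b : NExpr) (c c' : Cmd)
  | ifR (a b : RExpr) (c c' : Cmd)
  | loop (y : ℕ) (c : Cmd)

/-- Apply `f 0`, ..., `f (b - 1)` in this order. -/
def iter (b : ℕ) (f : ℕ → Heap → Heap) (m : Heap) : Heap :=
  Nat.rec m (fun i m => f i m) b

/-- Overwrite a natural cell. -/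
def Heap.setN (m : Heap) (a x : ℕ) : Heap := { m with nat := Function.update m.nat a x }

/-- Overwrite a real cell. -/
def Heap.setR (m : Heap) (a : ℕ) (x : ℝ) : Heap := { m with real := Function.update m.real a x }

/-- The heap after running a command. -/
noncomputable def Cmd.run (s : ℕ) (inp : ℕ → ℕ) : Cmd → List ℕ → Heap → Heap
  | skip, _, m => m
  | setN a e, env, m => m.setN (a.value s inp env m) (e.value s inp env m)
  | setR a e, env, m => m.setR (a.value s inp env m) (e.value s inp env m)
  | seq c c', env, m => c'.run s inp env (c.run s inp env m)
  | ifN a b c c', env, m =>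
    if a.value s inp env m ≤ b.value s inp env m then c.run s inp env m else c'.run s inp env m
  | ifR a b c c', env, m =>
    open Classical in
    if a.value s inp env m ≤ b.value s inp env m then c.run s inp env m else c'.run s inp env m
  | loop y c, env, m => iter (env.getD y 0) (fun i m => c.run s inp (env ++ [i]) m) m

/-! ## Compilation -/

namespace RealRAM

variable {K : Set ℝ}

/-- Registers for intermediate results. -/
def tReg (q i : ℕ) : ℕ := q + 1 + 3 * i

/-- Registers for variables. -/
def vReg (q i : ℕ) : ℕ := q + 2 + 3 * i

/-- Registers for the successors of variables. -/
def wReg (q i : ℕ) : ℕ := q + 3 + 3 * i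

/-- The store `σ` represents the variables `env` and the heap `m`, with the input in the memory
cells below `s`, and the number `s` in register `q`. -/
structure Rep (q s : ℕ) (inp : ℕ → ℕ) (env : List ℕ) (m : Heap) (σ : Store) : Prop where
  base : σ.reg q = s
  var : ∀ i < env.length, σ.reg (vReg q i) = (env.getD i 0 : ℕ)
  succ : ∀ i < env.length, σ.reg (wReg q i) = (env.getD i 0 : ℕ) + 1
  inp : ∀ a < s, σ.mem a = inp a
  nat : ∀ a, σ.mem (s + 2 * a) = m.nat a
  real : ∀ a, σ.mem (s + 2 * a + 1) = m.real a

/-- `σ'` differs from `σ` only in the temporary registers from `t` on. -/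
structure Frame (q t : ℕ) (σ σ' : Store) : Prop where
  mem : σ'.mem = σ.mem
  reg : ∀ r, (∀ i, t ≤ i → r ≠ tReg q i) → σ'.reg r = σ.reg r

theorem Frame.refl (q t : ℕ) (σ : Store) : Frame q t σ σ := ⟨rfl, fun _ _ => rfl⟩

theorem Frame.trans {q t t' : ℕ} {σ σ' σ'' : Store} (h : Frame q t σ σ') (h' : Frame q t' σ' σ'')
    (ht : t ≤ t') : Frame q t σ σ'' :=
  ⟨h'.mem.trans h.mem, fun r hr =>
    (h'.reg r fun i hi => hr i (ht.trans hi)).trans (h.reg r hr)⟩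

theorem Frame.setReg {q t t' : ℕ} {σ σ' : Store} (h : Frame q t σ σ') (ht : t ≤ t') (x : ℝ) :
    Frame q t σ (σ'.setReg (tReg q t') x) := by
  refine ⟨h.mem, fun r hr => ?_⟩
  rw [Store.setReg_reg, if_neg (hr t' ht)]
  exact h.reg r hr

theorem Frame.tReg {q t i : ℕ} {σ σ' : Store} (h : Frame q t σ σ') (hi : i < t) :
    σ'.reg (tReg q i) = σ.reg (tReg q i) :=
  h.reg _ fun j hj => by unfold RealRAM.tReg; omega

theorem Frame.base {q t : ℕ} {σ σ' : Store} (h : Frame q t σ σ') : σ'.reg q = σ.reg q :=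
  h.reg _ fun j hj => by unfold RealRAM.tReg; omega

theorem Frame.low {q t r : ℕ} {σ σ' : Store} (h : Frame q t σ σ') (hr : r < q) :
    σ'.reg r = σ.reg r :=
  h.reg _ fun j hj => by unfold RealRAM.tReg; omega

theorem Frame.vReg {q t i : ℕ} {σ σ' : Store} (h : Frame q t σ σ') :
    σ'.reg (vReg q i) = σ.reg (vReg q i) :=
  h.reg _ fun j hj => by unfold RealRAM.tReg RealRAM.vReg; omega

theorem Frame.wReg {q t i : ℕ} {σ σ' : Store} (h : Frame q t σ σ') :
    σ'.reg (wReg q i) = σ.reg (wReg q i) :=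
  h.reg _ fun j hj => by unfold RealRAM.tReg RealRAM.wReg; omega

/-- Above `q` the three families of registers are interleaved modulo 3, so each is unlimited and
writing to temporaries disturbs neither the variables nor their successors. -/
theorem Rep.frame {q s t : ℕ} {inp : ℕ → ℕ} {env : List ℕ} {m : Heap} {σ σ' : Store}
    (h : Rep q s inp env m σ) (hf : Frame q t σ σ') : Rep q s inp env m σ' where
  base := hf.base.trans h.base
  var i hi := hf.vReg.trans (h.var i hi)
  succ i hi := hf.wReg.trans (h.succ i hi)
  inp := hf.mem ▸ h.inp
  nat := hf.mem ▸ h.nat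
  real := hf.mem ▸ h.real

/-- Turn the natural number in a temporary register into the address of a natural cell. -/
def natAddr (q t : ℕ) : Program K :=
  .seq (.arith .add (tReg q t) (tReg q t) (tReg q t)) (.arith .add (tReg q t) (tReg q t) q)

/-- Turn the natural number in a temporary register into the address of a real cell. -/
def realAddr (q t : ℕ) : Program K :=
  .seq (natAddr q t)
    (.seq (.int (tReg q (t + 1)) 1) (.arith .add (tReg q t) (tReg q t) (tReg q (t + 1))))

theorem tReg_ne {q i j : ℕ} (h : i ≠ j) : tReg q i ≠ tReg q j := by unfold tReg; omega

theorem base_ne_tReg (q i : ℕ) : q ≠ tReg q i := by unfold tReg; omega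

theorem runs_natAddr {q t s a : ℕ} {σ : Store} (hb : σ.reg q = s) (ha : σ.reg (tReg q t) = a) :
    Runs (natAddr q t : Program K) σ 2 fun σ' =>
      Frame q t σ σ' ∧ σ'.reg (tReg q t) = (s + 2 * a : ℕ) := by
  refine Runs.seq (c := 1) (c' := 1) (Runs.arith (by simp) rfl) ?_
  rintro _ rfl
  refine Runs.arith (by simp) ⟨((Frame.refl q t σ).setReg le_rfl _).setReg le_rfl _, ?_⟩
  simp only [Store.setReg_reg, if_true, Op.eval, if_neg (base_ne_tReg q t), hb, ha]
  push_cast; ring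

theorem runs_realAddr {q t s a : ℕ} {σ : Store} (hb : σ.reg q = s) (ha : σ.reg (tReg q t) = a) :
    Runs (realAddr q t : Program K) σ 4 fun σ' =>
      Frame q t σ σ' ∧ σ'.reg (tReg q t) = (s + 2 * a + 1 : ℕ) := by
  refine Runs.seq (c' := 2) (runs_natAddr hb ha) ?_
  rintro σ' ⟨hf, h⟩
  refine Runs.seq (c := 1) (c' := 1) (Runs.int rfl) ?_
  rintro _ rfl
  refine Runs.arith (by simp) ⟨(hf.setReg (Nat.le_succ t) _).setReg le_rfl _, ?_⟩
  simp only [Store.setReg_reg, if_true, Op.eval, if_neg (tReg_ne (q := q) (Nat.succ_ne_self t).symm),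
    h]
  push_cast; ring

/-- Compile an expression, leaving its value in the temporary register `t`; the program may use
the later temporary registers. -/
def compileN (q d : ℕ) : NExpr → ℕ → Program K
  | .lit c, t => .int (tReg q t) c
  | .var i, t => if i < d then .seq (.int (tReg q t) 0) (.arith .add (tReg q t) (tReg q t) (vReg q i))
      else .int (tReg q t) 0
  | .get a, t => .seq (compileN q d a t) (.seq (natAddr q t) (.load (tReg q t) (tReg q t)))
  | .inp a, t => .seq (compileN q d a t) (.seq (.int (tReg q (t + 1)) 1)
      (.seq (.arith .add (tReg q (t + 1)) (tReg q (t + 1)) (tReg q t))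
        (.ite (tReg q (t + 1)) q (.load (tReg q t) (tReg q t)) (.int (tReg q t) 0))))
  | .add a b, t => .seq (compileN q d a t) (.seq (compileN q d b (t + 1))
      (.arith .add (tReg q t) (tReg q t) (tReg q (t + 1))))
  | .mul a b, t => .seq (compileN q d a t) (.seq (compileN q d b (t + 1))
      (.arith .mul (tReg q t) (tReg q t) (tReg q (t + 1))))
  | .sub a b, t => .seq (compileN q d a t) (.seq (compileN q d b (t + 1))
      (.ite (tReg q (t + 1)) (tReg q t) (.arith .sub (tReg q t) (tReg q t) (tReg q (t + 1)))
        (.int (tReg q t) 0)))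
  | .ite a b c e, t => .seq (compileN q d a t) (.seq (compileN q d b (t + 1))
      (.ite (tReg q t) (tReg q (t + 1)) (compileN q d c t) (compileN q d e t)))

/-- Expressions contain no loops, so the cost `c` is chosen before the store. Temporaries are used
like a stack: the left operand stays in register `t` while the right one is computed from `t + 1`
on, and the frame condition protects it. -/
theorem runs_compileN (q d : ℕ) (e : NExpr) : ∀ t, ∃ c, ∀ (s : ℕ) (inp : ℕ → ℕ) (env : List ℕ)
    (m : Heap) (σ : Store), env.length = d → Rep q s inp env m σ →
      Runs (compileN q d e t : Program K) σ c fun σ' =>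
        Frame q t σ σ' ∧ σ'.reg (tReg q t) = (e.value s inp env m : ℕ) := by
  induction e with
  | lit c =>
    intro t
    refine ⟨1, fun s inp env m σ hd h => Runs.int ⟨(Frame.refl q t σ).setReg le_rfl _, ?_⟩⟩
    simp [Store.setReg_reg, NExpr.value]
  | var i =>
    intro t
    refine ⟨2, fun s inp env m σ hd h => ?_⟩
    by_cases hi : i < d
    · rw [compileN, if_pos hi]
      refine Runs.seq (c := 1) (c' := 1) (Runs.int rfl) ?_
      rintro _ rfl
      refine Runs.arith (by simp) ⟨((Frame.refl q t σ).setReg le_rfl _).setReg le_rfl _, ?_⟩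
      have hv : vReg q i ≠ tReg q t := by unfold vReg tReg; omega
      simp [Store.setReg_reg, Op.eval, NExpr.value, hv, h.var i (hd ▸ hi)]
    · rw [compileN, if_neg hi]
      refine (Runs.int ⟨(Frame.refl q t σ).setReg le_rfl _, ?_⟩).mono (Nat.le_succ 1) fun _ h => h
      -- A variable out of scope has the default value `0`, which is what the compiled code writes.
      rw [NExpr.value, List.getD_eq_default _ _ (by omega : env.length ≤ i)]
      simp [Store.setReg_reg]
  | get a iha =>
    intro t
    obtain ⟨ca, ha⟩ := iha t
    refine ⟨ca + (2 + 1), fun s inp env m σ hd h => Runs.seq (ha s inp env m σ hd h) ?_⟩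
    rintro σ₁ ⟨hf₁, h₁⟩
    refine Runs.seq (runs_natAddr (hf₁.base.trans h.base) h₁) ?_
    rintro σ₂ ⟨hf₂, h₂⟩
    refine Runs.load _ h₂ ⟨(hf₁.trans hf₂ le_rfl).setReg le_rfl _, ?_⟩
    simp [Store.setReg_reg, NExpr.value, hf₂.mem, hf₁.mem, h.nat]
  | inp a iha =>
    intro t
    obtain ⟨ca, ha⟩ := iha t
    refine ⟨ca + (1 + (1 + (1 + 1 + 1))), fun s inp env m σ hd h =>
      Runs.seq (ha s inp env m σ hd h) ?_⟩
    rintro σ₁ ⟨hf₁, h₁⟩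
    refine Runs.seq (Runs.int rfl) ?_
    rintro _ rfl
    refine Runs.seq (Runs.arith (by simp) rfl) ?_
    rintro _ rfl
    have hf := (hf₁.setReg (Nat.le_succ t) ((1 : ℤ) : ℝ)).setReg (Nat.le_succ t)
      (Op.add.eval ((σ₁.setReg (tReg q (t + 1)) ((1 : ℤ) : ℝ)).reg (tReg q (t + 1)))
      ((σ₁.setReg (tReg q (t + 1)) ((1 : ℤ) : ℝ)).reg (tReg q t)))
    have hne : tReg q t ≠ tReg q (t + 1) := tReg_ne (Nat.succ_ne_self t).symm
    refine Runs.ite (fun hc => ?_) fun hc => ?_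
    · simp only [Store.setReg_reg, if_true, Op.eval, if_neg hne, if_neg (base_ne_tReg q (t + 1)),
        h₁, hf₁.base, h.base] at hc
      -- The machine only compares by `≤`, so the strict test against `s` was compiled with `1 + a`
      -- on the left.
      have hlt : a.value s inp env m < s := by
        have : ((1 + a.value s inp env m : ℕ) : ℝ) ≤ s := by push_cast; simpa using hc
        have := Nat.cast_le.1 this
        omega
      refine Runs.load (a.value s inp env m) ?_ ⟨hf.setReg le_rfl _, ?_⟩
      · simp [Store.setReg_reg, hne, h₁]
      · simp [Store.setReg_reg, NExpr.value, hlt, hf₁.mem, h.inp _ hlt]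
    · simp only [Store.setReg_reg, if_true, Op.eval, if_neg hne, if_neg (base_ne_tReg q (t + 1)),
        h₁, hf₁.base, h.base] at hc
      have hlt : ¬ a.value s inp env m < s := by
        have : ((s : ℕ) : ℝ) < (1 + a.value s inp env m : ℕ) := by push_cast; simpa using hc
        have := Nat.cast_lt.1 this
        omega
      refine Runs.int ⟨hf.setReg le_rfl _, ?_⟩
      simp [Store.setReg_reg, NExpr.value, hlt]
  | add a b iha ihb =>
    intro t
    obtain ⟨ca, ha⟩ := iha t
    obtain ⟨cb, hb⟩ := ihb (t + 1)
    refine ⟨ca + (cb + 1), fun s inp env m σ hd h => Runs.seq (ha s inp env m σ hd h) ?_⟩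
    rintro σ₁ ⟨hf₁, h₁⟩
    refine Runs.seq (hb s inp env m σ₁ hd (h.frame hf₁)) ?_
    rintro σ₂ ⟨hf₂, h₂⟩
    refine Runs.arith (by simp) ⟨(hf₁.trans hf₂ (Nat.le_succ t)).setReg le_rfl _, ?_⟩
    simp [Store.setReg_reg, NExpr.value, Op.eval, h₂, hf₂.tReg (Nat.lt_succ_self t), h₁]
  | mul a b iha ihb =>
    intro t
    obtain ⟨ca, ha⟩ := iha t
    obtain ⟨cb, hb⟩ := ihb (t + 1)
    refine ⟨ca + (cb + 1), fun s inp env m σ hd h => Runs.seq (ha s inp env m σ hd h) ?_⟩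
    rintro σ₁ ⟨hf₁, h₁⟩
    refine Runs.seq (hb s inp env m σ₁ hd (h.frame hf₁)) ?_
    rintro σ₂ ⟨hf₂, h₂⟩
    refine Runs.arith (by simp) ⟨(hf₁.trans hf₂ (Nat.le_succ t)).setReg le_rfl _, ?_⟩
    simp [Store.setReg_reg, NExpr.value, Op.eval, h₂, hf₂.tReg (Nat.lt_succ_self t), h₁]
  | sub a b iha ihb =>
    intro t
    obtain ⟨ca, ha⟩ := iha t
    obtain ⟨cb, hb⟩ := ihb (t + 1)
    refine ⟨ca + (cb + (1 + 1 + 1)), fun s inp env m σ hd h =>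
      Runs.seq (ha s inp env m σ hd h) ?_⟩
    rintro σ₁ ⟨hf₁, h₁⟩
    refine Runs.seq (hb s inp env m σ₁ hd (h.frame hf₁)) ?_
    rintro σ₂ ⟨hf₂, h₂⟩
    have h₁' := (hf₂.tReg (Nat.lt_succ_self t)).trans h₁
    refine Runs.ite (fun hc => ?_) fun hc => ?_
    · rw [h₁', h₂, Nat.cast_le] at hc
      refine Runs.arith (by simp) ⟨(hf₁.trans hf₂ (Nat.le_succ t)).setReg le_rfl _, ?_⟩
      simp [Store.setReg_reg, NExpr.value, Op.eval, h₂, h₁', Nat.cast_sub hc]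
    · rw [h₁', h₂, Nat.cast_lt] at hc
      refine Runs.int ⟨(hf₁.trans hf₂ (Nat.le_succ t)).setReg le_rfl _, ?_⟩
      simp [Store.setReg_reg, NExpr.value, Nat.sub_eq_zero_of_le hc.le]
  | ite a b c e iha ihb ihc ihe =>
    intro t
    obtain ⟨ca, ha⟩ := iha t
    obtain ⟨cb, hb⟩ := ihb (t + 1)
    obtain ⟨cc, hc⟩ := ihc t
    obtain ⟨ce, he⟩ := ihe t
    refine ⟨ca + (cb + (cc + ce + 1)), fun s inp env m σ hd h =>
      Runs.seq (ha s inp env m σ hd h) ?_⟩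
    rintro σ₁ ⟨hf₁, h₁⟩
    refine Runs.seq (hb s inp env m σ₁ hd (h.frame hf₁)) ?_
    rintro σ₂ ⟨hf₂, h₂⟩
    have h₁' := (hf₂.tReg (Nat.lt_succ_self t)).trans h₁
    have hf := hf₁.trans hf₂ (Nat.le_succ t)
    refine Runs.ite (fun hab => ?_) fun hab => ?_
    · rw [h₁', h₂, Nat.cast_le] at hab
      refine (hc s inp env m σ₂ hd (h.frame hf)).mono le_rfl fun σ' hσ' =>
        ⟨hf.trans hσ'.1 le_rfl, ?_⟩
      rw [hσ'.2, NExpr.value, if_pos hab]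
    · rw [h₁', h₂, Nat.cast_lt] at hab
      refine (he s inp env m σ₂ hd (h.frame hf)).mono le_rfl fun σ' hσ' =>
        ⟨hf.trans hσ'.1 le_rfl, ?_⟩
      rw [hσ'.2, NExpr.value, if_neg hab.not_ge]

/-- Compile a real expression. -/
def compileR (q d : ℕ) : RExpr → ℕ → Program K
  | .ofN a, t => compileN q d a t
  | .get a, t => .seq (compileN q d a t) (.seq (realAddr q t) (.load (tReg q t) (tReg q t)))
  | .add a b, t => .seq (compileR q d a t) (.seq (compileR q d b (t + 1))
      (.arith .add (tReg q t) (tReg q t) (tReg q (t + 1))))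

theorem runs_compileR (q d : ℕ) (e : RExpr) : ∀ t, ∃ c, ∀ (s : ℕ) (inp : ℕ → ℕ) (env : List ℕ)
    (m : Heap) (σ : Store), env.length = d → Rep q s inp env m σ →
      Runs (compileR q d e t : Program K) σ c fun σ' =>
        Frame q t σ σ' ∧ σ'.reg (tReg q t) = e.value s inp env m := by
  induction e with
  | ofN a => exact fun t => runs_compileN q d a t
  | get a =>
    intro t
    obtain ⟨ca, ha⟩ := runs_compileN (K := K) q d a t
    refine ⟨ca + (4 + 1), fun s inp env m σ hd h => Runs.seq (ha s inp env m σ hd h) ?_⟩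
    rintro σ₁ ⟨hf₁, h₁⟩
    refine Runs.seq (runs_realAddr (hf₁.base.trans h.base) h₁) ?_
    rintro σ₂ ⟨hf₂, h₂⟩
    refine Runs.load _ h₂ ⟨(hf₁.trans hf₂ le_rfl).setReg le_rfl _, ?_⟩
    simp [Store.setReg_reg, RExpr.value, hf₂.mem, hf₁.mem, h.real]
  | add a b iha ihb =>
    intro t
    obtain ⟨ca, ha⟩ := iha t
    obtain ⟨cb, hb⟩ := ihb (t + 1)
    refine ⟨ca + (cb + 1), fun s inp env m σ hd h => Runs.seq (ha s inp env m σ hd h) ?_⟩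
    rintro σ₁ ⟨hf₁, h₁⟩
    refine Runs.seq (hb s inp env m σ₁ hd (h.frame hf₁)) ?_
    rintro σ₂ ⟨hf₂, h₂⟩
    refine Runs.arith (by simp) ⟨(hf₁.trans hf₂ (Nat.le_succ t)).setReg le_rfl _, ?_⟩
    simp [Store.setReg_reg, RExpr.value, Op.eval, h₂, hf₂.tReg (Nat.lt_succ_self t), h₁]

/-- The input lies below `s`, and above it natural and real cells alternate, so a write to one array
cannot hit the other or the input. -/
theorem Rep.setN {q s : ℕ} {inp : ℕ → ℕ} {env : List ℕ} {m : Heap} {σ : Store}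
    (h : Rep q s inp env m σ) (a x : ℕ) : Rep q s inp env (m.setN a x) (σ.setMem (s + 2 * a) x) where
  base := h.base
  var := h.var
  succ := h.succ
  inp b hb := by rw [Store.setMem_mem, if_neg (by omega), h.inp b hb]
  nat b := by
    by_cases hab : b = a
    · simp [Store.setMem_mem, Heap.setN, hab]
    · rw [Store.setMem_mem, if_neg (by omega), h.nat b]
      simp [Heap.setN, hab]
  real b := by rw [Store.setMem_mem, if_neg (by omega), h.real b]; rfl

theorem Rep.setR {q s : ℕ} {inp : ℕ → ℕ} {env : List ℕ} {m : Heap} {σ : Store}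
    (h : Rep q s inp env m σ) (a : ℕ) (x : ℝ) :
    Rep q s inp env (m.setR a x) (σ.setMem (s + 2 * a + 1) x) where
  base := h.base
  var := h.var
  succ := h.succ
  inp b hb := by rw [Store.setMem_mem, if_neg (by omega), h.inp b hb]
  real b := by
    by_cases hab : b = a
    · simp [Store.setMem_mem, Heap.setR, hab]
    · rw [Store.setMem_mem, if_neg (by omega), h.real b]
      simp [Heap.setR, hab]
  nat b := by rw [Store.setMem_mem, if_neg (by omega), h.nat b]; rfl

/-- Store the value of a natural expression. -/
def compileSetN (q d : ℕ) (a e : NExpr) : Program K :=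
  .seq (compileN q d a 0) (.seq (natAddr q 0)
    (.seq (compileN q d e 1) (.store (tReg q 0) (tReg q 1))))

/-- Store the value of a real expression. -/
def compileSetR (q d : ℕ) (a : NExpr) (e : RExpr) : Program K :=
  .seq (compileN q d a 0) (.seq (realAddr q 0)
    (.seq (compileR q d e 1) (.store (tReg q 0) (tReg q 1))))

/-- Set the variable `d` to the content of register `r`. -/
def copyVar (q d r : ℕ) : Program K :=
  .seq (.int (vReg q d) 0) (.seq (.arith .add (vReg q d) (vReg q d) r)
    (.seq (.int (wReg q d) 1) (.arith .add (wReg q d) (wReg q d) r)))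

/-- Set the variable `d` to the value of an expression. -/
def letVar (q d : ℕ) (e : NExpr) : Program K :=
  .seq (compileN q d e 0) (copyVar q d (tReg q 0))

/-- Run `P` for each value of the variable `d` below the value of the variable `y`. -/
def forLoop (q d y : ℕ) (P : Program K) : Program K :=
  .seq (.int (vReg q d) 0) (.seq (.int (wReg q d) 1)
    (.loop (wReg q d) (vReg q y)
      (.seq P (.seq (.int (vReg q d) 0) (.seq (.arith .add (vReg q d) (vReg q d) (wReg q d))
        (.seq (.int (tReg q 0) 1) (.arith .add (wReg q d) (wReg q d) (tReg q 0))))))))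

/-- Compile a command in the scope of `d` variables. -/
def compile (q : ℕ) : Cmd → ℕ → Program K
  | .skip, _ => .skip
  | .setN a e, d => compileSetN q d a e
  | .setR a e, d => compileSetR q d a e
  | .seq c c', d => .seq (compile q c d) (compile q c' d)
  | .ifN a b c c', d => .seq (compileN q d a 0) (.seq (compileN q d b 1)
      (.ite (tReg q 0) (tReg q 1) (compile q c d) (compile q c' d)))
  | .ifR a b c c', d => .seq (compileR q d a 0) (.seq (compileR q d b 1)
      (.ite (tReg q 0) (tReg q 1) (compile q c d) (compile q c' d)))
  | .loop y c, d => if y < d then forLoop q d y (compile q c (d + 1)) else .skip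

theorem runs_compileSetN (q d : ℕ) (a e : NExpr) : ∃ c, ∀ (s : ℕ) (inp : ℕ → ℕ) (env : List ℕ)
    (m : Heap) (σ : Store), env.length = d → Rep q s inp env m σ →
      Runs (compileSetN q d a e : Program K) σ c fun σ' =>
        Rep q s inp env (m.setN (a.value s inp env m) (e.value s inp env m)) σ' := by
  obtain ⟨ca, ha⟩ := runs_compileN (K := K) q d a 0
  obtain ⟨ce, he⟩ := runs_compileN (K := K) q d e 1
  refine ⟨ca + (2 + (ce + 1)), fun s inp env m σ hd h => Runs.seq (ha s inp env m σ hd h) ?_⟩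
  rintro σ₁ ⟨hf₁, h₁⟩
  refine Runs.seq (runs_natAddr (hf₁.base.trans h.base) h₁) ?_
  rintro σ₂ ⟨hf₂, h₂⟩
  have hf := hf₁.trans hf₂ le_rfl
  refine Runs.seq (he s inp env m σ₂ hd (h.frame hf)) ?_
  rintro σ₃ ⟨hf₃, h₃⟩
  refine Runs.store _ ((hf₃.tReg Nat.zero_lt_one).trans h₂) ?_
  rw [h₃]
  exact (h.frame (hf.trans hf₃ (Nat.zero_le 1))).setN _ _

theorem runs_compileSetR (q d : ℕ) (a : NExpr) (e : RExpr) : ∃ c, ∀ (s : ℕ) (inp : ℕ → ℕ)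
    (env : List ℕ) (m : Heap) (σ : Store), env.length = d → Rep q s inp env m σ →
      Runs (compileSetR q d a e : Program K) σ c fun σ' =>
        Rep q s inp env (m.setR (a.value s inp env m) (e.value s inp env m)) σ' := by
  obtain ⟨ca, ha⟩ := runs_compileN (K := K) q d a 0
  obtain ⟨ce, he⟩ := runs_compileR (K := K) q d e 1
  refine ⟨ca + (4 + (ce + 1)), fun s inp env m σ hd h => Runs.seq (ha s inp env m σ hd h) ?_⟩
  rintro σ₁ ⟨hf₁, h₁⟩
  refine Runs.seq (runs_realAddr (hf₁.base.trans h.base) h₁) ?_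
  rintro σ₂ ⟨hf₂, h₂⟩
  have hf := hf₁.trans hf₂ le_rfl
  refine Runs.seq (he s inp env m σ₂ hd (h.frame hf)) ?_
  rintro σ₃ ⟨hf₃, h₃⟩
  refine Runs.store _ ((hf₃.tReg Nat.zero_lt_one).trans h₂) ?_
  rw [h₃]
  exact (h.frame (hf.trans hf₃ (Nat.zero_le 1))).setR _ _

/-- This is how a new innermost variable is introduced. Its successor is stored alongside, since `i
< y` is tested as `i + 1 ≤ y`. -/
theorem Rep.snoc {q s : ℕ} {inp : ℕ → ℕ} {env : List ℕ} {m : Heap} {σ σ' : Store}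
    (h : Rep q s inp env m σ) {x : ℕ}
    (hm : σ'.mem = σ.mem) (hreg : ∀ r, (∀ i, r ≠ tReg q i) → r ≠ vReg q env.length →
      r ≠ wReg q env.length → σ'.reg r = σ.reg r)
    (hv : σ'.reg (vReg q env.length) = x) (hw : σ'.reg (wReg q env.length) = x + 1) :
    Rep q s inp (env ++ [x]) m σ' where
  base := (hreg q (by unfold tReg; omega) (by unfold vReg; omega) (by unfold wReg; omega)).trans
    h.base
  var i hi := by
    rcases Nat.lt_or_ge i env.length with hlt | hge
    · rw [hreg _ (by unfold tReg vReg; omega) (by unfold vReg; omega) (by unfold vReg wReg; omega),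
        h.var i hlt, List.getD_append _ _ _ _ hlt]
    · obtain rfl : i = env.length := by simp at hi; omega
      simp [hv]
  succ i hi := by
    rcases Nat.lt_or_ge i env.length with hlt | hge
    · rw [hreg _ (by unfold tReg wReg; omega) (by unfold vReg wReg; omega) (by unfold wReg; omega),
        h.succ i hlt, List.getD_append _ _ _ _ hlt]
    · obtain rfl : i = env.length := by simp at hi; omega
      simp [hw]
  inp := hm ▸ h.inp
  nat := hm ▸ h.nat
  real := hm ▸ h.real

theorem Rep.of_snoc {q s x : ℕ} {inp : ℕ → ℕ} {env : List ℕ} {m : Heap} {σ : Store}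
    (h : Rep q s inp (env ++ [x]) m σ) : Rep q s inp env m σ where
  base := h.base
  var i hi := by
    rw [h.var i (by simp; omega), List.getD_append _ _ _ _ hi]
  succ i hi := by
    rw [h.succ i (by simp; omega), List.getD_append _ _ _ _ hi]
  inp := h.inp
  nat := h.nat
  real := h.real

theorem runs_copyVar {q s r x : ℕ} {inp : ℕ → ℕ} {env : List ℕ} {m : Heap} {σ : Store}
    (h : Rep q s inp env m σ) (hx : σ.reg r = x) (hv : r ≠ vReg q env.length)
    (hw : r ≠ wReg q env.length) :
    Runs (copyVar q env.length r : Program K) σ 4 fun σ' =>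
      Rep q s inp (env ++ [x]) m σ' ∧ σ'.mem = σ.mem ∧ ∀ i < q, σ'.reg i = σ.reg i := by
  have h3 : vReg q env.length ≠ wReg q env.length := by unfold vReg wReg; omega
  refine Runs.seq (c := 1) (c' := 3) (Runs.int rfl) ?_
  rintro _ rfl
  refine Runs.seq (c := 1) (c' := 2) (Runs.arith (by simp) rfl) ?_
  rintro _ rfl
  refine Runs.seq (c := 1) (c' := 1) (Runs.int rfl) ?_
  rintro _ rfl
  refine Runs.arith (by simp) ⟨h.snoc rfl (fun r hr hv hw => ?_) ?_ ?_, rfl, fun i hi => ?_⟩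
  · simp [Store.setReg_reg, hv, hw]
  · simp [Store.setReg_reg, hv, h3, Op.eval, hx]
  · simp [Store.setReg_reg, hv, hw, Op.eval, hx, add_comm]
  · have h1 : i ≠ vReg q env.length := by unfold vReg; omega
    have h2 : i ≠ wReg q env.length := by unfold wReg; omega
    simp [Store.setReg_reg, h1, h2]

theorem runs_letVar (q d : ℕ) (e : NExpr) : ∃ c, ∀ (s : ℕ) (inp : ℕ → ℕ) (env : List ℕ)
    (m : Heap) (σ : Store), env.length = d → Rep q s inp env m σ →
      Runs (letVar q d e : Program K) σ c fun σ' =>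
        Rep q s inp (env ++ [e.value s inp env m]) m σ' := by
  obtain ⟨ce, he⟩ := runs_compileN (K := K) q d e 0
  refine ⟨ce + 4, fun s inp env m σ hd h => Runs.seq (he s inp env m σ hd h) ?_⟩
  rintro σ₁ ⟨hf₁, h₁⟩
  subst hd
  exact (runs_copyVar (h.frame hf₁) h₁ (by unfold tReg vReg; omega)
    (by unfold tReg wReg; omega)).mono le_rfl fun _ h => h.1

/-- The body is an arbitrary program and not a compiled command, because the loop over the calls of
the given program needs the same rule. -/
theorem runs_forLoop {q s y d c : ℕ} {inp : ℕ → ℕ} {env : List ℕ} {P : Program K}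
    (hd : env.length = d) (hy : y < d) (I : ℕ → Heap → Prop)
    (hP : ∀ i m σ, i < env.getD y 0 → I i m → Rep q s inp (env ++ [i]) m σ →
      Runs P σ c fun σ' => ∃ m', I (i + 1) m' ∧ Rep q s inp (env ++ [i]) m' σ')
    {m : Heap} {σ : Store} (hI : I 0 m) (h : Rep q s inp env m σ) :
    Runs (forLoop q d y P) σ (1 + (1 + (env.getD y 0 * (c + 4 + 1) + 1))) fun σ' =>
      ∃ m', I (env.getD y 0) m' ∧ Rep q s inp env m' σ' := by
  subst hd
  have h1 : tReg q 0 ≠ vReg q env.length := by unfold tReg vReg; omega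
  have h2 : tReg q 0 ≠ wReg q env.length := by unfold tReg wReg; omega
  have h3 : vReg q env.length ≠ wReg q env.length := by unfold vReg wReg; omega
  refine Runs.seq (Runs.int rfl) ?_
  rintro _ rfl
  refine Runs.seq (Runs.int rfl) ?_
  rintro _ rfl
  refine (Runs.loop (n := env.getD y 0) (c := c + 4)
    (fun i σ => ∃ m, I i m ∧ Rep q s inp (env ++ [i]) m σ) ?_ ?_ ?_).mono le_rfl ?_
  · rintro i σ hi ⟨m, hI, h⟩
    constructor
    · have hw := h.succ env.length (by simp)
      have hv := h.var y (by simp; omega)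
      rw [hw, hv, List.getD_append _ _ _ _ hy]
      simp only [List.getD_append_right _ _ _ _ le_rfl, Nat.sub_self, List.getD_cons_zero]
      exact_mod_cast hi
    · refine Runs.seq (c' := 1 + (1 + (1 + 1))) (hP i m σ hi hI h) ?_
      rintro σ' ⟨m', hI', h'⟩
      have hw := h'.succ env.length (by simp)
      simp only [List.getD_append_right _ _ _ _ le_rfl, Nat.sub_self, List.getD_cons_zero] at hw
      refine Runs.seq (Runs.int rfl) ?_
      rintro _ rfl
      refine Runs.seq (Runs.arith (by simp) rfl) ?_
      rintro _ rfl
      refine Runs.seq (Runs.int rfl) ?_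
      rintro _ rfl
      refine Runs.arith (by simp) ⟨m', hI', h'.of_snoc.snoc rfl (fun r hr hv hw => ?_) ?_ ?_⟩
      · simp [Store.setReg_reg, hv, hw, hr]
      · simp [Store.setReg_reg, h1.symm, h3, h3.symm, Op.eval, hw]
      · simp [Store.setReg_reg, h2.symm, h3.symm, Op.eval, hw]
  · rintro σ ⟨m, hI, h⟩
    have hw := h.succ env.length (by simp)
    have hv := h.var y (by simp; omega)
    rw [hw, hv, List.getD_append _ _ _ _ hy]
    simp only [List.getD_append_right _ _ _ _ le_rfl, Nat.sub_self, List.getD_cons_zero]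
    exact lt_add_one _
  · refine ⟨m, hI, h.snoc rfl (fun r hr hv hw => ?_) ?_ ?_⟩
    · simp [Store.setReg_reg, hv, hw]
    · simp [Store.setReg_reg, h3]
    · simp [Store.setReg_reg]
  · rintro σ ⟨m, hI, h⟩
    exact ⟨m, hI, h.of_snoc⟩

/-- Commands cannot assign to variables, and a loop variable stays below the variable that bounds
it, so a bound `B` on the environment persists in all nested loops. Each loop costs one more factor
`B + 1`. Exponents are added even for sequential composition, which is wasteful but still
polynomial. -/
theorem runs_compile (q : ℕ) (p : Cmd) : ∀ d, ∃ c e, ∀ (B s : ℕ) (inp : ℕ → ℕ) (env : List ℕ)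
    (m : Heap) (σ : Store), env.length = d → (∀ x ∈ env, x ≤ B) → Rep q s inp env m σ →
      Runs (compile q p d : Program K) σ (c * (B + 1) ^ e) fun σ' =>
        Rep q s inp env (p.run s inp env m) σ' := by
  have hpos : ∀ B e : ℕ, 1 ≤ (B + 1) ^ e := fun B e => Nat.one_le_pow _ _ (Nat.succ_pos B)
  have hc : ∀ B e c : ℕ, c ≤ c * (B + 1) ^ e := fun B e c => Nat.le_mul_of_pos_right _ (hpos B e)
  have hadd : ∀ B c₁ e₁ c₂ e₂ : ℕ, c₁ * (B + 1) ^ e₁ + c₂ * (B + 1) ^ e₂ ≤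
      (c₁ + c₂) * (B + 1) ^ (e₁ + e₂) := by
    intro B c₁ e₁ c₂ e₂
    rw [add_mul]
    gcongr <;> omega
  induction p with
  | skip =>
    intro d
    exact ⟨1, 0, fun B s inp env m σ hd hB h => (Runs.skip h).mono (by simp) fun _ h => h⟩
  | setN a e =>
    intro d
    obtain ⟨c, hc⟩ := runs_compileSetN (K := K) q d a e
    exact ⟨c, 0, fun B s inp env m σ hd hB h =>
      (hc s inp env m σ hd h).mono (by simp) fun _ h => h⟩
  | setR a e =>
    intro d
    obtain ⟨c, hc⟩ := runs_compileSetR (K := K) q d a e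
    exact ⟨c, 0, fun B s inp env m σ hd hB h =>
      (hc s inp env m σ hd h).mono (by simp) fun _ h => h⟩
  | seq p p' ih ih' =>
    intro d
    obtain ⟨c₁, e₁, h₁⟩ := ih d
    obtain ⟨c₂, e₂, h₂⟩ := ih' d
    refine ⟨c₁ + c₂, e₁ + e₂, fun B s inp env m σ hd hB h => ?_⟩
    exact (Runs.seq (h₁ B s inp env m σ hd hB h) fun σ' h' => h₂ B s inp env _ σ' hd hB h').mono
      (hadd B c₁ e₁ c₂ e₂) fun _ h => h
  | ifN a b p p' ih ih' =>
    intro d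
    obtain ⟨ca, ha⟩ := runs_compileN (K := K) q d a 0
    obtain ⟨cb, hb⟩ := runs_compileN (K := K) q d b 1
    obtain ⟨c₁, e₁, h₁⟩ := ih d
    obtain ⟨c₂, e₂, h₂⟩ := ih' d
    refine ⟨ca + cb + 1 + (c₁ + c₂), e₁ + e₂, fun B s inp env m σ hd hB h => ?_⟩
    refine Runs.mono (c := ca + (cb + (c₁ * (B + 1) ^ e₁ + c₂ * (B + 1) ^ e₂ + 1)))
      (Runs.seq (ha s inp env m σ hd h) ?_) ?_ fun _ h => h
    · rintro σ₁ ⟨hf₁, hv₁⟩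
      refine Runs.seq (hb s inp env m σ₁ hd (h.frame hf₁)) ?_
      rintro σ₂ ⟨hf₂, hv₂⟩
      have hr := (h.frame hf₁).frame hf₂
      rw [Cmd.run]
      refine Runs.ite (fun hab => ?_) fun hab => ?_
      · rw [hf₂.tReg Nat.zero_lt_one, hv₁, hv₂, Nat.cast_le] at hab
        rw [if_pos hab]
        exact h₁ B s inp env m σ₂ hd hB hr
      · rw [hf₂.tReg Nat.zero_lt_one, hv₁, hv₂, Nat.cast_lt] at hab
        rw [if_neg hab.not_ge]
        exact h₂ B s inp env m σ₂ hd hB hr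
    · have := hadd B c₁ e₁ c₂ e₂
      have := hc B (e₁ + e₂) (ca + cb + 1)
      rw [add_mul (ca + cb + 1)]
      omega
  | ifR a b p p' ih ih' =>
    intro d
    obtain ⟨ca, ha⟩ := runs_compileR (K := K) q d a 0
    obtain ⟨cb, hb⟩ := runs_compileR (K := K) q d b 1
    obtain ⟨c₁, e₁, h₁⟩ := ih d
    obtain ⟨c₂, e₂, h₂⟩ := ih' d
    refine ⟨ca + cb + 1 + (c₁ + c₂), e₁ + e₂, fun B s inp env m σ hd hB h => ?_⟩
    refine Runs.mono (c := ca + (cb + (c₁ * (B + 1) ^ e₁ + c₂ * (B + 1) ^ e₂ + 1)))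
      (Runs.seq (ha s inp env m σ hd h) ?_) ?_ fun _ h => h
    · rintro σ₁ ⟨hf₁, hv₁⟩
      refine Runs.seq (hb s inp env m σ₁ hd (h.frame hf₁)) ?_
      rintro σ₂ ⟨hf₂, hv₂⟩
      have hr := (h.frame hf₁).frame hf₂
      rw [Cmd.run]
      refine Runs.ite (fun hab => ?_) fun hab => ?_
      · rw [hf₂.tReg Nat.zero_lt_one, hv₁, hv₂] at hab
        rw [if_pos hab]
        exact h₁ B s inp env m σ₂ hd hB hr
      · rw [hf₂.tReg Nat.zero_lt_one, hv₁, hv₂] at hab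
        rw [if_neg hab.not_ge]
        exact h₂ B s inp env m σ₂ hd hB hr
    · have := hadd B c₁ e₁ c₂ e₂
      have := hc B (e₁ + e₂) (ca + cb + 1)
      rw [add_mul (ca + cb + 1)]
      omega
  | loop y p ih =>
    intro d
    obtain ⟨c, e, hp⟩ := ih (d + 1)
    refine ⟨c + 8, e + 1, fun B s inp env m σ hd hB h => ?_⟩
    rw [compile, Cmd.run]
    by_cases hy : y < d
    · rw [if_pos hy]
      have hyB : env.getD y 0 ≤ B := by
        rw [List.getD_eq_getElem _ _ (hd ▸ hy)]
        exact hB _ (List.getElem_mem _)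
      refine (runs_forLoop (s := s) (inp := inp) (c := c * (B + 1) ^ e) hd hy
        (fun i m' => m' = iter i (fun i m => p.run s inp (env ++ [i]) m) m) ?_ rfl h).mono ?_ ?_
      · rintro i m' σ' hi rfl h'
        refine (hp B s inp (env ++ [i]) _ σ' (by simp [hd]) ?_ h').mono le_rfl
          fun _ h'' => ⟨_, rfl, h''⟩
        intro x hx
        rcases List.mem_append.1 hx with hx | hx
        · exact hB x hx
        · obtain rfl : x = i := by simpa using hx
          omega
      · have h1 := Nat.mul_le_mul_right (c * (B + 1) ^ e + 4 + 1) hyB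
        have h2 := hpos B e
        have h3 : (c + 8) * (B + 1) ^ (e + 1) =
          B * (c * (B + 1) ^ e) + c * (B + 1) ^ e + 8 * (B * (B + 1) ^ e) + 8 * (B + 1) ^ e := by
          ring
        have h4 := Nat.le_mul_of_pos_right B h2
        have h5 : B * (c * (B + 1) ^ e + 4 + 1) = B * (c * (B + 1) ^ e) + 5 * B := by ring
        omega
      · rintro σ' ⟨m', rfl, h'⟩
        exact h'
    · rw [if_neg hy, List.getD_eq_default _ _ (by omega)]
      exact (Runs.skip h).mono ((by omega : 1 ≤ c + 8).trans (hc _ _ _)) fun _ h => h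

end RealRAM

/-! ## Codes of rooted trees -/

/-- The number of vertices of the tree with the given code.  Code `0` is the empty graph, code `1`
a single vertex, and code `Nat.pair a b + 2` the tree with code `b + 1`, hung below the root of the
tree with code `a + 1`. -/
def codeSize : ℕ → ℕ
  | 0 => 0
  | 1 => 1
  | n + 2 => codeSize (n.unpair.1 + 1) + codeSize (n.unpair.2 + 1)
decreasing_by
  · have := Nat.unpair_left_le n; omega
  · have := Nat.unpair_right_le n; omega

/-- The adjacency matrix of the tree with the given code; the root is `0`. -/
def codeAdj : ℕ → ℕ → ℕ → ℕ
  | 0, _, _ => 0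
  | 1, _, _ => 0
  | n + 2, i, j =>
    if codeSize (n.unpair.1 + 1) ≤ i then
      if codeSize (n.unpair.1 + 1) ≤ j then
        codeAdj (n.unpair.2 + 1) (i - codeSize (n.unpair.1 + 1)) (j - codeSize (n.unpair.1 + 1))
      else if i ≤ codeSize (n.unpair.1 + 1) then if j ≤ 0 then 1 else 0 else 0
    else if codeSize (n.unpair.1 + 1) ≤ j then
      if j ≤ codeSize (n.unpair.1 + 1) then if i ≤ 0 then 1 else 0 else 0
    else codeAdj (n.unpair.1 + 1) i j
termination_by R _ _ => R
decreasing_by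
  · have := Nat.unpair_right_le n; omega
  · have := Nat.unpair_left_le n; omega

theorem codeSize_zero : codeSize 0 = 0 := by rw [codeSize]

theorem codeSize_one : codeSize 1 = 1 := by rw [codeSize]

theorem codeSize_pair (a b : ℕ) :
    codeSize (Nat.pair a b + 2) = codeSize (a + 1) + codeSize (b + 1) := by
  rw [codeSize, Nat.unpair_pair]

theorem codeAdj_one (i j : ℕ) : codeAdj 1 i j = 0 := by rw [codeAdj]

theorem codeAdj_pair (a b i j : ℕ) : codeAdj (Nat.pair a b + 2) i j =
    if codeSize (a + 1) ≤ i then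
      if codeSize (a + 1) ≤ j then codeAdj (b + 1) (i - codeSize (a + 1)) (j - codeSize (a + 1))
      else if i ≤ codeSize (a + 1) then if j ≤ 0 then 1 else 0 else 0
    else if codeSize (a + 1) ≤ j then
      if j ≤ codeSize (a + 1) then if i ≤ 0 then 1 else 0 else 0
    else codeAdj (a + 1) i j := by
  rw [codeAdj, Nat.unpair_pair]

/-- Induction on the structure of nonempty trees. -/
theorem code_induction {p : ℕ → Prop} (one : p 0)
    (pair : ∀ a b, p a → p b → p (Nat.pair a b + 1)) (R : ℕ) : p R := by
  induction R using Nat.strong_induction_on with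
  | _ R ih =>
    rcases R with _ | n
    · exact one
    · have h := pair n.unpair.1 n.unpair.2 (ih _ (Nat.lt_succ_of_le (Nat.unpair_left_le n)))
        (ih _ (Nat.lt_succ_of_le (Nat.unpair_right_le n)))
      rwa [Nat.pair_unpair] at h

theorem codeSize_pos (R : ℕ) : 0 < codeSize (R + 1) := by
  induction R using code_induction with
  | one => simp [zero_add, codeSize_one]
  | pair a b ha hb => rw [add_assoc, codeSize_pair]; omega

/-- This rests on `a + b ≤ Nat.pair a b`. Consequently loops up to a bound on the codes also reach
every vertex number, and time polynomial in the size is polynomial in the code. -/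
theorem codeSize_le (R : ℕ) : codeSize R ≤ R := by
  rcases R with _ | R
  · rw [codeSize_zero]
  induction R using code_induction with
  | one => simp [zero_add, codeSize_one]
  | pair a b ha hb => rw [add_assoc, codeSize_pair]; have := Nat.add_le_pair a b; omega

theorem codeAdj_le_one (R i j : ℕ) : codeAdj R i j ≤ 1 := by
  rcases R with _ | R
  · rw [codeAdj]; omega
  induction R using code_induction generalizing i j with
  | one => simp [zero_add, codeAdj_one]
  | pair a b ha hb =>
    rw [add_assoc, codeAdj_pair]
    split_ifs <;> first | omega | exact ha _ _ | exact hb _ _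

theorem codeAdj_comm (R i j : ℕ) : codeAdj R i j = codeAdj R j i := by
  rcases R with _ | R
  · rw [codeAdj, codeAdj]
  induction R using code_induction generalizing i j with
  | one => simp [zero_add, codeAdj_one]
  | pair a b ha hb =>
    rw [add_assoc, codeAdj_pair, codeAdj_pair]
    split_ifs <;> first | omega | exact ha _ _ | exact hb _ _

theorem codeAdj_self (R i : ℕ) : codeAdj R i i = 0 := by
  rcases R with _ | R
  · rw [codeAdj]
  induction R using code_induction generalizing i with
  | one => simp [zero_add, codeAdj_one]
  | pair a b ha hb =>
    rw [add_assoc, codeAdj_pair]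
    split_ifs <;> first | omega | exact ha _ | exact hb _

/-- The tree with the given code. -/
def codeGraph (R : ℕ) : SimpleGraph (Fin (codeSize R)) where
  Adj i j := codeAdj R i j = 1
  symm := ⟨fun i j h => by rwa [codeAdj_comm]⟩
  loopless := ⟨fun i h => by rw [codeAdj_self] at h; omega⟩

theorem codeGraph_adj (R : ℕ) (i j : Fin (codeSize R)) :
    (codeGraph R).Adj i j ↔ codeAdj R i j = 1 := Iff.rfl

/-- Counting edges: the graph is connected, and the bridge is the one edge that the union of two
trees is short of. -/
theorem SimpleGraph.IsTree.sum_sup_edge {V W : Type*} [Finite V] [Finite W] {G : SimpleGraph V}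
    {G' : SimpleGraph W} (hG : G.IsTree) (hG' : G'.IsTree) (v : V) (w : W) :
    (G.sum G' ⊔ SimpleGraph.edge (.inl v) (.inr w)).IsTree := by
  rw [SimpleGraph.isTree_iff_connected_and_card] at hG hG' ⊢
  refine ⟨hG.1.sum_sup_edge hG'.1, ?_⟩
  have hne : (Sum.inl v : V ⊕ W) ≠ Sum.inr w := Sum.inl_ne_inr
  have hs : s(Sum.inl v, Sum.inr w) ∉ (G.sum G').edgeSet := by
    simp [SimpleGraph.mem_edgeSet]
  have h := Nat.card_congr (SimpleGraph.edgeSetSumEquiv (G := G) (H := G'))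
  rw [Nat.card_sum] at h
  rw [SimpleGraph.edgeSet_sup, SimpleGraph.edgeSet_edge_of_ne hne, Nat.card_coe_set_eq,
    Set.union_singleton, Set.ncard_insert_of_notMem hs (Set.toFinite _), Nat.card_sum,
    ← Nat.card_coe_set_eq]
  omega

/-- The coded tree numbers the upper tree first and the hung tree after it, which is the order of
`finSumFinEquiv`. The bridge joins the two vertices that are numbered `0` in their own trees. -/
theorem codeGraph_isTree (R : ℕ) : (codeGraph (R + 1)).IsTree := by
  induction R using code_induction with
  | one =>
    rw [zero_add]
    have : Subsingleton (Fin (codeSize 1)) := by rw [codeSize_one]; infer_instance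
    have : Nonempty (Fin (codeSize 1)) := by rw [codeSize_one]; infer_instance
    exact SimpleGraph.IsTree.of_subsingleton
  | pair a b ha hb =>
    rw [add_assoc]
    refine SimpleGraph.Iso.isTree_iff
      (G := (codeGraph (a + 1)).sum (codeGraph (b + 1)) ⊔
        SimpleGraph.edge (.inl ⟨0, codeSize_pos a⟩) (.inr ⟨0, codeSize_pos b⟩))
      ⟨finSumFinEquiv.trans (finCongr (codeSize_pair a b).symm), ?_⟩ |>.1
      (ha.sum_sup_edge hb _ _)
    rintro (⟨i, hi⟩ | ⟨i, hi⟩) (⟨j, hj⟩ | ⟨j, hj⟩)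
    · simp [codeGraph_adj, codeAdj_pair, SimpleGraph.edge_adj, hi.not_ge, hj.not_ge]
    · simp [codeGraph_adj, codeAdj_pair, SimpleGraph.edge_adj, hi.not_ge]
      split_ifs <;> simp_all
    · simp [codeGraph_adj, codeAdj_pair, SimpleGraph.edge_adj, hj.not_ge]
      split_ifs <;> simp_all
    · simp [codeGraph_adj, codeAdj_pair, SimpleGraph.edge_adj]

/-- A bound for the codes of the trees with `s` vertices. -/
def codeBound (s : ℕ) : ℕ := Nat.rec 0 (fun _ x => (x + 1) * (x + 1)) s

theorem codeBound_succ (s : ℕ) : codeBound (s + 1) = (codeBound s + 1) * (codeBound s + 1) := rfl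

theorem codeBound_mono : Monotone codeBound := by
  refine monotone_nat_of_le_succ fun s => ?_
  rw [codeBound_succ]; nlinarith

theorem self_le_codeBound (s : ℕ) : s ≤ codeBound s := by
  induction s with
  | zero => exact Nat.zero_le _
  | succ s ih => rw [codeBound_succ]; nlinarith

/-- Both parts of a composed tree are nonempty, so each has fewer vertices than the whole, and
`Nat.pair a b < (max a b + 1) ^ 2` matches the recursion of `codeBound`. This is what makes the
number of shapes a function of `L`. -/
theorem code_le (R : ℕ) : R ≤ codeBound (codeSize R) := by
  rcases R with _ | R
  · exact Nat.zero_le _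
  induction R using code_induction with
  | one => simp [codeSize_one, codeBound]
  | pair a b ha hb =>
    have hpa := codeSize_pos a
    have hpb := codeSize_pos b
    rw [add_assoc, codeSize_pair]
    obtain ⟨s, hs⟩ : ∃ s, codeSize (a + 1) + codeSize (b + 1) = s + 1 :=
      ⟨codeSize (a + 1) + codeSize (b + 1) - 1, by omega⟩
    rw [hs, codeBound_succ]
    have ha' := ha.trans (codeBound_mono (by omega : codeSize (a + 1) ≤ s))
    have hb' := hb.trans (codeBound_mono (by omega : codeSize (b + 1) ≤ s))
    have hm := Nat.pair_lt_max_add_one_sq a b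
    have hmax : max a b + 1 ≤ codeBound s := by omega
    have := Nat.pow_le_pow_left hmax 2
    nlinarith

/-- The code of the component of a vertex, after a piece has been hung below it. -/
def combine (R R' : ℕ) : ℕ :=
  if R ≤ 0 then 0 else if R' ≤ 0 then R else Nat.pair (R - 1) (R' - 1) + 2

/-! ## Values of induced subgraphs -/

namespace GraphMeasure

variable {V : Type} [Finite V]

/-- The value of an induced subgraph. -/
noncomputable def on (H : GraphMeasure) (G : SimpleGraph V) (A : Finset V) : ℝ :=
  H.val (G.induce (A : Set V))

/-- The value of the tree with the given code. -/
noncomputable def codeVal (H : GraphMeasure) (R : ℕ) : ℝ := H.val (codeGraph R)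

variable {H : GraphMeasure}

/-- The empty graph is isomorphic to the disjoint union of two copies of itself, so its value is
twice itself. -/
theorem Additive.val_of_isEmpty (hadd : H.Additive) {W : Type} [IsEmpty W] (G : SimpleGraph W) :
    H.val G = 0 := by
  have h := hadd W W G G
  rw [H.val_eq_of_iso (G.sum G) G ⟨⟨Equiv.equivOfIsEmpty _ _, fun {a} => isEmptyElim a⟩⟩] at h
  linarith

theorem Additive.codeVal_zero (hadd : H.Additive) : H.codeVal 0 = 0 := by
  have : IsEmpty (Fin (codeSize 0)) := by rw [codeSize_zero]; infer_instance
  exact hadd.val_of_isEmpty _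

theorem Additive.on_union (hadd : H.Additive) [DecidableEq V] (G : SimpleGraph V)
    {A B : Finset V} (hAB : Disjoint A B)
    (h : ∀ a ∈ A, ∀ b ∈ B, ¬ G.Adj a b) : H.on G (A ∪ B) = H.on G A + H.on G B := by
  rw [on, on, on, ← hadd]
  apply H.val_eq_of_iso
  have hd : Disjoint (A : Set V) (B : Set V) := by exact_mod_cast hAB
  let e : ((A ∪ B : Finset V) : Set V) ≃ ((A : Set V) ⊕ (B : Set V)) :=
    (Equiv.setCongr (Finset.coe_union A B)).trans (Equiv.Set.union hd)
  have hl : ∀ a, (e.symm (.inl a) : V) = a := fun a => rfl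
  have hr : ∀ b, (e.symm (.inr b) : V) = b := fun b => rfl
  refine ⟨SimpleGraph.Iso.symm ⟨e.symm, ?_⟩⟩
  rintro (⟨a, ha⟩ | ⟨a, ha⟩) (⟨b, hb⟩ | ⟨b, hb⟩)
  · simp [hl]
  · simpa [hl, hr] using h a ha b hb
  · simpa [hl, hr] using fun hab => h b hb a ha hab.symm
  · simp [hr]

end GraphMeasure

/-! ## Partial solutions -/

namespace GraphMeasure

variable {V : Type} [DecidableEq V]

theorem union_sdiff_union {A B S S' : Finset V} (hAB : Disjoint A B) (hS : S ⊆ A) (hS' : S' ⊆ B) :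
    (A ∪ B) \ (S ∪ S') = (A \ S) ∪ (B \ S') := by
  rw [Finset.disjoint_left] at hAB
  ext z
  simp only [Finset.mem_sdiff, Finset.mem_union]
  have := @hS z
  have := @hS' z
  have := @hAB z
  tauto

variable [Finite V]

/-- `S` is a set of deleted vertices of the piece `A`, whose only vertex with neighbors outside the
piece is `v`.  The component of `v` in `A - S` is the tree with code `R`, numbered by `f`, and `x`
is the value of the rest of `A - S`. -/
structure IsPartial (H : GraphMeasure) (G : SimpleGraph V) (A : Finset V) (v : V) (S : Finset V)
    (R : ℕ) (x : ℝ) (f : ℕ → V) : Prop where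
  sub : S ⊆ A
  mem : v ∈ A
  zero_iff : R = 0 ↔ v ∈ S
  root : R ≠ 0 → f 0 = v
  inj : ∀ i < codeSize R, ∀ j < codeSize R, f i = f j → i = j
  adj : ∀ i < codeSize R, ∀ j < codeSize R, (G.Adj (f i) (f j) ↔ codeAdj R i j = 1)
  comp_sub : (Finset.range (codeSize R)).image f ⊆ A \ S
  sep : ∀ a ∈ (Finset.range (codeSize R)).image f,
    ∀ b ∈ (A \ S) \ (Finset.range (codeSize R)).image f, ¬ G.Adj a b
  rest : H.on G ((A \ S) \ (Finset.range (codeSize R)).image f) = x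

variable {H : GraphMeasure} {G : SimpleGraph V} {A B S S' : Finset V} {v w : V} {R R' : ℕ} {x y : ℝ}
  {f g : ℕ → V}

theorem on_image_code (hinj : ∀ i < codeSize R, ∀ j < codeSize R, f i = f j → i = j)
    (hadj : ∀ i < codeSize R, ∀ j < codeSize R, (G.Adj (f i) (f j) ↔ codeAdj R i j = 1)) :
    H.on G ((Finset.range (codeSize R)).image f) = H.codeVal R := by
  symm
  apply H.val_eq_of_iso
  refine ⟨⟨Equiv.ofBijective
    (fun i : Fin (codeSize R) => ⟨f i, by simpa using ⟨(i : ℕ), i.2, rfl⟩⟩) ⟨?_, ?_⟩, ?_⟩⟩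
  · intro i j hij
    exact Fin.ext (hinj i i.2 j j.2 (by simpa using hij))
  · rintro ⟨a, ha⟩
    obtain ⟨i, hi, rfl⟩ := Finset.mem_image.1 (Finset.mem_coe.1 ha)
    exact ⟨⟨i, Finset.mem_range.1 hi⟩, rfl⟩
  · intro i j
    exact hadj i i.2 j j.2

/-- Separation of the component from the rest makes additivity applicable. The set `S` and the
numbering `f` no longer matter, so a table may store `R` and `x` only. -/
theorem IsPartial.on_sdiff (hadd : H.Additive) (h : H.IsPartial G A v S R x f) :
    H.on G (A \ S) = x + H.codeVal R := by
  rw [← h.rest, ← on_image_code h.inj h.adj, add_comm, ← hadd.on_union G Finset.disjoint_sdiff h.sep,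
    Finset.union_sdiff_of_subset h.comp_sub]

theorem IsPartial.root_mem (h : H.IsPartial G A v S R x f) (hR : R ≠ 0) :
    v ∈ (Finset.range (codeSize R)).image f := by
  obtain ⟨R, rfl⟩ := Nat.exists_eq_succ_of_ne_zero hR
  exact Finset.mem_image.2 ⟨0, Finset.mem_range.2 (codeSize_pos R), h.root hR⟩

/-- Hanging the piece `B` below the vertex `v` of the piece `A`. -/
theorem IsPartial.merge (hadd : H.Additive) (h : H.IsPartial G A v S R x f)
    (h' : H.IsPartial G B w S' R' y g) (hAB : Disjoint A B) (hvw : G.Adj v w)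
    (hcross : ∀ a ∈ A, ∀ b ∈ B, G.Adj a b → a = v ∧ b = w) :
    ∃ f', H.IsPartial G (A ∪ B) v (S ∪ S') (combine R R')
      (x + y + H.codeVal (if R ≤ 0 then R' else 0)) f' := by
  have hd := Finset.disjoint_left.1 hAB
  have hU := union_sdiff_union hAB h.sub h'.sub
  have hdS : Disjoint (A \ S) (B \ S') :=
    Finset.disjoint_of_subset_left Finset.sdiff_subset
      (Finset.disjoint_of_subset_right Finset.sdiff_subset hAB)
  have hmem : v ∈ S ∪ S' ↔ v ∈ S := by
    rw [Finset.mem_union, or_iff_left]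
    exact fun hv => hd h.mem (h'.sub hv)
  have hsub : S ∪ S' ⊆ A ∪ B := Finset.union_subset_union h.sub h'.sub
  have hmemU : v ∈ A ∪ B := Finset.mem_union_left _ h.mem
  -- If `v` is deleted, nothing above can reach `w` any more: the component of `w` is final, and its
  -- value is paid now.
  by_cases hR : R = 0
  · have hv := h.zero_iff.1 hR
    subst hR
    have hc : combine 0 R' = 0 := by simp [combine]
    rw [hc, if_pos le_rfl]
    have he : (Finset.range (codeSize 0)).image f = ∅ := by simp [codeSize_zero]
    refine ⟨f, hsub, hmemU, ?_, by simp, by simp [codeSize_zero], by simp [codeSize_zero], ?_, ?_, ?_⟩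
    · simp [hmem, hv]
    · simp [he]
    · simp [he]
    · rw [he, Finset.sdiff_empty, hU, hadd.on_union G hdS, h.on_sdiff hadd, h'.on_sdiff hadd,
        hadd.codeVal_zero]
      · ring
      · intro a ha b hb hab
        obtain ⟨rfl, -⟩ := hcross a (Finset.mem_sdiff.1 ha).1 b (Finset.mem_sdiff.1 hb).1 hab
        exact (Finset.mem_sdiff.1 ha).2 hv
  · rw [if_neg (by omega), hadd.codeVal_zero, add_zero]
    have hvC := h.root_mem hR
    -- If `v` is kept and `w` is deleted, the component of `v` does not change and all of `B \ S'`
    -- belongs to the rest.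
    by_cases hR' : R' = 0
    · have hw := h'.zero_iff.1 hR'
      subst hR'
      have hc : combine R 0 = R := by simp [combine]; omega
      have hno : ∀ a ∈ A, ∀ b ∈ B \ S', ¬ G.Adj a b := by
        intro a ha b hb hab
        obtain ⟨-, rfl⟩ := hcross a ha b (Finset.mem_sdiff.1 hb).1 hab
        exact (Finset.mem_sdiff.1 hb).2 hw
      have hrest : (A \ S ∪ B \ S') \ (Finset.range (codeSize R)).image f =
          (A \ S) \ (Finset.range (codeSize R)).image f ∪ B \ S' := by
        rw [Finset.union_sdiff_distrib]
        congr 1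
        exact Finset.sdiff_eq_self_of_disjoint
          (Finset.disjoint_of_subset_right h.comp_sub hdS.symm)
      rw [hc]
      refine ⟨f, hsub, hmemU, by rw [hmem, h.zero_iff], h.root, h.inj, h.adj, ?_, ?_, ?_⟩
      · rw [hU]
        exact h.comp_sub.trans Finset.subset_union_left
      · rw [hU, hrest]
        intro a ha b hb
        rcases Finset.mem_union.1 hb with hb | hb
        · exact h.sep a ha b hb
        · exact hno a (Finset.mem_sdiff.1 (h.comp_sub ha)).1 b hb
      · rw [hU, hrest, hadd.on_union G, h.rest, h'.on_sdiff hadd, hadd.codeVal_zero, add_zero]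
        · exact Finset.disjoint_of_subset_left Finset.sdiff_subset hdS
        · intro a ha b hb
          exact hno a (Finset.mem_sdiff.1 (Finset.mem_sdiff.1 ha).1).1 b hb
    -- If both are kept, the edge `vw` joins their components into one, and no value is final yet.
    · have hwC := h'.root_mem hR'
      obtain ⟨a, rfl⟩ := Nat.exists_eq_succ_of_ne_zero hR
      obtain ⟨b, rfl⟩ := Nat.exists_eq_succ_of_ne_zero hR'
      have hc : combine (a + 1) (b + 1) = Nat.pair a b + 2 := by simp [combine]
      have ha0 := codeSize_pos a
      have hb0 := codeSize_pos b
      simp only [Nat.succ_eq_add_one] at *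
      rw [hc]
      set C := (Finset.range (codeSize (a + 1))).image f with hC
      set D := (Finset.range (codeSize (b + 1))).image g with hD
      have hfA : ∀ i < codeSize (a + 1), f i ∈ A \ S := fun i hi =>
        h.comp_sub (Finset.mem_image_of_mem f (Finset.mem_range.2 hi))
      have hgB : ∀ i < codeSize (b + 1), g i ∈ B \ S' := fun i hi =>
        h'.comp_sub (Finset.mem_image_of_mem g (Finset.mem_range.2 hi))
      have hfgne : ∀ i < codeSize (a + 1), ∀ j < codeSize (b + 1), f i ≠ g j := fun i hi j hj hij =>
        Finset.disjoint_left.1 hdS (hfA i hi) (hij ▸ hgB j hj)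
      -- The only edge between the pieces is `vw`, and by injectivity only the number `0` belongs to
      -- `v` or to `w`.
      have hfg : ∀ i < codeSize (a + 1), ∀ j < codeSize (b + 1),
          (G.Adj (f i) (g j) ↔ i = 0 ∧ j = 0) := by
        intro i hi j hj
        constructor
        · intro hij
          obtain ⟨h1, h2⟩ := hcross _ (Finset.mem_sdiff.1 (hfA i hi)).1 _
            (Finset.mem_sdiff.1 (hgB j hj)).1 hij
          exact ⟨h.inj i hi 0 ha0 (h1.trans (h.root hR).symm),
            h'.inj j hj 0 hb0 (h2.trans (h'.root hR').symm)⟩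
        · rintro ⟨rfl, rfl⟩
          rw [h.root hR, h'.root hR']
          exact hvw
      -- Concatenating the two numberings reproduces the case distinction of `codeAdj` on a composed
      -- code.
      let F : ℕ → V := fun i => if codeSize (a + 1) ≤ i then g (i - codeSize (a + 1)) else f i
      have hF1 : ∀ i < codeSize (a + 1), F i = f i := fun i hi => if_neg hi.not_ge
      have hF2 : ∀ i, codeSize (a + 1) ≤ i → F i = g (i - codeSize (a + 1)) := fun i hi => if_pos hi
      have himg : (Finset.range (codeSize (Nat.pair a b + 2))).image F = C ∪ D := by
        rw [codeSize_pair]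
        ext z
        simp only [hC, hD, Finset.mem_image, Finset.mem_range, Finset.mem_union]
        constructor
        · rintro ⟨i, hi, rfl⟩
          rcases lt_or_ge i (codeSize (a + 1)) with hia | hia
          · exact .inl ⟨i, hia, (hF1 i hia).symm⟩
          · exact .inr ⟨i - codeSize (a + 1), by omega, (hF2 i hia).symm⟩
        · rintro (⟨i, hi, rfl⟩ | ⟨i, hi, rfl⟩)
          · exact ⟨i, by omega, hF1 i hi⟩
          · exact ⟨codeSize (a + 1) + i, by omega, by rw [hF2 _ (by omega), Nat.add_sub_cancel_left]⟩
      have hsubU : C ∪ D ⊆ A \ S ∪ B \ S' := Finset.union_subset_union h.comp_sub h'.comp_sub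
      have hrest : (A \ S ∪ B \ S') \ (C ∪ D) = ((A \ S) \ C) ∪ ((B \ S') \ D) :=
        union_sdiff_union hdS h.comp_sub h'.comp_sub
      refine ⟨F, hsub, hmemU, by rw [hmem, ← h.zero_iff]; simp, fun _ => ?_, ?_, ?_, ?_, ?_, ?_⟩
      · rw [hF1 0 ha0, h.root hR]
      · rw [codeSize_pair]
        intro i hi j hj hij
        rcases lt_or_ge i (codeSize (a + 1)) with hia | hia <;>
          rcases lt_or_ge j (codeSize (a + 1)) with hja | hja
        · rw [hF1 i hia, hF1 j hja] at hij
          exact h.inj i hia j hja hij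
        · rw [hF1 i hia, hF2 j hja] at hij
          exact absurd hij (hfgne i hia _ (by omega))
        · rw [hF2 i hia, hF1 j hja] at hij
          exact absurd hij.symm (hfgne j hja _ (by omega))
        · rw [hF2 i hia, hF2 j hja] at hij
          have := h'.inj _ (by omega) _ (by omega) hij
          omega
      · rw [codeSize_pair]
        intro i hi j hj
        rw [codeAdj_pair]
        rcases lt_or_ge i (codeSize (a + 1)) with hia | hia <;>
          rcases lt_or_ge j (codeSize (a + 1)) with hja | hja
        · rw [hF1 i hia, hF1 j hja, if_neg hia.not_ge, if_neg hja.not_ge]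
          exact h.adj i hia j hja
        · rw [hF1 i hia, hF2 j hja, if_neg hia.not_ge, if_pos hja, hfg i hia _ (by omega)]
          split_ifs <;> simp <;> omega
        · rw [hF2 i hia, hF1 j hja, if_pos hia, if_neg hja.not_ge, G.adj_comm,
            hfg j hja _ (by omega)]
          split_ifs <;> simp <;> omega
        · rw [hF2 i hia, hF2 j hja, if_pos hia, if_pos hja]
          exact h'.adj _ (by omega) _ (by omega)
      · rw [himg, hU]
        exact hsubU
      · rw [himg, hU, hrest]
        intro z hz z' hz' hzz
        rcases Finset.mem_union.1 hz with hz | hz <;> rcases Finset.mem_union.1 hz' with hz' | hz'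
        · exact h.sep z hz z' hz' hzz
        · obtain ⟨-, rfl⟩ := hcross z (Finset.mem_sdiff.1 (h.comp_sub hz)).1 z'
            (Finset.mem_sdiff.1 (Finset.mem_sdiff.1 hz').1).1 hzz
          exact (Finset.mem_sdiff.1 hz').2 hwC
        · obtain ⟨rfl, -⟩ := hcross z' (Finset.mem_sdiff.1 (Finset.mem_sdiff.1 hz').1).1 z
            (Finset.mem_sdiff.1 (h'.comp_sub hz)).1 hzz.symm
          exact (Finset.mem_sdiff.1 hz').2 hvC
        · exact h'.sep z hz z' hz' hzz
      · rw [himg, hU, hrest, hadd.on_union G, h.rest, h'.rest]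
        · exact Finset.disjoint_of_subset_left Finset.sdiff_subset
            (Finset.disjoint_of_subset_right Finset.sdiff_subset hdS)
        · intro z hz z' hz' hzz
          obtain ⟨rfl, -⟩ := hcross z (Finset.mem_sdiff.1 (Finset.mem_sdiff.1 hz).1).1 z'
            (Finset.mem_sdiff.1 (Finset.mem_sdiff.1 hz').1).1 hzz
          exact (Finset.mem_sdiff.1 hz).2 hvC

theorem isPartial_delete (hadd : H.Additive) (v : V) (f : ℕ → V) :
    H.IsPartial G {v} v {v} 0 0 f where
  sub := le_rfl
  mem := Finset.mem_singleton_self v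
  zero_iff := by simp
  root := by simp
  inj := by simp [codeSize_zero]
  adj := by simp [codeSize_zero]
  comp_sub := by simp [codeSize_zero]
  sep := by simp [codeSize_zero]
  rest := by
    simp only [sdiff_self, codeSize_zero, Finset.range_zero, Finset.image_empty, Finset.bot_eq_empty]
    have : IsEmpty ((∅ : Finset V) : Set V) := by simp
    exact hadd.val_of_isEmpty _

theorem isPartial_keep (hadd : H.Additive) (v : V) :
    H.IsPartial G {v} v ∅ 1 0 fun _ => v where
  sub := Finset.empty_subset _
  mem := Finset.mem_singleton_self v
  zero_iff := by simp
  root := by simp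
  inj := by simp [codeSize_one]
  adj := by simp [codeSize_one, codeAdj_one]
  comp_sub := by simp [codeSize_one]
  sep := by simp [codeSize_one]
  rest := by
    have he : (({v} : Finset V) \ ∅) \ (Finset.range (codeSize 1)).image (fun _ => v) = ∅ := by
      simp [codeSize_one]
    rw [he]
    have : IsEmpty ((∅ : Finset V) : Set V) := by simp
    exact hadd.val_of_isEmpty _

/-- The component recorded in a partial solution is contained in a component of the whole graph. -/
theorem IsPartial.codeSize_le_of_isTrimming {L : ℕ} {S₀ : Finset V}
    (h : H.IsPartial G A v (S₀ ∩ A) R x f) (hS : IsTrimming G L S₀) : codeSize R ≤ L := by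
  rcases R with _ | R
  · simp [codeSize_zero]
  have hf : ∀ i < codeSize (R + 1), f i ∉ S₀ := by
    intro i hi hmem
    have := Finset.mem_sdiff.1 (h.comp_sub (Finset.mem_image_of_mem f (Finset.mem_range.2 hi)))
    exact this.2 (Finset.mem_inter.2 ⟨hmem, this.1⟩)
  let φ : codeGraph (R + 1) →g deleteVertices G S₀ :=
    { toFun := fun i => ⟨f i, by simpa using hf i i.2⟩
      map_rel' := fun {i j} hij => (h.adj i i.2 j j.2).2 hij }
  let r : Fin (codeSize (R + 1)) := ⟨0, codeSize_pos R⟩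
  have hφ : Function.Injective φ := fun i j hij =>
    Fin.ext (h.inj i i.2 j j.2 (congrArg Subtype.val hij))
  -- The coded tree is connected, so its injective image in `G - S₀` lies in a single component,
  -- whose size is bounded by hypothesis.
  have hsub : Set.range φ ⊆ ((deleteVertices G S₀).connectedComponentMk (φ r)).supp := by
    rintro _ ⟨i, rfl⟩
    rw [SimpleGraph.ConnectedComponent.mem_supp_iff, SimpleGraph.ConnectedComponent.eq]
    exact ((codeGraph_isTree R).1.preconnected i r).map φ
  have hcard := Set.ncard_le_ncard hsub (Set.toFinite _)
  rw [← Set.image_univ, Set.ncard_image_of_injective _ hφ, Set.ncard_univ, Nat.card_fin] at hcard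
  have := hS ((deleteVertices G S₀).connectedComponentMk (φ r))
  exact hcard.trans (by exact_mod_cast this)

end GraphMeasure

/-! ## Partitions of a tree into pieces -/

/-- The pieces `A v`, for `v ∈ Al`, partition the vertices of `T`, and each edge between two of them
joins `v` and `w`, if the pieces are `A v` and `A w`. -/
structure IsPieces {V : Type} (T : SimpleGraph V) (Al : Finset V) (A : V → Finset V) :
    Prop where
  self : ∀ v ∈ Al, v ∈ A v
  cover : ∀ x, ∃ v ∈ Al, x ∈ A v
  disj : ∀ v ∈ Al, ∀ w ∈ Al, v ≠ w → Disjoint (A v) (A w)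
  edge : ∀ v ∈ Al, ∀ w ∈ Al, v ≠ w → ∀ x ∈ A v, ∀ y ∈ A w, T.Adj x y → x = v ∧ y = w

namespace IsPieces

variable {V : Type} {T : SimpleGraph V} {Al : Finset V} {A : V → Finset V}

theorem singletons [Fintype V] (T : SimpleGraph V) : IsPieces T Finset.univ fun v => {v} where
  self v _ := Finset.mem_singleton_self v
  cover x := ⟨x, Finset.mem_univ x, Finset.mem_singleton_self x⟩
  disj v _ w _ h := by simpa using h
  edge v _ w _ _ x hx y hy _ := ⟨Finset.mem_singleton.1 hx, Finset.mem_singleton.1 hy⟩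

/-- An edge that leaves `A u` starts at `u` and ends at another representative, which can only be
`p`. Hence every edge that leaves the union starts at `p`. -/
theorem merge [DecidableEq V] (h : IsPieces T Al A) {u p : V} (hu : u ∈ Al) (hp : p ∈ Al) (hup : T.Adj u p)
    (hleaf : ∀ w ∈ Al, T.Adj u w → w = p) :
    IsPieces T (Al.erase u) (Function.update A p (A p ∪ A u)) := by
  have hne : p ≠ u := hup.ne'
  have key : ∀ w ∈ Al, w ≠ u → w ≠ p → ∀ x ∈ A p ∪ A u, ∀ y ∈ A w, T.Adj x y → x = p ∧ y = w := by
    intro w hw hwu hwp x hx y hy hxy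
    rcases Finset.mem_union.1 hx with hx | hx
    · exact h.edge p hp w hw hwp.symm x hx y hy hxy
    · obtain ⟨rfl, rfl⟩ := h.edge u hu w hw hwu.symm x hx y hy hxy
      exact absurd (hleaf y hw hxy) hwp
  refine ⟨?_, ?_, ?_, ?_⟩
  · intro v hv
    obtain ⟨hvu, hv⟩ := Finset.mem_erase.1 hv
    by_cases hvp : v = p
    · subst hvp; simp [h.self v hv]
    · simp [hvp, h.self v hv]
  · intro x
    obtain ⟨v, hv, hx⟩ := h.cover x
    by_cases hvu : v = u
    · subst hvu
      exact ⟨p, Finset.mem_erase.2 ⟨hne, hp⟩, by simp [hx]⟩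
    · refine ⟨v, Finset.mem_erase.2 ⟨hvu, hv⟩, ?_⟩
      by_cases hvp : v = p
      · subst hvp; simp [hx]
      · simpa [hvp] using hx
  · intro v hv w hw hvw
    obtain ⟨hvu, hv⟩ := Finset.mem_erase.1 hv
    obtain ⟨hwu, hw⟩ := Finset.mem_erase.1 hw
    by_cases hvp : v = p
    · subst hvp
      simp [hvw.symm, Finset.disjoint_union_left, h.disj v hv w hw hvw, h.disj u hu w hw hwu.symm]
    · by_cases hwp : w = p
      · subst hwp
        simp [hvw, Finset.disjoint_union_right, h.disj v hv w hw hvw, h.disj v hv u hu hvu]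
      · simp [hvp, hwp, h.disj v hv w hw hvw]
  · intro v hv w hw hvw x hx y hy hxy
    obtain ⟨hvu, hv⟩ := Finset.mem_erase.1 hv
    obtain ⟨hwu, hw⟩ := Finset.mem_erase.1 hw
    by_cases hvp : v = p
    · subst hvp
      rw [Function.update_self] at hx
      rw [Function.update_of_ne hvw.symm] at hy
      exact key w hw hwu hvw.symm x hx y hy hxy
    · rw [Function.update_of_ne hvp] at hx
      by_cases hwp : w = p
      · subst hwp
        rw [Function.update_self] at hy
        exact (key v hv hvu hvp y hy x hx hxy.symm).symm
      · rw [Function.update_of_ne hwp] at hy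
        exact h.edge v hv w hw hvw x hx y hy hxy

/-- Send each vertex to the representative of its piece. An edge of `T` either collapses or becomes
itself an edge between representatives, so walks in `T` project to reachability among
representatives. -/
theorem connected (h : IsPieces T Al A) (hT : T.Connected) :
    (T.induce (Al : Set V)).Connected := by
  choose π hπ hmem using h.cover
  have huniq : ∀ v ∈ Al, ∀ x ∈ A v, π x = v := by
    intro v hv x hx
    by_contra hne
    exact Finset.disjoint_left.1 (h.disj _ (hπ x) v hv hne) (hmem x) hx
  have hadj : ∀ x y, T.Adj x y → (T.induce (Al : Set V)).Reachable ⟨π x, hπ x⟩ ⟨π y, hπ y⟩ := by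
    intro x y hxy
    by_cases hne : π x = π y
    · simp only [hne]; rfl
    · obtain ⟨hx, hy⟩ := h.edge _ (hπ x) _ (hπ y) hne x (hmem x) y (hmem y) hxy
      refine SimpleGraph.Adj.reachable ?_
      rw [hx, hy] at hxy
      exact hxy
  have hreach : ∀ x y, T.Reachable x y →
      (T.induce (Al : Set V)).Reachable ⟨π x, hπ x⟩ ⟨π y, hπ y⟩ := by
    rintro x y ⟨p⟩
    induction p with
    | nil => rfl
    | cons hxy _ ih => exact (hadj _ _ hxy).trans ih
  obtain ⟨x₀⟩ := hT.nonempty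
  have : Nonempty (Al : Set V) := ⟨⟨π x₀, hπ x₀⟩⟩
  refine ⟨fun ⟨x, hx⟩ ⟨y, hy⟩ => ?_⟩
  have hx' := huniq x hx x (h.self x hx)
  have hy' := huniq y hy y (h.self y hy)
  have := hreach x y (hT.preconnected x y)
  simpa only [hx', hy'] using this

/-- The representatives induce a connected acyclic graph, and a tree with at least two vertices has
a vertex of degree one. -/
theorem exists_leaf (h : IsPieces T Al A) (hT : T.IsTree) (hcard : 2 ≤ Al.card) :
    ∃ u ∈ Al, ∃ p ∈ Al, T.Adj u p ∧ ∀ w ∈ Al, T.Adj u w → w = p := by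
  classical
  have htree : (T.induce (Al : Set V)).IsTree := ⟨h.connected hT.1, hT.2.induce _⟩
  have : Nontrivial (Al : Set V) := by
    exact Set.nontrivial_coe_sort.2 (Finset.one_lt_card_iff_nontrivial.1 hcard)
  obtain ⟨⟨u, hu⟩, hdeg⟩ := htree.exists_vert_degree_one_of_nontrivial
  obtain ⟨⟨p, hp⟩, hup, huniq⟩ := SimpleGraph.degree_eq_one_iff_existsUnique_adj.1 hdeg
  refine ⟨u, hu, p, hp, hup, fun w hw huw => ?_⟩
  have := huniq ⟨w, hw⟩ huw
  simpa using this

end IsPieces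

/-! ## Reasoning about commands -/

theorem iter_inv {b : ℕ} {f : ℕ → Heap → Heap} (I : ℕ → Heap → Prop) {m : Heap} (h0 : I 0 m)
    (hstep : ∀ i < b, ∀ m, I i m → I (i + 1) (f i m)) : I b (iter b f m) := by
  induction b with
  | zero => exact h0
  | succ b ih => exact hstep b (Nat.lt_succ_self b) _ (ih fun i hi => hstep i (by omega))

/-- The pattern for a loop that searches or fills an array: under the invariant `J`, round `i₀`
achieves `Q` whatever happened before, and no later round destroys it. -/
theorem iter_establish {b : ℕ} {f : ℕ → Heap → Heap} (J Q : Heap → Prop) {i₀ : ℕ} (hi₀ : i₀ < b)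
    (hJ : ∀ i < b, ∀ m, J m → J (f i m)) (hQ : ∀ i < b, ∀ m, J m → Q m → Q (f i m))
    (h₀ : ∀ m, J m → Q (f i₀ m)) {m : Heap} (hm : J m) : J (iter b f m) ∧ Q (iter b f m) := by
  have h := iter_inv (b := b) (f := f) (fun i m => J m ∧ (i₀ < i → Q m)) (m := m)
    ⟨hm, fun h => absurd h (Nat.not_lt_zero _)⟩ fun i hi m' h' => by
      refine ⟨hJ i hi m' h'.1, fun hlt => ?_⟩
      rcases Nat.lt_or_ge i₀ i with h'' | h''
      · exact hQ i hi m' h'.1 (h'.2 h'')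
      · obtain rfl : i = i₀ := by omega
        exact h₀ m' h'.1
  exact ⟨h.1, h.2 hi₀⟩

theorem iter_inv₂ {b b' : ℕ} {f : ℕ → ℕ → Heap → Heap} (J : Heap → Prop)
    (hJ : ∀ i < b, ∀ j < b', ∀ m, J m → J (f i j m)) {m : Heap} (hm : J m) :
    J (iter b (fun i => iter b' (f i)) m) :=
  iter_inv (fun _ => J) hm fun i hi _ hm => iter_inv (fun _ => J) hm fun j hj _ => hJ i hi j hj _

theorem iter_establish₂ {b b' : ℕ} {f : ℕ → ℕ → Heap → Heap} (J Q : Heap → Prop) {i₀ j₀ : ℕ}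
    (hi₀ : i₀ < b) (hj₀ : j₀ < b') (hJ : ∀ i < b, ∀ j < b', ∀ m, J m → J (f i j m))
    (hQ : ∀ i < b, ∀ j < b', ∀ m, J m → Q m → Q (f i j m)) (h₀ : ∀ m, J m → Q (f i₀ j₀ m))
    {m : Heap} (hm : J m) : Q (iter b (fun i => iter b' (f i)) m) := by
  refine (iter_establish J Q hi₀ ?_ ?_ ?_ hm).2
  · exact fun i hi m hm => iter_inv (fun _ => J) hm fun j hj _ => hJ i hi j hj _
  · exact fun i hi m hm hq => (iter_inv (fun _ m => J m ∧ Q m) ⟨hm, hq⟩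
      fun j hj _ h => ⟨hJ i hi j hj _ h.1, hQ i hi j hj _ h.1 h.2⟩).2
  · exact fun m hm => (iter_establish J Q hj₀ (hJ i₀ hi₀) (hQ i₀ hi₀) h₀ hm).2

@[simp] theorem Heap.setN_nat (m : Heap) (a x b : ℕ) :
    (m.setN a x).nat b = if b = a then x else m.nat b := by
  simp [Heap.setN, Function.update_apply]

@[simp] theorem Heap.setN_real (m : Heap) (a x : ℕ) : (m.setN a x).real = m.real := rfl

@[simp] theorem Heap.setN_real_apply (m : Heap) (a x b : ℕ) : (m.setN a x).real b = m.real b := rfl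

@[simp] theorem Heap.setR_nat (m : Heap) (a : ℕ) (x : ℝ) : (m.setR a x).nat = m.nat := rfl

@[simp] theorem Heap.setR_real (m : Heap) (a : ℕ) (x : ℝ) (b : ℕ) :
    (m.setR a x).real b = if b = a then x else m.real b := by
  simp [Heap.setR, Function.update_apply]

theorem Heap.setN_eq_self {m : Heap} {a x : ℕ} (h : m.nat a = x) : m.setN a x = m := by
  subst h; simp [Heap.setN]

theorem Heap.setN_setN (m : Heap) (a x y : ℕ) : (m.setN a x).setN a y = m.setN a y := by
  simp [Heap.setN]

/-- The pairing function as an expression. -/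
def NExpr.pair (a b : NExpr) : NExpr :=
  .ite b a (.add (.add (.mul a a) a) b) (.add (.mul b b) a)

@[simp] theorem NExpr.value_pair (s : ℕ) (inp : ℕ → ℕ) (env : List ℕ) (m : Heap) (a b : NExpr) :
    (NExpr.pair a b).value s inp env m =
      Nat.pair (a.value s inp env m) (b.value s inp env m) := by
  simp only [NExpr.pair, NExpr.value, Nat.pair]
  split_ifs <;> first | rfl | omega

/-! ## Layout of the heap -/

/-- Address of a cell of a one-dimensional array. -/
abbrev loc (id i : ℕ) : ℕ := Nat.pair id i

/-- Address of a cell of a two-dimensional array. -/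
abbrev loc₂ (id i j : ℕ) : ℕ := Nat.pair id (Nat.pair i j)

/-- Address of a cell of a three-dimensional array. -/
abbrev loc₃ (id i j l : ℕ) : ℕ := Nat.pair id (Nat.pair i (Nat.pair j l))

namespace Heap

/-- The scalar variables. -/
abbrev scal (m : Heap) (i : ℕ) : ℕ := m.nat (loc 0 i)

/-- The sizes of the trees. -/
abbrev size (m : Heap) (R : ℕ) : ℕ := m.nat (loc 1 R)

/-- The adjacency matrices of the trees. -/
abbrev adj (m : Heap) (R i j : ℕ) : ℕ := m.nat (loc₃ 2 R i j)

/-- Which entries of a table are present. -/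
abbrev valid (m : Heap) (t R j : ℕ) : ℕ := m.nat (loc₃ 3 t R j)

/-- The table of a piece. -/
abbrev table (m : Heap) (v : ℕ) : ℕ := m.nat (loc 4 v)

/-- Which vertices have been merged into another piece. -/
abbrev dead (m : Heap) (v : ℕ) : ℕ := m.nat (loc 5 v)

/-- The memory in which the value of a tree is computed. -/
abbrev work (m : Heap) (R a : ℕ) : ℝ := m.real (loc₂ 0 R a)

/-- The values of the trees. -/
abbrev val (m : Heap) (R : ℕ) : ℝ := m.real (loc 1 R)

/-- The entries of the tables. -/
abbrev entry (m : Heap) (t R j : ℕ) : ℝ := m.real (loc₃ 2 t R j)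

/-- The target. -/
abbrev target (m : Heap) : ℝ := m.real (loc 3 0)

end Heap

namespace Cmd

/-- Address expressions. -/
abbrev at₁ (id : ℕ) (i : NExpr) : NExpr := .pair (.lit id) i

/-- Address expressions. -/
abbrev at₂ (id : ℕ) (i j : NExpr) : NExpr := .pair (.lit id) (.pair i j)

/-- Address expressions. -/
abbrev at₃ (id : ℕ) (i j l : NExpr) : NExpr := .pair (.lit id) (.pair i (.pair j l))

/-- Run `c` if two expressions have the same value. -/
def ifEq (a b : NExpr) (c : Cmd) : Cmd := ifN a b (ifN b a c skip) skip

theorem run_ifEq (s : ℕ) (inp : ℕ → ℕ) (env : List ℕ) (m : Heap) (a b : NExpr) (c : Cmd) :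
    (ifEq a b c).run s inp env m =
      if a.value s inp env m = b.value s inp env m then c.run s inp env m else m := by
  simp only [ifEq, Cmd.run]
  split_ifs <;> first | rfl | omega

/-- Compute `⌈n / k⌉`; the variables are `n` and `k`. -/
def ceilDiv : Cmd :=
  loop 0 (ifN (.add (.mul (.var 2) (.var 1)) (.lit 1)) (.var 0)
    (setN (at₁ 0 (.lit 0)) (.add (.var 2) (.lit 1))) skip)

/-- Compute `codeBound L`; the variables are `n`, `k`, `L`. -/
def bound : Cmd :=
  loop 2 (setN (at₁ 0 (.lit 1)) (.mul (.add (.get (at₁ 0 (.lit 1))) (.lit 1))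
    (.add (.get (at₁ 0 (.lit 1))) (.lit 1))))

/-- The size of the tree whose code is the value of `a`, plus one. -/
abbrev sizeSucc (a : NExpr) : NExpr := .get (at₁ 1 (.add a (.lit 1)))

/-- An entry of the adjacency matrix of a tree that is composed of two trees. -/
def adjExpr : NExpr :=
  .ite (sizeSucc (.var 5)) (.var 7)
    (.ite (sizeSucc (.var 5)) (.var 8)
      (.get (at₃ 2 (.add (.var 6) (.lit 1)) (.sub (.var 7) (sizeSucc (.var 5)))
        (.sub (.var 8) (sizeSucc (.var 5)))))
      (.ite (.var 7) (sizeSucc (.var 5)) (.ite (.var 8) (.lit 0) (.lit 1) (.lit 0)) (.lit 0)))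
    (.ite (sizeSucc (.var 5)) (.var 8)
      (.ite (.var 8) (sizeSucc (.var 5)) (.ite (.var 7) (.lit 0) (.lit 1) (.lit 0)) (.lit 0))
      (.get (at₃ 2 (.add (.var 5) (.lit 1)) (.var 7) (.var 8))))

/-- Fill in the size and the adjacency matrix of one tree. -/
def tree : Cmd :=
  seq (setN (at₁ 1 (.add (.var 4) (.lit 2))) (.add (sizeSucc (.var 5)) (sizeSucc (.var 6))))
    (loop 3 (loop 3 (setN (at₃ 2 (.add (.var 4) (.lit 2)) (.var 7) (.var 8)) adjExpr)))

/-- Compute the sizes and the adjacency matrices of the trees with codes below `W`; the variables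
are `n`, `k`, `L`, `W`. -/
def trees : Cmd :=
  seq (setN (at₁ 1 (.lit 1)) (.lit 1))
    (loop 3 (loop 3 (loop 3 (ifEq (.pair (.var 5) (.var 6)) (.var 4) tree))))

/-- Write the adjacency matrices of the trees with codes below `W` to memory. -/
def matrices : Cmd :=
  loop 3 (loop 3 (loop 3
    (ifN (.add (.var 5) (.lit 1)) (.get (at₁ 1 (.var 4)))
      (ifN (.add (.var 6) (.lit 1)) (.get (at₁ 1 (.var 4)))
        (setR (at₂ 0 (.var 4) (.add (.mul (.var 5) (.get (at₁ 1 (.var 4)))) (.var 6)))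
          (.ofN (.get (at₃ 2 (.var 4) (.var 5) (.var 6)))))
        skip)
      skip)))

variable {s : ℕ} {inp : ℕ → ℕ} {n k L W : ℕ} {m : Heap}

/-- The language has no division. The last `i` with `i * k < n` is overwritten into the result as `i
+ 1`, and `i < n` is a sufficient range because `k ≥ 1`. -/
theorem run_ceilDiv (hk : 1 ≤ k) (hkn : k ≤ n) (hm : m.scal 0 = 0) :
    ∃ x, ceilDiv.run s inp [n, k] m = m.setN (loc 0 0) x ∧ n ≤ x * k ∧ x * k < n + k := by
  have h : ∃ x, iter n (fun i m => if i * k + 1 ≤ n then m.setN (loc 0 0) (i + 1) else m) m =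
      m.setN (loc 0 0) x ∧ n ≤ x * k ∧ x * k < n + k := by
    have := iter_inv (b := n)
      (f := fun i m => if i * k + 1 ≤ n then m.setN (loc 0 0) (i + 1) else m)
      -- Either the test has succeeded in every round so far, or the result is already large enough
      -- and stays fixed.
      (fun i m' => ∃ x, m' = m.setN (loc 0 0) x ∧ x ≤ i ∧ (x = i ∨ n ≤ x * k) ∧ x * k < n + k)
      (m := m) ⟨0, ?_, le_rfl, .inl rfl, by omega⟩ ?_
    · obtain ⟨x, hx, -, hx', hx''⟩ := this
      refine ⟨x, hx, ?_, hx''⟩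
      rcases hx' with rfl | hx'
      · nlinarith
      · exact hx'
    · exact (Heap.setN_eq_self hm).symm
    · rintro i hi _ ⟨x, rfl, hxi, hx, hx'⟩
      split_ifs with hc
      · refine ⟨i + 1, Heap.setN_setN _ _ _ _, le_rfl, .inl rfl, ?_⟩
        rw [add_mul]; omega
      · refine ⟨x, rfl, by omega, .inr ?_, hx'⟩
        rcases hx with rfl | hx
        · omega
        · exact hx
  simpa [ceilDiv, Cmd.run, NExpr.value] using h

theorem run_bound (hm : m.scal 1 = 0) :
    bound.run s inp [n, k, L] m = m.setN (loc 0 1) (codeBound L) := by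
  have h := iter_inv (b := L)
    (f := fun _ m => m.setN (loc 0 1) ((m.scal 1 + 1) * (m.scal 1 + 1)))
    (fun i m' => m' = m.setN (loc 0 1) (codeBound i)) (m := m) ?_ ?_
  · simpa [bound, Cmd.run, NExpr.value] using h
  · exact (Heap.setN_eq_self hm).symm
  · rintro i hi _ rfl
    rw [Heap.setN_setN, codeBound_succ]
    simp

/-- The sizes and adjacency matrices of the trees with codes below `c` have been computed, and no
other array has been changed. -/
structure TreesDone (W c : ℕ) (m₀ m : Heap) : Prop where
  size : ∀ R < c, m.size R = codeSize R
  adj : ∀ R < c, ∀ i < W, ∀ j < W, m.adj R i j = codeAdj R i j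
  real : m.real = m₀.real
  other : ∀ id a, id ≠ 1 → id ≠ 2 → m.nat (loc id a) = m₀.nat (loc id a)

/-- Both parts have smaller codes, so their sizes and matrices are available, and `adjExpr`
evaluates one step of the recursion of `codeAdj`. The whole `W × W` square is filled, which avoids
testing indices against sizes. -/
theorem run_tree {a b : ℕ} {m₀ : Heap} (h : TreesDone W (Nat.pair a b + 2) m₀ m) :
    TreesDone W (Nat.pair a b + 3) m₀ (tree.run s inp [n, k, L, W, Nat.pair a b, a, b] m) := by
  have hap := Nat.left_le_pair a b
  have hbp := Nat.right_le_pair a b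
  have hsa := h.size (a + 1) (by omega)
  have hsb := h.size (b + 1) (by omega)
  set c := Nat.pair a b with hc
  let f : ℕ → ℕ → Heap → Heap := fun i j m =>
    (setN (at₃ 2 (.add (.var 4) (.lit 2)) (.var 7) (.var 8)) adjExpr).run s inp
      [n, k, L, W, c, a, b, i, j] m
  have hrun : tree.run s inp [n, k, L, W, c, a, b] m =
      iter W (fun i => iter W (f i)) (m.setN (loc 1 (c + 2)) (codeSize (a + 1) + codeSize (b + 1))) := by
    simp [tree, Cmd.run, NExpr.value, f, hsa, hsb]
  let J : Heap → Prop := fun m => TreesDone W (c + 2) m₀ m ∧ m.size (c + 2) = codeSize (c + 2)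
  have hf : ∀ i < W, ∀ j < W, ∀ m, J m →
      f i j m = m.setN (loc₃ 2 (c + 2) i j) (codeAdj (c + 2) i j) := by
    intro i hi j hj m hm
    have h1 := hm.1.size (a + 1) (by omega)
    have h2 := hm.1.adj (a + 1) (by omega) i hi j hj
    have h3 := hm.1.adj (b + 1) (by omega) (i - codeSize (a + 1)) (by omega)
      (j - codeSize (a + 1)) (by omega)
    simp only [f, Cmd.run, NExpr.value, NExpr.value_pair, adjExpr, List.getD_cons_succ,
      List.getD_cons_zero, h1, h2, h3]
    rw [hc, codeAdj_pair]
  have hJ : ∀ i < W, ∀ j < W, ∀ m, J m → J (f i j m) := by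
    intro i hi j hj m hm
    rw [hf i hi j hj m hm]
    refine ⟨⟨fun R hR => ?_, fun R hR i' hi' j' hj' => ?_, ?_, fun id x h1 h2 => ?_⟩, ?_⟩
    · simpa using hm.1.size R hR
    · have : R ≠ c + 2 := by omega
      simpa [this] using hm.1.adj R hR i' hi' j' hj'
    · exact hm.1.real
    · simpa [h2] using hm.1.other id x h1 h2
    · simpa using hm.2
  have hQ : ∀ i₀ < W, ∀ j₀ < W, ∀ m, J m →
      (iter W (fun i => iter W (f i)) m).adj (c + 2) i₀ j₀ = codeAdj (c + 2) i₀ j₀ := by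
    intro i₀ hi₀ j₀ hj₀ m hm
    have hQ' : ∀ i < W, ∀ j < W, ∀ m, J m → m.adj (c + 2) i₀ j₀ = codeAdj (c + 2) i₀ j₀ →
        (f i j m).adj (c + 2) i₀ j₀ = codeAdj (c + 2) i₀ j₀ := by
      intro i hi j hj m hm hq
      rw [hf i hi j hj m hm]
      by_cases hij : i₀ = i ∧ j₀ = j
      · obtain ⟨rfl, rfl⟩ := hij
        simp
      · simpa [hij] using hq
    refine iter_establish₂ J (fun m => m.adj (c + 2) i₀ j₀ = codeAdj (c + 2) i₀ j₀) hi₀ hj₀ hJ hQ'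
      (fun m hm => ?_) hm
    rw [hf i₀ hi₀ j₀ hj₀ m hm]
    simp
  have hJm : J (m.setN (loc 1 (c + 2)) (codeSize (a + 1) + codeSize (b + 1))) := by
    refine ⟨⟨fun R hR => ?_, fun R hR i' hi' j' hj' => ?_, h.real, fun id x h1 h2 => ?_⟩, ?_⟩
    · have : R ≠ c + 2 := by omega
      simpa [this] using h.size R hR
    · simpa using h.adj R hR i' hi' j' hj'
    · simpa [h1] using h.other id x h1 h2
    · simp [hc, codeSize_pair]
  have hJ' : J (iter W (fun i => iter W (f i))
      (m.setN (loc 1 (c + 2)) (codeSize (a + 1) + codeSize (b + 1)))) :=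
    iter_inv₂ J hJ hJm
  rw [hrun]
  refine ⟨fun R hR => ?_, fun R hR i hi j hj => ?_, hJ'.1.real, hJ'.1.other⟩
  · rcases Nat.lt_or_ge R (c + 2) with hR' | hR'
    · exact hJ'.1.size R hR'
    · obtain rfl : R = c + 2 := by omega
      exact hJ'.2
  · rcases Nat.lt_or_ge R (c + 2) with hR' | hR'
    · exact hJ'.1.adj R hR' i hi j hj
    · obtain rfl : R = c + 2 := by omega
      exact hQ i hi j hj _ hJm

theorem TreesDone.mono {c c' : ℕ} {m₀ : Heap} (h : TreesDone W c m₀ m) (hc : c' ≤ c) :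
    TreesDone W c' m₀ m :=
  ⟨fun R hR => h.size R (by omega), fun R hR => h.adj R (by omega), h.real, h.other⟩

/-- Unpairing is done by searching all `a, b < W` for `Nat.pair a b = c`; both components of `c` are
at most `c`, so the search succeeds. Code `0` and the matrix of code `1` are correct because the
arrays start out zero. -/
theorem run_trees (hm : ∀ a, m.nat (loc 1 a) = 0 ∧ m.nat (loc 2 a) = 0) :
    TreesDone W (W + 2) m (trees.run s inp [n, k, L, W] m) := by
  have h0 : TreesDone W 2 m (m.setN (loc 1 1) 1) := by
    refine ⟨fun R hR => ?_, fun R hR i hi j hj => ?_, rfl, fun id x h1 h2 => ?_⟩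
    · interval_cases R
      · simp [codeSize_zero, hm]
      · simp [codeSize_one]
    · interval_cases R
      · simp [codeAdj, hm]
      · simp [codeAdj_one, hm]
    · simp [h1]
  let f : ℕ → ℕ → ℕ → Heap → Heap := fun c a b m =>
    (ifEq (.pair (.var 5) (.var 6)) (.var 4) tree).run s inp [n, k, L, W, c, a, b] m
  have hf : ∀ c a b m, f c a b m =
      if Nat.pair a b = c then tree.run s inp [n, k, L, W, c, a, b] m else m := by
    intro c a b m
    simp [f, run_ifEq, NExpr.value]
  have h := iter_inv (b := W) (f := fun c => iter W fun a => iter W fun b => f c a b)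
    (fun c m' => TreesDone W (c + 2) m m') h0 ?_
  · simpa [trees, Cmd.run, NExpr.value, f] using h
  · intro c hc m' hm'
    have hstep : ∀ a b m', TreesDone W (c + 2) m m' → TreesDone W (c + 2) m (f c a b m') := by
      intro a b m' hm'
      rw [hf]
      split_ifs with hab
      · subst hab
        exact (run_tree hm').mono (by omega)
      · exact hm'
    have hstep' : ∀ a b m', TreesDone W (c + 3) m m' → TreesDone W (c + 3) m (f c a b m') := by
      intro a b m' hm'
      rw [hf]
      split_ifs with hab
      · subst hab
        exact run_tree (hm'.mono (by omega))
      · exact hm'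
    have ha := Nat.unpair_left_le c
    have hb := Nat.unpair_right_le c
    refine iter_establish₂ (TreesDone W (c + 2) m) (TreesDone W (c + 3) m)
      (i₀ := c.unpair.1) (j₀ := c.unpair.2) (by omega) (by omega) (fun a _ b _ => hstep a b)
      (fun a _ b _ m' _ => hstep' a b m') ?_ hm'
    intro m' hm'
    rw [hf, if_pos (Nat.pair_unpair c)]
    have := run_tree (s := s) (inp := inp) (n := n) (k := k) (L := L) (a := c.unpair.1)
      (b := c.unpair.2) (m := m') (m₀ := m) (W := W)
    rw [Nat.pair_unpair] at this
    exact this hm'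

end Cmd

/-! ## The values of the trees -/

theorem adjacencyMemory_apply {n : ℕ} (G : SimpleGraph (Fin n)) [DecidableRel G.Adj] (i j : Fin n) :
    adjacencyMemory G (i * n + j) = if G.Adj i j then 1 else 0 := by
  have h : (∃ i' j' : Fin n, G.Adj i' j' ∧ (i : ℕ) * n + j = (i' : ℕ) * n + (j' : ℕ)) ↔
      G.Adj i j := by
    constructor
    · rintro ⟨i', j', hadj, heq⟩
      have h1 : (i : ℕ) = i' := by
        have := congrArg (· / n) heq
        simpa [mul_comm _ n, Nat.mul_add_div i.pos, Nat.div_eq_of_lt j.2,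
          Nat.div_eq_of_lt j'.2] using this
      have h2 : (j : ℕ) = j' := by rw [h1] at heq; omega
      rw [Fin.ext h1, Fin.ext h2]
      exact hadj
    · exact fun hadj => ⟨i, j, hadj, rfl⟩
  unfold adjacencyMemory
  simp only [h]

theorem adjacencyMemory_codeGraph {R i j : ℕ} (hi : i < codeSize R) (hj : j < codeSize R) :
    adjacencyMemory (codeGraph R) (i * codeSize R + j) = codeAdj R i j := by
  classical
  have h := adjacencyMemory_apply (codeGraph R) ⟨i, hi⟩ ⟨j, hj⟩
  rw [codeGraph_adj] at h
  refine h.trans ?_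
  have hle := codeAdj_le_one R i j
  split_ifs with hc
  · rw [hc, Nat.cast_one]
  · rw [(by simp only at hc; omega : codeAdj R i j = 0), Nat.cast_zero]

namespace Cmd

variable {s : ℕ} {inp : ℕ → ℕ} {n k L W : ℕ} {m : Heap}

/-- Here the indices must be tested against the size: in row-major order an index beyond the size
would address another entry of the matrix. -/
theorem run_matrices (hsize : ∀ R < W, m.size R = codeSize R)
    (hadj : ∀ R < W, ∀ i < W, ∀ j < W, m.adj R i j = codeAdj R i j)
    (hwork : ∀ R a, m.work R a = 0) :
    (matrices.run s inp [n, k, L, W] m).nat = m.nat ∧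
      (∀ id a, id ≠ 0 → (matrices.run s inp [n, k, L, W] m).real (loc id a) = m.real (loc id a)) ∧
      ∀ R < W, ∀ a, (matrices.run s inp [n, k, L, W] m).work R a =
        adjacencyMemory (codeGraph R) a := by
  let f : ℕ → ℕ → ℕ → Heap → Heap := fun R i j m =>
    if i + 1 ≤ m.size R then if j + 1 ≤ m.size R then
      m.setR (loc₂ 0 R (i * m.size R + j)) (m.adj R i j) else m else m
  have hrun : matrices.run s inp [n, k, L, W] m =
      iter W (fun R => iter W fun i => iter W (f R i)) m := by
    simp [matrices, Cmd.run, NExpr.value, RExpr.value, f]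
  let J : Heap → Prop := fun m' => m'.nat = m.nat ∧
    ∀ id a, id ≠ 0 → m'.real (loc id a) = m.real (loc id a)
  have hf : ∀ R < W, ∀ i < W, ∀ j < W, ∀ m', J m' → f R i j m' =
      if i < codeSize R ∧ j < codeSize R then
        m'.setR (loc₂ 0 R (i * codeSize R + j)) (adjacencyMemory (codeGraph R) (i * codeSize R + j))
      else m' := by
    intro R hR i hi j hj m' hm'
    have h1 : m'.size R = codeSize R := by rw [Heap.size, hm'.1, ← hsize R hR]
    have h2 : m'.adj R i j = codeAdj R i j := by rw [Heap.adj, hm'.1, ← hadj R hR i hi j hj]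
    simp only [f, h1, h2, Nat.succ_le_iff]
    split_ifs with h3 h4 h5 h5 h5
    · rw [adjacencyMemory_codeGraph h3 h4]
    · exact absurd ⟨h3, h4⟩ h5
    · exact absurd h5.2 h4
    · rfl
    · exact absurd h5.1 h3
    · rfl
  have hJ : ∀ R < W, ∀ i < W, ∀ j < W, ∀ m', J m' → J (f R i j m') := by
    intro R hR i hi j hj m' hm'
    rw [hf R hR i hi j hj m' hm']
    split_ifs
    · refine ⟨hm'.1, fun id a hid => ?_⟩
      simpa [hid] using hm'.2 id a hid
    · exact hm'
  have hJm : J m := ⟨rfl, fun _ _ _ => rfl⟩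
  have hJ' : ∀ R < W, ∀ m', J m' → J (iter W (fun i => iter W (f R i)) m') :=
    fun R hR m' hm' => iter_inv₂ J (hJ R hR) hm'
  rw [hrun]
  have hJfin : J (iter W (fun R => iter W fun i => iter W (f R i)) m) :=
    iter_inv (fun _ => J) hJm hJ'
  refine ⟨hJfin.1, hJfin.2, fun R₀ hR₀ a₀ => ?_⟩
  let Q : Heap → Prop := fun m' => m'.work R₀ a₀ = adjacencyMemory (codeGraph R₀) a₀
  have hQ : ∀ R < W, ∀ i < W, ∀ j < W, ∀ m', J m' → Q m' → Q (f R i j m') := by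
    intro R hR i hi j hj m' hm' hq
    rw [hf R hR i hi j hj m' hm']
    split_ifs
    · by_cases h : R₀ = R ∧ a₀ = i * codeSize R + j
      · obtain ⟨rfl, rfl⟩ := h
        simp [Q]
      · simpa [Q, h] using hq
    · exact hq
  have hQ' : ∀ R < W, ∀ m', J m' → Q m' → Q (iter W (fun i => iter W (f R i)) m') :=
    fun R hR m' hm' hq => (iter_inv₂ (fun m => J m ∧ Q m) (fun i hi j hj m h =>
      ⟨hJ R hR i hi j hj m h.1, hQ R hR i hi j hj m h.1 h.2⟩) ⟨hm', hq⟩).2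
  -- A cell that is no position of the matrix is never written with anything but the right value,
  -- and the zero it starts with is what the given program expects.
  by_cases hx : ∃ i < codeSize R₀, ∃ j < codeSize R₀, a₀ = i * codeSize R₀ + j
  · obtain ⟨i₀, hi₀, j₀, hj₀, rfl⟩ := hx
    have hle := codeSize_le R₀
    refine (iter_establish J Q hR₀ hJ' hQ' (fun m' hm' => ?_) hJm).2
    refine iter_establish₂ J Q (i₀ := i₀) (j₀ := j₀) (by omega) (by omega) (hJ R₀ hR₀) (hQ R₀ hR₀)
      (fun m' hm' => ?_) hm'
    rw [hf R₀ hR₀ i₀ (by omega) j₀ (by omega) m' hm', if_pos ⟨hi₀, hj₀⟩]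
    simp [Q]
  · have h0 : adjacencyMemory (codeGraph R₀) a₀ = 0 := by
      unfold adjacencyMemory
      rw [if_neg]
      rintro ⟨i, j, -, h⟩
      exact hx ⟨i, i.2, j, j.2, h⟩
    exact (iter_inv (fun _ m => J m ∧ Q m) ⟨hJm, (hwork R₀ a₀).trans h0.symm⟩
      fun R hR m h => ⟨hJ' R hR m h.1, hQ' R hR m h.1 h.2⟩).2

end Cmd

/-! ### Running the given program for the measure in private blocks of memory -/

namespace RealRAM

variable {K : Set ℝ}

/-- All registers mentioned in the program are below this bound. -/
def Program.regBound : Program K → ℕ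
  | .skip => 0
  | .int r _ => r + 1
  | .const r _ => r + 1
  | .arith _ r a b => r + a + b + 1
  | .load r a => r + a + 1
  | .store a r => a + r + 1
  | .seq P Q => P.regBound + Q.regBound
  | .ite a b P Q => a + b + 1 + P.regBound + Q.regBound
  | .loop a b P => a + b + 1 + P.regBound

/-- Compute the address of a cell of the work memory, where the number of the memory is the value
of the variable `4` and the number of the cell is in register `a`. -/
def workAddr (q a : ℕ) : Program K :=
  .seq (copyVar q 5 a) (.seq (compileN q 6 (Cmd.at₂ 0 (.var 4) (.var 5)) 0) (realAddr q 0))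

/-- Let a program use the work memory whose number is the value of the variable `4`. -/
def relocate (q : ℕ) : Program K → Program K
  | .load r a => .seq (workAddr q a) (.load r (tReg q 0))
  | .store a r => .seq (workAddr q a) (.store (tReg q 0) r)
  | .seq P Q => .seq (relocate q P) (relocate q Q)
  | .ite a b P Q => .ite a b (relocate q P) (relocate q Q)
  | .loop a b P => .loop a b (relocate q P)
  | P => P

/-- The store `ρ` represents the store `σ` of a relocated program. -/
structure Reloc (q s : ℕ) (inp : ℕ → ℕ) (env : List ℕ) (R : ℕ) (m₀ m : Heap) (ρ σ : Store) :
    Prop where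
  rep : Rep q s inp env m ρ
  reg : ∀ r < q, ρ.reg r = σ.reg r
  work : ∀ a, m.work R a = σ.mem a
  nat : m.nat = m₀.nat
  real : ∀ b, (∀ a, b ≠ loc₂ 0 R a) → m.real b = m₀.real b

variable {q s : ℕ} {inp : ℕ → ℕ} {env : List ℕ} {R : ℕ} {m₀ m : Heap} {ρ σ : Store}

theorem runs_workAddr (q : ℕ) : ∃ c, ∀ (s : ℕ) (inp : ℕ → ℕ) (env : List ℕ) (R a i : ℕ) (m : Heap)
    (ρ : Store), env.length = 5 → env.getD 4 0 = R → Rep q s inp env m ρ → a < q → ρ.reg a = i →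
      Runs (workAddr q a : Program K) ρ c fun ρ' => Rep q s inp env m ρ' ∧ ρ'.mem = ρ.mem ∧
        (∀ r < q, ρ'.reg r = ρ.reg r) ∧ ρ'.reg (tReg q 0) = (s + 2 * loc₂ 0 R i + 1 : ℕ) := by
  obtain ⟨c, hc⟩ := runs_compileN (K := K) q 6 (Cmd.at₂ 0 (.var 4) (.var 5)) 0
  refine ⟨4 + (c + 4), fun s inp env R a i m ρ hlen hR h ha hi => ?_⟩
  have h1 := runs_copyVar (K := K) h hi (by unfold vReg; omega) (by unfold wReg; omega)
  rw [hlen] at h1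
  refine Runs.seq h1 ?_
  rintro ρ₁ ⟨hrep₁, hmem₁, hreg₁⟩
  refine Runs.seq (hc s inp (env ++ [i]) m ρ₁ (by simp [hlen]) hrep₁) ?_
  rintro ρ₂ ⟨hf₂, hv₂⟩
  have hrep₂ := hrep₁.frame hf₂
  have hval : (Cmd.at₂ 0 (.var 4) (.var 5)).value s inp (env ++ [i]) m = loc₂ 0 R i := by
    simp only [NExpr.value_pair, NExpr.value]
    rw [List.getD_append _ _ _ _ (by omega), hR, List.getD_append_right _ _ _ _ (by omega), hlen]
    simp
  rw [hval] at hv₂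
  refine (runs_realAddr hrep₂.base hv₂).mono le_rfl ?_
  rintro ρ₃ ⟨hf₃, hv₃⟩
  exact ⟨(hrep₂.frame hf₃).of_snoc, hf₃.mem.trans (hf₂.mem.trans hmem₁), fun r hr =>
    (hf₃.low hr).trans ((hf₂.low hr).trans (hreg₁ r hr)), hv₃⟩

theorem Rep.setLow (h : Rep q s inp env m ρ) {r : ℕ} (hr : r < q) (x : ℝ) :
    Rep q s inp env m (ρ.setReg r x) where
  base := by rw [Store.setReg_reg, if_neg (by omega), h.base]
  var i hi := by rw [Store.setReg_reg, if_neg (by unfold vReg; omega), h.var i hi]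
  succ i hi := by rw [Store.setReg_reg, if_neg (by unfold wReg; omega), h.succ i hi]
  inp := h.inp
  nat := h.nat
  real := h.real

theorem Reloc.setLow (h : Reloc q s inp env R m₀ m ρ σ) {r : ℕ} (hr : r < q) (x : ℝ) :
    Reloc q s inp env R m₀ m (ρ.setReg r x) (σ.setReg r x) where
  rep := h.rep.setLow hr x
  reg i hi := by rw [Store.setReg_reg, Store.setReg_reg, h.reg i hi]
  work := h.work
  nat := h.nat
  real := h.real

/-- Simulation by induction on the execution, with a constant slowdown because only memory accesses
change. Cell `i` becomes the real cell `loc₂ 0 R i`. Since pairing is injective, a block has room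
for arbitrarily large addresses, and nothing need be known about the memory the program uses. -/
theorem runs_relocate (q : ℕ) : ∃ c, 1 ≤ c ∧ ∀ (P : Program K) (σ : Store) (t : ℕ) (σ' : Store),
    Exec P σ t σ' → P.regBound ≤ q → ∀ (s : ℕ) (inp : ℕ → ℕ) (env : List ℕ) (R : ℕ) (m₀ m : Heap)
      (ρ : Store), env.length = 5 → env.getD 4 0 = R → Reloc q s inp env R m₀ m ρ σ →
        Runs (relocate q P) ρ (c * t) fun ρ' => ∃ m', Reloc q s inp env R m₀ m' ρ' σ' := by
  obtain ⟨c, hc⟩ := runs_workAddr (K := K) q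
  refine ⟨c + 1, by omega, fun P σ t σ' h => ?_⟩
  have one : ∀ t, t ≤ (c + 1) * t := fun t => Nat.le_mul_of_pos_left _ (Nat.succ_pos c)
  induction h with
  | skip σ => exact fun _ s inp env R m₀ m ρ _ _ h => (Runs.skip ⟨m, h⟩).mono (one 1) fun _ h => h
  | int σ r z =>
    intro hq s inp env R m₀ m ρ _ _ h
    exact (Runs.int ⟨m, h.setLow (by simp [Program.regBound] at hq; omega) _⟩).mono (one 1)
      fun _ h => h
  | const σ r z =>
    intro hq s inp env R m₀ m ρ _ _ h
    exact ⟨1, _, .const ρ r z, one 1, m, h.setLow (by simp [Program.regBound] at hq; omega) _⟩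
  | arith σ op r a b hop =>
    intro hq s inp env R m₀ m ρ _ _ h
    simp only [Program.regBound] at hq
    have ha := h.reg a (by omega)
    have hb := h.reg b (by omega)
    refine ⟨1, _, .arith ρ op r a b (by rwa [hb]), one 1, m, ?_⟩
    rw [ha, hb]
    exact h.setLow (by omega) _
  | load σ r a i hi =>
    intro hq s inp env R m₀ m ρ hlen hR h
    simp only [Program.regBound] at hq
    refine (Runs.seq (c' := 1) (hc s inp env R a i m ρ hlen hR h.rep (by omega)
      ((h.reg a (by omega)).trans hi)) ?_).mono (by omega) fun _ h => h
    rintro ρ₁ ⟨hrep, hmem, hreg, hv⟩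
    refine Runs.load _ hv ⟨m, ?_⟩
    have hval : ρ₁.mem (s + 2 * loc₂ 0 R i + 1) = σ.mem i := (hrep.real _).trans (h.work i)
    rw [hval]
    exact Reloc.setLow (σ := σ) ⟨hrep, fun r hr => (hreg r hr).trans (h.reg r hr), h.work, h.nat,
      h.real⟩ (by omega) _
  | store σ a r i hi =>
    intro hq s inp env R m₀ m ρ hlen hR h
    simp only [Program.regBound] at hq
    refine (Runs.seq (c' := 1) (hc s inp env R a i m ρ hlen hR h.rep (by omega)
      ((h.reg a (by omega)).trans hi)) ?_).mono (by omega) fun _ h => h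
    rintro ρ₁ ⟨hrep, hmem, hreg, hv⟩
    refine Runs.store _ hv ⟨m.setR (loc₂ 0 R i) (ρ₁.reg r), hrep.setR _ _,
      fun r hr => (hreg r hr).trans (h.reg r hr), fun a => ?_, h.nat, fun b hb => ?_⟩
    · rw [Store.setMem_mem, Heap.work, Heap.setR_real]
      have := h.work a
      simp only [Nat.pair_eq_pair, true_and, hreg r (by omega), h.reg r (by omega)]
      split_ifs
      · rfl
      · exact this
    · rw [Heap.setR_real, if_neg (hb i), h.real b hb]
  | seq hP hQ ihP ihQ =>
    intro hq s inp env R m₀ m ρ hlen hR h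
    simp only [Program.regBound] at hq
    refine (Runs.seq (ihP (by omega) s inp env R m₀ m ρ hlen hR h) ?_).mono (mul_add _ _ _).ge
      fun _ h => h
    rintro ρ₁ ⟨m₁, h₁⟩
    exact ihQ (by omega) s inp env R m₀ m₁ ρ₁ hlen hR h₁
  | ite_true hab hP ih =>
    intro hq s inp env R m₀ m ρ hlen hR h
    simp only [Program.regBound] at hq
    obtain ⟨t', ρ', he, ht, h'⟩ := ih (by omega) s inp env R m₀ m ρ hlen hR h
    refine ⟨_, _, .ite_true ?_ he, ?_, h'⟩
    · rwa [h.reg _ (by omega), h.reg _ (by omega)]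
    · rw [mul_add]; omega
  | ite_false hab hP ih =>
    intro hq s inp env R m₀ m ρ hlen hR h
    simp only [Program.regBound] at hq
    obtain ⟨t', ρ', he, ht, h'⟩ := ih (by omega) s inp env R m₀ m ρ hlen hR h
    refine ⟨_, _, .ite_false ?_ he, ?_, h'⟩
    · rwa [h.reg _ (by omega), h.reg _ (by omega)]
    · rw [mul_add]; omega
  | loop_true hab hP hL ih ihL =>
    intro hq s inp env R m₀ m ρ hlen hR h
    have hq' := hq
    simp only [Program.regBound] at hq
    obtain ⟨t', ρ', he, ht, m', h'⟩ := ih (by omega) s inp env R m₀ m ρ hlen hR h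
    obtain ⟨t'', ρ'', he', ht', h''⟩ := ihL hq' s inp env R m₀ m' ρ' hlen hR h'
    refine ⟨_, _, .loop_true ?_ he he', ?_, h''⟩
    · rwa [h.reg _ (by omega), h.reg _ (by omega)]
    · rw [mul_add, mul_add]; omega
  | loop_false hab =>
    intro hq s inp env R m₀ m ρ hlen hR h
    simp only [Program.regBound] at hq
    refine ⟨_, _, .loop_false ?_, one 1, m, h⟩
    rwa [h.reg _ (by omega), h.reg _ (by omega)]

/-- Set the registers below `j` to zero. -/
def zeroRegs : ℕ → Program K
  | 0 => .skip
  | j + 1 => .seq (zeroRegs j) (.int j 0)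

theorem runs_zeroRegs (h : Rep q s inp env m ρ) {j : ℕ} (hj : j ≤ q) :
    Runs (zeroRegs j : Program K) ρ (j + 1) fun ρ' =>
      Rep q s inp env m ρ' ∧ ∀ r < j, ρ'.reg r = 0 := by
  induction j with
  | zero => exact Runs.skip ⟨h, fun r hr => absurd hr (Nat.not_lt_zero r)⟩
  | succ j ih =>
    refine Runs.seq (ih (by omega)) ?_
    rintro ρ₁ ⟨h₁, hz⟩
    refine Runs.int ⟨h₁.setLow (by omega) _, fun r hr => ?_⟩
    rw [Store.setReg_reg]
    split_ifs with hrj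
    · simp
    · exact hz r (by omega)

/-- Compute the value of the tree whose code is the value of the variable `4`. -/
def callOne (q : ℕ) (P : Program K) : Program K :=
  .seq (zeroRegs q) (.seq (compileN q 5 (.get (Cmd.at₁ 1 (.var 4))) 0)
    (.seq (.arith .add 0 0 (tReg q 0)) (.seq (relocate q P)
      (.seq (compileN q 5 (Cmd.at₁ 1 (.var 4)) 0) (.seq (realAddr q 0) (.store (tReg q 0) 0))))))

/-- Compute the values of the trees with codes below `W`. -/
def callAll (q : ℕ) (P : Program K) : Program K :=
  forLoop q 4 3 (.seq (.int (tReg q 0) 1) (.ite (tReg q 0) (vReg q 4) (callOne q P) .skip))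

/-- The given program computes the values of trees. -/
def Computes (P : Program K) (H : GraphMeasure) (d : ℕ) : Prop :=
  ∀ (n : ℕ) (T : SimpleGraph (Fin n)), T.IsTree →
    ∃ (t : ℕ) (σ : RealRAM.Store),
      RealRAM.Exec P ⟨fun r => if r = 0 then (n : ℝ) else 0, adjacencyMemory T⟩ t σ ∧
        t ≤ (n + 1) ^ d ∧ σ.reg 0 = H.val T

/-- Registers below `q` may hold leftovers, so they are cleared and register `0` receives the size.
This recreates the store for which the hypothesis on `P` is stated, as far as `P` can see it. -/
theorem runs_callOne {P : Program K} {H : GraphMeasure} {d : ℕ} (hP : Computes P H d) (hq : 1 ≤ q)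
    (hPq : P.regBound ≤ q) : ∃ c, ∀ (s : ℕ) (inp : ℕ → ℕ) (n k L W R : ℕ) (m : Heap) (ρ : Store),
      Rep q s inp [n, k, L, W, R + 1] m ρ → m.size (R + 1) = codeSize (R + 1) →
      (∀ a, m.work (R + 1) a = adjacencyMemory (codeGraph (R + 1)) a) →
      Runs (callOne q P) ρ (c * (R + 2) ^ d) fun ρ' => ∃ m', Rep q s inp [n, k, L, W, R + 1] m' ρ' ∧
        m'.nat = m.nat ∧ m'.val (R + 1) = H.codeVal (R + 1) ∧
        ∀ b, (∀ a, b ≠ loc₂ 0 (R + 1) a) → b ≠ loc 1 (R + 1) → m'.real b = m.real b := by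
  obtain ⟨c₁, hc₁⟩ := runs_compileN (K := K) q 5 (.get (Cmd.at₁ 1 (.var 4))) 0
  obtain ⟨c₂, hc₂⟩ := runs_compileN (K := K) q 5 (Cmd.at₁ 1 (.var 4)) 0
  obtain ⟨c₃, hc₃, hrel⟩ := runs_relocate (K := K) q
  refine ⟨(q + 1) + c₁ + 1 + c₃ + c₂ + 4 + 1, fun s inp n k L W R m ρ h hsize hwork => ?_⟩
  obtain ⟨t, σ, hexec, ht, hσ⟩ := hP _ _ (codeGraph_isTree R)
  refine (Runs.seq (runs_zeroRegs h le_rfl) (c' := c₁ + (1 + (c₃ * t + (c₂ + (4 + 1))))) ?_).mono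
    ?_ fun _ h => h
  · rintro ρ₁ ⟨h₁, hz₁⟩
    refine Runs.seq (hc₁ s inp _ m ρ₁ rfl h₁) ?_
    rintro ρ₂ ⟨hf₂, hv₂⟩
    have hv₂' : ρ₂.reg (tReg q 0) = codeSize (R + 1) := by
      rw [hv₂, ← hsize]; simp [NExpr.value]
    refine Runs.seq (Runs.arith (by simp) rfl) ?_
    rintro _ rfl
    have hrel₃ : Reloc q s inp [n, k, L, W, R + 1] (R + 1) m m
        (ρ₂.setReg 0 (Op.add.eval (ρ₂.reg 0) (ρ₂.reg (tReg q 0))))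
        ⟨fun r => if r = 0 then (codeSize (R + 1) : ℝ) else 0,
          adjacencyMemory (codeGraph (R + 1))⟩ := by
      refine ⟨(h₁.frame hf₂).setLow (by omega) _, fun r hr => ?_, hwork, rfl, fun _ _ => rfl⟩
      simp only [Store.setReg_reg, Op.eval, hv₂', hf₂.low (by omega : 0 < q),
        hz₁ 0 (by omega), zero_add, hf₂.low hr, hz₁ r hr]
    refine Runs.seq (hrel P _ t σ hexec hPq s inp _ (R + 1) m m _ rfl rfl hrel₃) ?_
    rintro ρ₄ ⟨m', h₄⟩
    refine Runs.seq (hc₂ s inp _ m' ρ₄ rfl h₄.rep) ?_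
    rintro ρ₅ ⟨hf₅, hv₅⟩
    have h₅ := h₄.rep.frame hf₅
    refine Runs.seq (runs_realAddr h₅.base hv₅) ?_
    rintro ρ₆ ⟨hf₆, hv₆⟩
    have hloc : (Cmd.at₁ 1 (.var 4)).value s inp [n, k, L, W, R + 1] m' = loc 1 (R + 1) := by
      simp [NExpr.value]
    rw [hloc] at hv₆
    have hval : ρ₆.reg 0 = H.codeVal (R + 1) := by
      rw [hf₆.low (by omega), hf₅.low (by omega), h₄.reg 0 (by omega), hσ]; rfl
    refine Runs.store _ hv₆ ⟨m'.setR (loc 1 (R + 1)) (ρ₆.reg 0), (h₅.frame hf₆).setR _ _, h₄.nat,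
      ?_, fun b hb hb' => ?_⟩
    · simp [hval]
    · rw [Heap.setR_real, if_neg hb', h₄.real b hb]
  · have hle : codeSize (R + 1) + 1 ≤ R + 2 := by have := codeSize_le (R + 1); omega
    have h1 : t ≤ (R + 2) ^ d := ht.trans (Nat.pow_le_pow_left hle d)
    have h2 : 1 ≤ (R + 2) ^ d := Nat.one_le_pow _ _ (by omega)
    have h3 := Nat.mul_le_mul_left c₃ h1
    have h4 := Nat.le_mul_of_pos_right ((q + 1) + c₁ + 1 + c₂ + 4 + 1) h2
    have h5 : ((q + 1) + c₁ + 1 + c₃ + c₂ + 4 + 1) * (R + 2) ^ d =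
      ((q + 1) + c₁ + 1 + c₂ + 4 + 1) * (R + 2) ^ d + c₃ * (R + 2) ^ d := by ring
    omega

/-- Code `0` is skipped: the empty graph is not a tree, so `P` promises nothing on it. Its cell is
left alone, and the value `0` found there later is the one forced by additivity. -/
theorem runs_callAll {P : Program K} {H : GraphMeasure} {d : ℕ} (hP : Computes P H d) (hq : 1 ≤ q)
    (hPq : P.regBound ≤ q) : ∃ c, ∀ (s : ℕ) (inp : ℕ → ℕ) (n k L W : ℕ) (m : Heap) (ρ : Store),
      Rep q s inp [n, k, L, W] m ρ → (∀ R < W, m.size R = codeSize R) →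
      (∀ R < W, ∀ a, m.work R a = adjacencyMemory (codeGraph R) a) →
      Runs (callAll q P) ρ (c * (W + 1) ^ (d + 1)) fun ρ' => ∃ m', Rep q s inp [n, k, L, W] m' ρ' ∧
        m'.nat = m.nat ∧ (∀ R < W, R ≠ 0 → m'.val R = H.codeVal R) ∧ m'.val 0 = m.val 0 ∧
        ∀ id a, id ≠ 0 → id ≠ 1 → m'.real (loc id a) = m.real (loc id a) := by
  obtain ⟨c, hc⟩ := runs_callOne hP hq hPq
  refine ⟨c + 10, fun s inp n k L W m ρ h hsize hwork => ?_⟩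
  refine (runs_forLoop (env := [n, k, L, W]) (d := 4) (y := 3)
    (c := 1 + (c * (W + 1) ^ d + 1 + 1)) rfl (by omega)
    -- A call destroys the matrix in its own block only, so the invariant keeps the blocks that are
    -- still to be used.
    (fun i m' => m'.nat = m.nat ∧ (∀ R < i, R ≠ 0 → m'.val R = H.codeVal R) ∧ m'.val 0 = m.val 0 ∧
      (∀ R, i ≤ R → ∀ a, m'.work R a = m.work R a) ∧
      ∀ id a, id ≠ 0 → id ≠ 1 → m'.real (loc id a) = m.real (loc id a)) ?_
    ⟨rfl, fun R hR => absurd hR (Nat.not_lt_zero R), rfl, fun _ _ _ => rfl, fun _ _ _ _ => rfl⟩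
    h).mono ?_ ?_
  · rintro R m₁ ρ₁ hR ⟨hnat, hval, hval0, hwork₁, hreal⟩ h₁
    change R < W at hR
    refine Runs.seq (Runs.int rfl) ?_
    rintro _ rfl
    have hrep : Rep q s inp [n, k, L, W, R] m₁ (ρ₁.setReg (tReg q 0) ((1 : ℤ) : ℝ)) :=
      h₁.frame ((Frame.refl q 0 ρ₁).setReg le_rfl _)
    have hv4 := hrep.var 4 (by simp)
    simp only [List.getD_cons_succ, List.getD_cons_zero] at hv4
    refine Runs.ite (fun hle => ?_) fun hlt => ?_
    · rw [hv4] at hle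
      simp only [Store.setReg_reg, if_true, Int.cast_one, Nat.one_le_cast] at hle
      obtain ⟨R, rfl⟩ := Nat.exists_eq_succ_of_ne_zero (by omega : R ≠ 0)
      refine (hc s inp n k L W R m₁ _ hrep ?_ fun a => ?_).mono ?_ ?_
      · rw [Heap.size, hnat]; exact hsize _ hR
      · rw [hwork₁ _ le_rfl]; exact hwork _ hR a
      · exact Nat.mul_le_mul_left c (Nat.pow_le_pow_left (by omega) d)
      · rintro ρ₂ ⟨m₂, h₂, hnat₂, hval₂, hreal₂⟩
        refine ⟨m₂, ⟨hnat₂.trans hnat, fun R' hR' hR0 => ?_, ?_, fun R' hR' a => ?_,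
          fun id a h0 h1 => ?_⟩, h₂⟩
        · rcases Nat.lt_or_ge R' (R + 1) with hlt | hge
          · rw [← hval R' hlt hR0]
            exact hreal₂ _ (by simp) (by simp; omega)
          · obtain rfl : R' = R + 1 := by omega
            exact hval₂
        · rw [← hval0]
          exact hreal₂ _ (by simp) (by simp)
        · rw [← hwork₁ R' (by omega) a]
          exact hreal₂ _ (by simp; omega) (by simp)
        · rw [← hreal id a h0 h1]
          exact hreal₂ _ (by simp [h0]) (by simp [h1])
    · rw [hv4] at hlt
      simp only [Store.setReg_reg, if_true, Int.cast_one, Nat.cast_lt_one] at hlt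
      subst hlt
      exact Runs.skip ⟨m₁, ⟨hnat, fun R' hR' hR0 => absurd hR' (by omega), hval0,
        fun R' hR' => hwork₁ R' (by omega), hreal⟩, hrep⟩
  · simp only [List.getD_cons_succ, List.getD_cons_zero]
    have h2 : 1 ≤ (W + 1) ^ d := Nat.one_le_pow _ _ (by omega)
    have h3 : (c + 10) * (W + 1) ^ (d + 1) = W * (c * (W + 1) ^ d) + c * (W + 1) ^ d +
      10 * (W * (W + 1) ^ d) + 10 * (W + 1) ^ d := by ring
    have h4 := Nat.le_mul_of_pos_right W h2
    have h5 : W * (1 + (c * (W + 1) ^ d + 1 + 1) + 4 + 1) = W * (c * (W + 1) ^ d) + 8 * W := by ring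
    omega
  · rintro ρ' ⟨m', ⟨hnat, hval, hval0, -, hreal⟩, h'⟩
    exact ⟨m', h', hnat, hval, hval0, hreal⟩

end RealRAM

/-! ## Dynamic programming -/

/-- A table of partial solutions for the piece `A`: `valid R j` says whether there is an entry for
component code `R` and `j` deleted vertices, and `entry R j` is the value of that entry. -/
structure TableOK {n : ℕ} (H : GraphMeasure) (T : SimpleGraph (Fin n)) (L W : ℕ)
    (A : Finset (Fin n)) (v : Fin n) (valid : ℕ → ℕ → ℕ) (entry : ℕ → ℕ → ℝ) : Prop where
  sound : ∀ R j, 1 ≤ valid R j → ∃ S f, H.IsPartial T A v S R (entry R j) f ∧ S.card = j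
  complete : ∀ S₀, IsTrimming T (L : ℝ) S₀ → ∃ R x f, R < W ∧
    H.IsPartial T A v (S₀ ∩ A) R x f ∧ 1 ≤ valid R (S₀ ∩ A).card ∧ entry R (S₀ ∩ A).card ≤ x

/-- Soundness glues the two sets behind a pair of entries. Completeness restricts `S₀` to both
pieces and glues the restrictions back. The pairs that matter have codes and cardinalities below
`W`, which is the range the program visits. -/
theorem TableOK.merge {n : ℕ} {H : GraphMeasure} (hadd : H.Additive) {T : SimpleGraph (Fin n)}
    {L W : ℕ} (hn : n < W) (hW : codeBound L < W) {A B : Finset (Fin n)} {v w : Fin n}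
    {va vb vc : ℕ → ℕ → ℕ} {ea eb ec : ℕ → ℕ → ℝ}
    (hA : TableOK H T L W A v va ea) (hB : TableOK H T L W B w vb eb) (hAB : Disjoint A B)
    (hvw : T.Adj v w) (hcross : ∀ a ∈ A, ∀ b ∈ B, T.Adj a b → a = v ∧ b = w)
    (hs : ∀ R j, 1 ≤ vc R j → ∃ R₁ j₁ R₂ j₂, 1 ≤ va R₁ j₁ ∧ 1 ≤ vb R₂ j₂ ∧ R = combine R₁ R₂ ∧
      j = j₁ + j₂ ∧ ec R j = ea R₁ j₁ + eb R₂ j₂ + H.codeVal (if R₁ ≤ 0 then R₂ else 0))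
    (hc : ∀ R₁ < W, ∀ j₁ < W, ∀ R₂ < W, ∀ j₂ < W, 1 ≤ va R₁ j₁ → 1 ≤ vb R₂ j₂ →
      1 ≤ vc (combine R₁ R₂) (j₁ + j₂) ∧ ec (combine R₁ R₂) (j₁ + j₂) ≤
        ea R₁ j₁ + eb R₂ j₂ + H.codeVal (if R₁ ≤ 0 then R₂ else 0)) :
    TableOK H T L W (A ∪ B) v vc ec := by
  refine ⟨fun R j hR => ?_, fun S₀ hS₀ => ?_⟩
  · obtain ⟨R₁, j₁, R₂, j₂, h₁, h₂, rfl, rfl, he⟩ := hs R j hR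
    obtain ⟨S, f, hS, rfl⟩ := hA.sound _ _ h₁
    obtain ⟨S', f', hS', rfl⟩ := hB.sound _ _ h₂
    obtain ⟨g, hg⟩ := hS.merge hadd hS' hAB hvw hcross
    refine ⟨S ∪ S', g, he ▸ hg, Finset.card_union_of_disjoint ?_⟩
    exact Finset.disjoint_of_subset_left hS.sub (Finset.disjoint_of_subset_right hS'.sub hAB)
  · obtain ⟨R₁, x, f, hR₁, hx, hv₁, he₁⟩ := hA.complete S₀ hS₀
    obtain ⟨R₂, y, f', hR₂, hy, hv₂, he₂⟩ := hB.complete S₀ hS₀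
    obtain ⟨g, hg⟩ := hx.merge hadd hy hAB hvw hcross
    have hcard : (S₀ ∩ (A ∪ B)).card = (S₀ ∩ A).card + (S₀ ∩ B).card := by
      rw [Finset.inter_union_distrib_left]
      exact Finset.card_union_of_disjoint (Finset.disjoint_of_subset_left Finset.inter_subset_right
        (Finset.disjoint_of_subset_right Finset.inter_subset_right hAB))
    have hlt : ∀ S : Finset (Fin n), S.card < W := fun S =>
      (S.card_le_univ.trans_eq (Fintype.card_fin n)).trans_lt hn
    rw [← Finset.inter_union_distrib_left] at hg
    obtain ⟨hv, he⟩ := hc R₁ hR₁ _ (hlt _) R₂ hR₂ _ (hlt _) hv₁ hv₂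
    refine ⟨_, _, g, ?_, hg, by rwa [hcard], ?_⟩
    -- This is where trimming is used: the joined component still has at most `L` vertices, so its
    -- code stays below `W`.
    · exact ((code_le _).trans (codeBound_mono (hg.codeSize_le_of_isTrimming hS₀))).trans_lt hW
    · rw [hcard]
      linarith

/-- What is true of the heap when the pieces `A v`, for `v ∈ Al`, remain. -/
structure DPState {n : ℕ} (H : GraphMeasure) (T : SimpleGraph (Fin n)) (L W : ℕ) (τ : ℝ) (m : Heap)
    (Al : Finset (Fin n)) (A : Fin n → Finset (Fin n)) : Prop where
  pieces : IsPieces T Al A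
  dead : ∀ v : Fin n, m.dead v = 0 ↔ v ∈ Al
  fresh : ∀ v ∈ Al, m.table (v : ℕ) < m.scal 2
  empty : ∀ t, m.scal 2 ≤ t → ∀ R j, m.valid t R j = 0
  ok : ∀ v ∈ Al, TableOK H T L W (A v) v (m.valid (m.table (v : ℕ))) (m.entry (m.table (v : ℕ)))
  val : ∀ R < W, m.val R = H.codeVal R
  target : m.target = τ
  ans : m.scal 4 = 0

/-- The input is the adjacency matrix of `T`. -/
def InputOK {n : ℕ} (T : SimpleGraph (Fin n)) (s : ℕ) (inp : ℕ → ℕ) : Prop :=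
  ∀ u v : Fin n, (1 ≤ if u * n + v < s then inp (u * n + v) else 0) ↔ T.Adj u v

namespace Cmd

/-- Create the tables of the single vertices; the variables are `n`, `k`, `L`, `W`. -/
def initTables : Cmd :=
  seq (loop 0 (seq (setN (at₁ 4 (.var 4)) (.var 4))
      (seq (setN (at₃ 3 (.var 4) (.lit 0) (.lit 1)) (.lit 1))
        (setN (at₃ 3 (.var 4) (.lit 1) (.lit 0)) (.lit 1)))))
    (setN (at₁ 0 (.lit 2)) (.var 0))

/-- The number of the next table. -/
abbrev next : NExpr := .get (at₁ 0 (.lit 2))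

/-- The table of the piece of the vertex `v`. -/
abbrev tableOf (v : NExpr) : NExpr := .get (at₁ 4 v)

/-- Address of the entry of the next table to which the entries with codes `7`, `9` and numbers `8`,
`10` of the tables of the vertices `6` and `5` contribute. -/
abbrev newAt (id : ℕ) : NExpr :=
  at₃ id next (.ite (.var 7) (.lit 0) (.lit 0) (.ite (.var 9) (.lit 0) (.var 7)
    (.add (.pair (.sub (.var 7) (.lit 1)) (.sub (.var 9) (.lit 1))) (.lit 2))))
    (.add (.var 8) (.var 10))

/-- The value contributed to this entry. -/
abbrev newValue : RExpr :=
  .add (.add (.get (at₃ 2 (tableOf (.var 6)) (.var 7) (.var 8)))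
    (.get (at₃ 2 (tableOf (.var 5)) (.var 9) (.var 10))))
    (.get (at₁ 1 (.ite (.var 7) (.lit 0) (.var 9) (.lit 0))))

/-- Replace an entry of the next table by a better one. -/
def relax : Cmd :=
  ifN (.lit 1) (.get (newAt 3))
    (ifR newValue (.get (newAt 2)) (setR (newAt 2) newValue) skip)
    (seq (setR (newAt 2) newValue) (setN (newAt 3) (.lit 1)))

/-- Compute the table of the union of the pieces of the vertices `6` and `5`. -/
def mergeTables : Cmd :=
  loop 3 (loop 3 (ifN (.lit 1) (.get (at₃ 3 (tableOf (.var 6)) (.var 7) (.var 8)))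
    (loop 3 (loop 3 (ifN (.lit 1) (.get (at₃ 3 (tableOf (.var 5)) (.var 9) (.var 10))) relax skip)))
    skip))

/-- Check that the vertex `6` is the only neighbor of the vertex `5` that is not dead. -/
def checkLeaf : Cmd :=
  seq (setN (at₁ 0 (.lit 3)) (.lit 0))
    (loop 0 (ifN (.get (at₁ 5 (.var 7))) (.lit 0)
      (ifN (.lit 1) (.inp (.add (.mul (.var 5) (.var 0)) (.var 7)))
        (ifN (.var 7) (.var 6) (ifN (.var 6) (.var 7) skip (setN (at₁ 0 (.lit 3)) (.lit 1)))
          (setN (at₁ 0 (.lit 3)) (.lit 1)))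
        skip)
      skip))

/-- Merge the piece of the vertex `5` into the piece of the vertex `6`. -/
def merge : Cmd :=
  seq mergeTables (seq (setN (at₁ 4 (.var 6)) next) (seq (setN (at₁ 5 (.var 5)) (.lit 1))
    (setN (at₁ 0 (.lit 2)) (.add next (.lit 1)))))

/-- Merge the piece of the vertex `5` into the piece of the vertex `6`, if possible. -/
def tryMerge : Cmd :=
  ifN (.get (at₁ 5 (.var 5))) (.lit 0)
    (ifN (.get (at₁ 5 (.var 6))) (.lit 0)
      (ifN (.lit 1) (.inp (.add (.mul (.var 5) (.var 0)) (.var 6)))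
        (seq checkLeaf (ifN (.get (at₁ 0 (.lit 3))) (.lit 0) merge skip))
        skip)
      skip)
    skip

/-- Merge all pieces. -/
def mergeAll : Cmd := loop 0 (loop 0 (loop 0 tryMerge))

/-- Search the last table for an entry that meets the target. -/
def answer : Cmd :=
  loop 0 (ifN (.get (at₁ 5 (.var 4))) (.lit 0)
    (loop 3 (ifN (.lit 1) (.get (at₃ 3 (tableOf (.var 4)) (.var 5) (.var 1)))
      (ifR (.add (.get (at₃ 2 (tableOf (.var 4)) (.var 5) (.var 1))) (.get (at₁ 1 (.var 5))))
        (.get (at₁ 3 (.lit 0))) (setN (at₁ 0 (.lit 4)) (.lit 1)) skip)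
      skip))
    skip)

variable {s : ℕ} {inp : ℕ → ℕ} {n k L W : ℕ} {m : Heap} {H : GraphMeasure}
  {T : SimpleGraph (Fin n)} {τ : ℝ} {Al : Finset (Fin n)} {A : Fin n → Finset (Fin n)}

/-- A single vertex is deleted (code `0`, one deletion) or kept (code `1`, none). In both cases the
rest is empty and has value `0`, so the entries need not be written. -/
theorem run_initTables (hadd : H.Additive) (hW : 1 < W) (hvalid : ∀ t R j, m.valid t R j = 0)
    (hentry : ∀ t R j, m.entry t R j = 0) (hdead : ∀ v, m.dead v = 0) (hans : m.scal 4 = 0)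
    (hval : ∀ R < W, m.val R = H.codeVal R) (htarget : m.target = τ) :
    DPState H T L W τ (initTables.run s inp [n, k, L, W] m) Finset.univ fun v => {v} := by
  have h := iter_inv (b := n) (f := fun i m =>
      ((m.setN (loc 4 i) i).setN (loc₃ 3 i 0 1) 1).setN (loc₃ 3 i 1 0) 1)
    (fun i m' => (∀ v < i, m'.table v = v) ∧ (∀ t R j, m'.valid t R j =
      if t < i ∧ (R = 0 ∧ j = 1 ∨ R = 1 ∧ j = 0) then 1 else 0) ∧ (∀ v, m'.dead v = 0) ∧
      m'.scal 4 = 0 ∧ m'.real = m.real) (m := m) ?_ ?_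
  · have hrun : initTables.run s inp [n, k, L, W] m = (iter n (fun i m =>
      ((m.setN (loc 4 i) i).setN (loc₃ 3 i 0 1) 1).setN (loc₃ 3 i 1 0) 1) m).setN (loc 0 2) n := by
      simp [initTables, Cmd.run, NExpr.value]
    rw [hrun]
    obtain ⟨h1, h2, h3, h4, h5⟩ := h
    generalize iter n _ m = m' at *
    refine ⟨IsPieces.singletons T, fun v => ?_, fun v _ => ?_, fun t ht R j => ?_, fun v _ => ?_,
      fun R hR => ?_, ?_, ?_⟩
    · simpa using h3 v
    · simpa using (h1 v v.2).trans_lt v.2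
    · have hct : (m'.setN (loc 0 2) n).scal 2 = n := by simp
      have := h2 t R j
      rw [hct] at ht
      rw [if_neg (by omega)] at this
      simpa using this
    · have hv : (m'.setN (loc 0 2) n).table v = v := by simpa using h1 v v.2
      have hv' : ∀ R j, (m'.setN (loc 0 2) n).valid v R j =
          if R = 0 ∧ j = 1 ∨ R = 1 ∧ j = 0 then 1 else 0 := by
        intro R j
        simpa using h2 v R j
      have he : ∀ R j, (m'.setN (loc 0 2) n).entry v R j = 0 := by
        intro R j
        simp [h5, hentry]
      rw [hv]
      refine ⟨fun R j hRj => ?_, fun S₀ _ => ?_⟩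
      · rw [hv'] at hRj
        rw [he]
        split_ifs at hRj with hc
        · rcases hc with ⟨rfl, rfl⟩ | ⟨rfl, rfl⟩
          · exact ⟨{v}, fun _ => v, GraphMeasure.isPartial_delete hadd v _, by simp⟩
          · exact ⟨∅, fun _ => v, GraphMeasure.isPartial_keep hadd v, by simp⟩
        · omega
      · by_cases hvS : v ∈ S₀
        · rw [Finset.inter_singleton_of_mem hvS]
          exact ⟨0, 0, fun _ => v, by omega, GraphMeasure.isPartial_delete hadd v _,
            by rw [Finset.card_singleton, hv']; simp,
            (he _ _).le⟩
        · rw [Finset.inter_singleton_of_notMem hvS]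
          exact ⟨1, 0, fun _ => v, hW, GraphMeasure.isPartial_keep hadd v,
            by rw [Finset.card_empty, hv']; simp,
            (he _ _).le⟩
    · simp [h5, hval R hR]
    · simp [h5, htarget]
    · simpa using h4
  · exact ⟨fun v hv => absurd hv (Nat.not_lt_zero v), fun t R j => by simp [hvalid], hdead, hans, rfl⟩
  · rintro i hi m' ⟨h1, h2, h3, h4, h5⟩
    refine ⟨fun v hv => ?_, fun t R j => ?_, fun v => by simpa using h3 v, by simpa using h4, h5⟩
    · by_cases hvi : v = i
      · simp [hvi]
      · simpa [hvi] using h1 v (by omega)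
    · have := h2 t R j
      simp only [Heap.setN_nat, Nat.pair_eq_pair, true_and]
      simp only [Heap.valid] at this
      rw [this]
      split_ifs <;> omega

/-- During the computation of the table `c`, the other tables are not changed, and the entries
of the table `c` come from pairs of entries. -/
structure Merging (H : GraphMeasure) (c tp tu : ℕ) (m₀ m : Heap) : Prop where
  nat : ∀ a, (∀ R j, a ≠ loc₃ 3 c R j) → m.nat a = m₀.nat a
  real : ∀ a, (∀ R j, a ≠ loc₃ 2 c R j) → m.real a = m₀.real a
  sound : ∀ R j, 1 ≤ m.valid c R j → ∃ R₁ j₁ R₂ j₂, 1 ≤ m₀.valid tp R₁ j₁ ∧ 1 ≤ m₀.valid tu R₂ j₂ ∧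
    R = combine R₁ R₂ ∧ j = j₁ + j₂ ∧ m.entry c R j =
      m₀.entry tp R₁ j₁ + m₀.entry tu R₂ j₂ + H.codeVal (if R₁ ≤ 0 then R₂ else 0)

/-- The last clause says that entries only appear or decrease. It is stated through an upper bound
`x` so that it serves as the persistence condition of `iter_establish₂`. -/
theorem run_relax {u p : ℕ} {m₀ : Heap} (hp : m₀.table p ≠ m₀.scal 2) (hu : m₀.table u ≠ m₀.scal 2)
    (hval : ∀ R < W, m₀.val R = H.codeVal R) (st : ℕ) {R₁ j₁ R₂ j₂ : ℕ} (hR₂ : R₂ < W)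
    (h₁ : 1 ≤ m₀.valid (m₀.table p) R₁ j₁) (h₂ : 1 ≤ m₀.valid (m₀.table u) R₂ j₂)
    (h : Merging H (m₀.scal 2) (m₀.table p) (m₀.table u) m₀ m) :
    ∀ m', m' = relax.run s inp [n, k, L, W, st, u, p, R₁, j₁, R₂, j₂] m →
      Merging H (m₀.scal 2) (m₀.table p) (m₀.table u) m₀ m' ∧
      (1 ≤ m'.valid (m₀.scal 2) (combine R₁ R₂) (j₁ + j₂) ∧
        m'.entry (m₀.scal 2) (combine R₁ R₂) (j₁ + j₂) ≤ m₀.entry (m₀.table p) R₁ j₁ +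
          m₀.entry (m₀.table u) R₂ j₂ + H.codeVal (if R₁ ≤ 0 then R₂ else 0)) ∧
      ∀ R j x, 1 ≤ m.valid (m₀.scal 2) R j ∧ m.entry (m₀.scal 2) R j ≤ x →
        1 ≤ m'.valid (m₀.scal 2) R j ∧ m'.entry (m₀.scal 2) R j ≤ x := by
  have e1 : m.scal 2 = m₀.scal 2 := h.nat _ (by simp)
  have e2 : m.table p = m₀.table p := h.nat _ (by simp)
  have e3 : m.table u = m₀.table u := h.nat _ (by simp)
  have e4 : ∀ R j, m.entry (m₀.table p) R j = m₀.entry (m₀.table p) R j :=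
    fun R j => h.real _ (by simp [hp])
  have e5 : ∀ R j, m.entry (m₀.table u) R j = m₀.entry (m₀.table u) R j :=
    fun R j => h.real _ (by simp [hu])
  have e6 : m.val (if R₁ ≤ 0 then R₂ else 0) = H.codeVal (if R₁ ≤ 0 then R₂ else 0) := by
    rw [← hval _ (by split_ifs <;> omega)]
    exact h.real _ (by simp)
  have e7 : (if R₁ ≤ 0 then 0 else if R₂ ≤ 0 then R₁ else Nat.pair (R₁ - 1) (R₂ - 1) + 2) =
    combine R₁ R₂ := rfl
  set c := m₀.scal 2
  set tp := m₀.table p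
  set tu := m₀.table u
  set R₀ := combine R₁ R₂
  set j₀ := j₁ + j₂
  set x₀ := m₀.entry tp R₁ j₁ + m₀.entry tu R₂ j₂ + H.codeVal (if R₁ ≤ 0 then R₂ else 0) with hx₀
  rintro m' rfl
  classical
  have hrun : relax.run s inp [n, k, L, W, st, u, p, R₁, j₁, R₂, j₂] m =
      if 1 ≤ m.valid c R₀ j₀ then
        if x₀ ≤ m.entry c R₀ j₀ then m.setR (loc₃ 2 c R₀ j₀) x₀ else m
      else (m.setR (loc₃ 2 c R₀ j₀) x₀).setN (loc₃ 3 c R₀ j₀) 1 := by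
    simp only [relax, Cmd.run, NExpr.value, RExpr.value, NExpr.value_pair, List.getD_cons_succ,
      List.getD_cons_zero, e1, e2, e3, e4, e5, e6, e7, Heap.setR_nat]
    rfl
  rw [hrun]
  split_ifs with hc1 hc2
  · refine ⟨⟨h.nat, fun a ha => ?_, fun R j hR => ?_⟩, ⟨hc1, by simp⟩, fun R j x hx => ⟨hx.1, ?_⟩⟩
    · rw [Heap.setR_real, if_neg (ha _ _), h.real a ha]
    · by_cases hRj : R = R₀ ∧ j = j₀
      · obtain ⟨rfl, rfl⟩ := hRj
        exact ⟨R₁, j₁, R₂, j₂, h₁, h₂, rfl, rfl, by simp [hx₀]⟩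
      · obtain ⟨R₁', j₁', R₂', j₂', h1, h2, h3, h4, h5⟩ := h.sound R j hR
        exact ⟨R₁', j₁', R₂', j₂', h1, h2, h3, h4, by simpa [hRj] using h5⟩
    · by_cases hRj : R = R₀ ∧ j = j₀
      · obtain ⟨rfl, rfl⟩ := hRj
        simpa using hc2.trans hx.2
      · simpa [hRj] using hx.2
  · exact ⟨h, ⟨hc1, (not_le.1 hc2).le⟩, fun R j x hx => hx⟩
  · refine ⟨⟨fun a ha => ?_, fun a ha => ?_, fun R j hR => ?_⟩, ⟨by simp, by simp⟩,
      fun R j x hx => ?_⟩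
    · rw [Heap.setN_nat, if_neg (ha _ _), Heap.setR_nat, h.nat a ha]
    · rw [Heap.setN_real, Heap.setR_real, if_neg (ha _ _), h.real a ha]
    · by_cases hRj : R = R₀ ∧ j = j₀
      · obtain ⟨rfl, rfl⟩ := hRj
        exact ⟨R₁, j₁, R₂, j₂, h₁, h₂, rfl, rfl, by simp [hx₀]⟩
      · obtain ⟨R₁', j₁', R₂', j₂', h1, h2, h3, h4, h5⟩ := h.sound R j (by simpa [hRj] using hR)
        exact ⟨R₁', j₁', R₂', j₂', h1, h2, h3, h4, by simpa [hRj] using h5⟩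
    · have hRj : ¬ (R = R₀ ∧ j = j₀) := by
        rintro ⟨rfl, rfl⟩
        exact hc1 hx.1
      simpa [hRj] using hx

/-- The target table starts empty, so soundness holds vacuously at first. For a given pair of
entries, its own round of the four loops makes the bound true, and later rounds preserve it. The
source tables differ from the target and can be read unchanged throughout. -/
theorem run_mergeTables {u p : ℕ} {m₀ : Heap} (hp : m₀.table p ≠ m₀.scal 2)
    (hu : m₀.table u ≠ m₀.scal 2) (hempty : ∀ R j, m₀.valid (m₀.scal 2) R j = 0)
    (hval : ∀ R < W, m₀.val R = H.codeVal R) (st : ℕ) :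
    ∀ m', m' = mergeTables.run s inp [n, k, L, W, st, u, p] m₀ →
      Merging H (m₀.scal 2) (m₀.table p) (m₀.table u) m₀ m' ∧
      ∀ R₁ < W, ∀ j₁ < W, ∀ R₂ < W, ∀ j₂ < W, 1 ≤ m₀.valid (m₀.table p) R₁ j₁ →
        1 ≤ m₀.valid (m₀.table u) R₂ j₂ →
        1 ≤ m'.valid (m₀.scal 2) (combine R₁ R₂) (j₁ + j₂) ∧
        m'.entry (m₀.scal 2) (combine R₁ R₂) (j₁ + j₂) ≤ m₀.entry (m₀.table p) R₁ j₁ +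
          m₀.entry (m₀.table u) R₂ j₂ + H.codeVal (if R₁ ≤ 0 then R₂ else 0) := by
  let J : Heap → Prop := Merging H (m₀.scal 2) (m₀.table p) (m₀.table u) m₀
  let g : ℕ → ℕ → ℕ → ℕ → Heap → Heap := fun R₁ j₁ R₂ j₂ m =>
    if 1 ≤ m.valid (m.table u) R₂ j₂ then
      relax.run s inp [n, k, L, W, st, u, p, R₁, j₁, R₂, j₂] m else m
  let f : ℕ → ℕ → Heap → Heap := fun R₁ j₁ m =>
    if 1 ≤ m.valid (m.table p) R₁ j₁ then iter W (fun R₂ => iter W (g R₁ j₁ R₂)) m else m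
  have hrun : mergeTables.run s inp [n, k, L, W, st, u, p] m₀ =
      iter W (fun R₁ => iter W (f R₁)) m₀ := by
    simp [mergeTables, Cmd.run, NExpr.value, f, g]
  have htp : ∀ m, J m → ∀ R j, m.valid (m.table p) R j = m₀.valid (m₀.table p) R j := by
    intro m hm R j
    have : m.table p = m₀.table p := hm.nat _ (by simp)
    rw [this]
    exact hm.nat _ (by simp [hp])
  have htu : ∀ m, J m → ∀ R j, m.valid (m.table u) R j = m₀.valid (m₀.table u) R j := by
    intro m hm R j
    have : m.table u = m₀.table u := hm.nat _ (by simp)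
    rw [this]
    exact hm.nat _ (by simp [hu])
  let Q : ℕ → ℕ → ℝ → Heap → Prop := fun R j x m =>
    1 ≤ m.valid (m₀.scal 2) R j ∧ m.entry (m₀.scal 2) R j ≤ x
  have hg : ∀ R₁ j₁, 1 ≤ m₀.valid (m₀.table p) R₁ j₁ → ∀ R₂ < W, ∀ j₂ < W, ∀ m, J m →
      J (g R₁ j₁ R₂ j₂ m) ∧ ∀ R j x, Q R j x m → Q R j x (g R₁ j₁ R₂ j₂ m) := by
    intro R₁ j₁ h₁ R₂ hR₂ j₂ hj₂ m hm
    simp only [g, htu m hm]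
    split_ifs with h₂
    · obtain ⟨h3, -, h5⟩ := run_relax (s := s) (inp := inp) (n := n) (k := k) (L := L) hp hu hval st
        hR₂ h₁ h₂ hm _ rfl
      exact ⟨h3, h5⟩
    · exact ⟨hm, fun _ _ _ h => h⟩
  have hf : ∀ R₁ j₁ m, J m → J (f R₁ j₁ m) ∧ ∀ R j x, Q R j x m → Q R j x (f R₁ j₁ m) := by
    intro R₁ j₁ m hm
    simp only [f, htp m hm]
    split_ifs with h₁
    · exact iter_inv₂ (fun m' => J m' ∧ ∀ R j x, Q R j x m → Q R j x m')
        (fun R₂ hR₂ j₂ hj₂ m' hm' => ⟨(hg R₁ j₁ h₁ R₂ hR₂ j₂ hj₂ m' hm'.1).1, fun R j x hQ =>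
          (hg R₁ j₁ h₁ R₂ hR₂ j₂ hj₂ m' hm'.1).2 R j x (hm'.2 R j x hQ)⟩) ⟨hm, fun _ _ _ h => h⟩
    · exact ⟨hm, fun _ _ _ h => h⟩
  have hJ₀ : J m₀ := ⟨fun _ _ => rfl, fun _ _ => rfl, fun R j hR => by rw [hempty] at hR; omega⟩
  rintro m' rfl
  rw [hrun]
  refine ⟨iter_inv₂ J (fun R₁ _ j₁ _ m hm => (hf R₁ j₁ m hm).1) hJ₀, ?_⟩
  intro R₁ hR₁ j₁ hj₁ R₂ hR₂ j₂ hj₂ h₁ h₂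
  refine iter_establish₂ J (Q (combine R₁ R₂) (j₁ + j₂) _) hR₁ hj₁
    (fun R₁ _ j₁ _ m hm => (hf R₁ j₁ m hm).1) (fun R₁ _ j₁ _ m hm => (hf R₁ j₁ m hm).2 _ _ _)
    (fun m hm => ?_) hJ₀
  simp only [f, htp m hm, if_pos h₁]
  refine iter_establish₂ J (Q (combine R₁ R₂) (j₁ + j₂) _) hR₂ hj₂
    (fun R₂ hR₂ j₂ hj₂ m hm => (hg R₁ j₁ h₁ R₂ hR₂ j₂ hj₂ m hm).1)
    (fun R₂ hR₂ j₂ hj₂ m hm => (hg R₁ j₁ h₁ R₂ hR₂ j₂ hj₂ m hm).2 _ _ _) (fun m hm => ?_) hm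
  simp only [g, htu m hm, if_pos h₂]
  exact (run_relax hp hu hval st hR₂ h₁ h₂ hm _ rfl).2.1

theorem run_checkLeaf (hinp : InputOK T s inp) (u p : Fin n)
    (hdead : ∀ v : Fin n, m.dead v = 0 ↔ v ∈ Al) (st : ℕ) :
    ∃ x, checkLeaf.run s inp [n, k, L, W, st, u, p] m = m.setN (loc 0 3) x ∧
      (x = 0 ↔ ∀ w ∈ Al, T.Adj u w → w = p) := by
  let f : ℕ → Heap → Heap := fun i m =>
    if m.dead i ≤ 0 then if 1 ≤ (if u * n + i < s then inp (u * n + i) else 0) then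
      if i ≤ p then if p ≤ i then m else m.setN (loc 0 3) 1 else m.setN (loc 0 3) 1 else m else m
  have hrun : checkLeaf.run s inp [n, k, L, W, st, u, p] m = iter n f (m.setN (loc 0 3) 0) := by
    simp only [checkLeaf, Cmd.run, NExpr.value, NExpr.value_pair, List.getD_cons_succ,
      List.getD_cons_zero, List.cons_append, List.nil_append]
    rfl
  rw [hrun]
  have hfin := iter_inv (b := n) (f := f) (fun i m' => ∃ x, m' = m.setN (loc 0 3) x ∧
    (x = 0 ↔ ∀ w ∈ Al, (w : ℕ) < i → T.Adj u w → w = p)) (m := m.setN (loc 0 3) 0)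
    ⟨0, rfl, by simp⟩ ?_
  · obtain ⟨x, hx, hx'⟩ := hfin
    exact ⟨x, hx, hx'.trans ⟨fun h w hw => h w hw w.2, fun h w hw _ => h w hw⟩⟩
  · rintro i hi _ ⟨x, rfl, hx⟩
    have h1 : (m.setN (loc 0 3) x).dead i ≤ 0 ↔ (⟨i, hi⟩ : Fin n) ∈ Al := by
      rw [← hdead ⟨i, hi⟩]; simp
    have h2 := hinp u ⟨i, hi⟩
    simp only at h2
    have hsucc : (∀ w ∈ Al, (w : ℕ) < i + 1 → T.Adj u w → w = p) ↔
        (∀ w ∈ Al, (w : ℕ) < i → T.Adj u w → w = p) ∧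
          ((⟨i, hi⟩ : Fin n) ∈ Al → T.Adj u ⟨i, hi⟩ → (⟨i, hi⟩ : Fin n) = p) := by
      constructor
      · exact fun h => ⟨fun w hw hwi => h w hw (by omega), fun h' => h _ h' (Nat.lt_succ_self i)⟩
      · rintro ⟨h, h'⟩ w hw hwi
        rcases Nat.lt_or_ge (w : ℕ) i with hlt | hge
        · exact h w hw hlt
        · obtain rfl : w = ⟨i, hi⟩ := Fin.ext (by simp; omega)
          exact h' hw
    simp only [hsucc, ← hx]
    have hip : (⟨i, hi⟩ : Fin n) = p ↔ i ≤ p ∧ (p : ℕ) ≤ i := by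
      rw [Fin.ext_iff]; simp; omega
    rw [hip]
    by_cases c1 : (⟨i, hi⟩ : Fin n) ∈ Al
    · by_cases c2 : T.Adj u ⟨i, hi⟩
      · simp only [f, if_pos (h1.2 c1), if_pos (h2.2 c2), Heap.setN_setN]
        split_ifs with c3 c4
        · exact ⟨x, rfl, by simp [c3, c4]⟩
        · exact ⟨1, rfl, by simp [c1, c2, c4]⟩
        · exact ⟨1, rfl, by simp [c1, c2, c3]⟩
      · simp only [f, if_pos (h1.2 c1), if_neg (fun h => c2 (h2.1 h))]
        exact ⟨x, rfl, by simp [c2]⟩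
    · simp only [f, if_neg (fun h => c1 (h1.1 h))]
      exact ⟨x, rfl, by simp [c1]⟩

end Cmd

/-! ### Merging all pieces and reading off the answer -/

namespace Cmd

variable {s : ℕ} {inp : ℕ → ℕ} {n k L W : ℕ} {m : Heap} {H : GraphMeasure}
  {T : SimpleGraph (Fin n)} {τ : ℝ} {Al : Finset (Fin n)} {A : Fin n → Finset (Fin n)}

/-- The result goes to a table with a fresh number, after which `p` is redirected to it. All other
remaining pieces keep their tables because those have smaller numbers. -/
theorem run_merge (hadd : H.Additive) (hn : n < W) (hW : codeBound L < W)
    (h : DPState H T L W τ m Al A) {u p : Fin n} (hu : u ∈ Al) (hp : p ∈ Al) (hup : T.Adj u p)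
    (hleaf : ∀ w ∈ Al, T.Adj u w → w = p) (st : ℕ) :
    DPState H T L W τ (merge.run s inp [n, k, L, W, st, u, p] m) (Al.erase u)
      (Function.update A p (A p ∪ A u)) := by
  have hpt := h.fresh p hp
  have hut := h.fresh u hu
  obtain ⟨hM, hC⟩ := run_mergeTables (s := s) (inp := inp) (n := n) (k := k) (L := L) (u := u)
    (p := p) hpt.ne hut.ne (h.empty _ le_rfl) h.val st _ rfl
  have hrun : merge.run s inp [n, k, L, W, st, u, p] m =
      (((mergeTables.run s inp [n, k, L, W, st, u, p] m).setN (loc 4 p) (m.scal 2)).setN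
        (loc 5 u) 1).setN (loc 0 2) (m.scal 2 + 1) := by
    have hc : (mergeTables.run s inp [n, k, L, W, st, u, p] m).scal 2 = m.scal 2 :=
      hM.nat _ (by simp)
    simp [merge, Cmd.run, NExpr.value, hc]
  rw [hrun]
  generalize mergeTables.run s inp [n, k, L, W, st, u, p] m = m₁ at hM hC
  set c := m.scal 2
  set m' := ((m₁.setN (loc 4 p) c).setN (loc 5 u) 1).setN (loc 0 2) (c + 1) with hm'
  have hne : p ≠ u := hup.ne'
  have hct : m'.scal 2 = c + 1 := by simp [hm']
  have hvalid : ∀ t R j, m'.valid t R j = m₁.valid t R j := fun t R j => by simp [hm']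
  have hentry : ∀ t R j, m'.entry t R j = m₁.entry t R j := fun t R j => by simp [hm']
  have hvalid' : ∀ t, t ≠ c → ∀ R j, m'.valid t R j = m.valid t R j := fun t ht R j =>
    (hvalid t R j).trans (hM.nat _ (by simp [ht]))
  have hentry' : ∀ t, t ≠ c → ∀ R j, m'.entry t R j = m.entry t R j := fun t ht R j =>
    (hentry t R j).trans (hM.real _ (by simp [ht]))
  have htp : m'.table p = c := by simp [hm']
  have htv : ∀ v : Fin n, v ≠ p → m'.table v = m.table v := by
    intro v hv
    have hv' : (v : ℕ) ≠ p := fun h => hv (Fin.ext h)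
    have h1 : m'.table v = m₁.table v := by simp [hm', hv']
    exact h1.trans (hM.nat _ (by simp))
  refine ⟨h.pieces.merge hu hp hup hleaf, fun v => ?_, fun v hv => ?_, fun t ht R j => ?_,
    fun v hv => ?_, fun R hR => ?_, ?_, ?_⟩
  · by_cases hvu : v = u
    · subst hvu
      simp [hm']
    · have hv' : (v : ℕ) ≠ u := fun h => hvu (Fin.ext h)
      have h1 : m'.dead v = m₁.dead v := by simp [hm', hv']
      have h2 : m₁.dead v = m.dead v := hM.nat _ (by simp)
      rw [h1, h2, h.dead, Finset.mem_erase]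
      exact ⟨fun h => ⟨hvu, h⟩, fun h => h.2⟩
  · rw [hct]
    by_cases hvp : v = p
    · rw [hvp, htp]; omega
    · have := h.fresh v (Finset.mem_of_mem_erase hv)
      rw [htv v hvp]; omega
  · rw [hct] at ht
    rw [hvalid' t (by omega)]
    exact h.empty t (by omega) R j
  · by_cases hvp : v = p
    · subst hvp
      rw [Function.update_self, htp]
      refine TableOK.merge hadd hn hW (h.ok v hp) (h.ok u hu) (h.pieces.disj v hp u hu hne) hup.symm
        (h.pieces.edge v hp u hu hne) (fun R j hR => ?_) fun R₁ hR₁ j₁ hj₁ R₂ hR₂ j₂ hj₂ h₁ h₂ => ?_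
      · simpa only [hentry] using hM.sound R j (by rwa [hvalid] at hR)
      · simpa only [hvalid, hentry] using hC R₁ hR₁ j₁ hj₁ R₂ hR₂ j₂ hj₂ h₁ h₂
    · have hv := Finset.mem_of_mem_erase hv
      have hlt := h.fresh v hv
      rw [Function.update_of_ne hvp, htv v hvp]
      have h1 : m'.valid (m.table (v : ℕ)) = m.valid (m.table (v : ℕ)) :=
        funext₂ (hvalid' _ hlt.ne)
      have h2 : m'.entry (m.table (v : ℕ)) = m.entry (m.table (v : ℕ)) :=
        funext₂ (hentry' _ hlt.ne)
      rw [h1, h2]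
      exact h.ok v hv
  · rw [← h.val R hR]
    exact hM.real _ (by simp)
  · rw [← h.target]
    exact hM.real _ (by simp)
  · have h1 : m'.scal 4 = m₁.scal 4 := by simp [hm']
    rw [h1, ← h.ans]
    exact hM.nat _ (by simp)

/-- The alternative records why nothing was merged, so that an attempt at a leaf and its neighbor is
seen to succeed. -/
theorem run_tryMerge (hadd : H.Additive) (hn : n < W) (hW : codeBound L < W)
    (hinp : InputOK T s inp) (h : DPState H T L W τ m Al A) (u p : Fin n) (st : ℕ) :
    (DPState H T L W τ (tryMerge.run s inp [n, k, L, W, st, u, p] m) Al A ∧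
      ¬ (u ∈ Al ∧ p ∈ Al ∧ T.Adj u p ∧ ∀ w ∈ Al, T.Adj u w → w = p)) ∨
    ∃ A', DPState H T L W τ (tryMerge.run s inp [n, k, L, W, st, u, p] m) (Al.erase u) A' ∧
      u ∈ Al := by
  have hrun : tryMerge.run s inp [n, k, L, W, st, u, p] m =
      if m.dead u ≤ 0 then if m.dead p ≤ 0 then
        if 1 ≤ (if u * n + p < s then inp (u * n + p) else 0) then
          if (checkLeaf.run s inp [n, k, L, W, st, u, p] m).scal 3 ≤ 0 then
            merge.run s inp [n, k, L, W, st, u, p] (checkLeaf.run s inp [n, k, L, W, st, u, p] m)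
          else checkLeaf.run s inp [n, k, L, W, st, u, p] m
        else m else m else m := by
    simp only [tryMerge, Cmd.run, NExpr.value, NExpr.value_pair, List.getD_cons_succ,
      List.getD_cons_zero]
  obtain ⟨x, hx, hx0⟩ := run_checkLeaf (k := k) (L := L) (W := W) hinp u p h.dead st
  have hstate : DPState H T L W τ (m.setN (loc 0 3) x) Al A := by
    refine ⟨h.pieces, fun v => ?_, fun v hv => ?_, fun t ht R j => ?_, fun v hv => ?_,
      h.val, h.target, ?_⟩
    · simpa using h.dead v
    · simpa using h.fresh v hv
    · have hct : (m.setN (loc 0 3) x).scal 2 = m.scal 2 := by simp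
      rw [hct] at ht
      simpa using h.empty t ht R j
    · have h1 : (m.setN (loc 0 3) x).table v = m.table v := by simp
      have h2 : (m.setN (loc 0 3) x).valid (m.table v) = m.valid (m.table v) := by
        ext R j; simp
      rw [h1, h2]
      exact h.ok v hv
    · simpa using h.ans
  rw [hrun, hx]
  have hscal : (m.setN (loc 0 3) x).scal 3 = x := by simp
  rw [hscal]
  have hadj := hinp u p
  generalize (if (u : ℕ) * n + p < s then inp (u * n + p) else 0) = y at hadj
  split_ifs with h1 h2 h3 h4
  · rw [Nat.le_zero, h.dead] at h1 h2
    exact .inr ⟨_, run_merge hadd hn hW hstate h1 h2 (hadj.1 h3)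
      (hx0.1 (Nat.le_zero.1 h4)) st, h1⟩
  · exact .inl ⟨hstate, fun hc => h4 (hx0.2 hc.2.2.2).le⟩
  · exact .inl ⟨h, fun hc => h3 (hadj.2 hc.2.2.1)⟩
  · exact .inl ⟨h, fun hc => h2 ((h.dead p).2 hc.2.1).le⟩
  · exact .inl ⟨h, fun hc => h1 ((h.dead u).2 hc.1).le⟩

/-- Each of the `n` rounds tries all pairs, and as long as two pieces are left it removes at least
one. -/
theorem run_mergeAll (hadd : H.Additive) (hn : n < W) (hW : codeBound L < W)
    (hinp : InputOK T s inp) (hT : T.IsTree) (h : DPState H T L W τ m Al A) :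
    ∃ Al' A', DPState H T L W τ (mergeAll.run s inp [n, k, L, W] m) Al' A' ∧ Al'.card ≤ 1 := by
  let f : ℕ → ℕ → ℕ → Heap → Heap := fun st u p m => tryMerge.run s inp [n, k, L, W, st, u, p] m
  have hrun : mergeAll.run s inp [n, k, L, W] m =
      iter n (fun st => iter n fun u => iter n (f st u)) m := by
    simp [mergeAll, Cmd.run, f]
  let P : ℕ → Heap → Prop := fun c m => ∃ Al A, DPState H T L W τ m Al A ∧ Al.card ≤ c
  have hP : ∀ c st, ∀ u < n, ∀ p < n, ∀ m, P c m → P c (f st u p m) := by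
    rintro c st u hu p hp m ⟨Al, A, h, hc⟩
    rcases run_tryMerge hadd hn hW hinp h ⟨u, hu⟩ ⟨p, hp⟩ st with ⟨h', -⟩ | ⟨A', h', -⟩
    · exact ⟨Al, A, h', hc⟩
    · exact ⟨_, A', h', (Finset.card_erase_le).trans hc⟩
  have hmain := iter_inv (b := n) (f := fun st => iter n fun u => iter n (f st u))
    (fun i m => P (max (n - i) 1) m) (m := m) ⟨Al, A, h, ?_⟩ ?_
  · obtain ⟨Al', A', h', hc⟩ := hmain
    exact ⟨Al', A', hrun ▸ h', by simpa using hc⟩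
  · exact (Al.card_le_univ.trans_eq (Fintype.card_fin n)).trans (le_max_left _ _)
  · rintro i hi m₁ ⟨Al₁, A₁, h₁, hc₁⟩
    rcases Nat.lt_or_ge Al₁.card 2 with hlt | hge
    · obtain ⟨Al₂, A₂, h₂, hc₂⟩ := iter_inv₂ (P 1) (hP 1 i) ⟨Al₁, A₁, h₁, by omega⟩
      exact ⟨Al₂, A₂, h₂, hc₂.trans (le_max_right _ _)⟩
    · obtain ⟨u₀, hu₀, p₀, hp₀, hadj, hleaf⟩ := h₁.pieces.exists_leaf hT hge
      -- When the leaf chosen at the start of the round comes up, either the representatives are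
      -- still the same and it is merged, or an earlier merge has already lowered their number.
      have hQ := iter_establish₂ (f := f i) (b := n) (b' := n) (i₀ := u₀) (j₀ := p₀)
        (fun m => (∃ A, DPState H T L W τ m Al₁ A) ∨ P (Al₁.card - 1) m) (P (Al₁.card - 1))
        u₀.2 p₀.2 ?_ ?_ ?_ (.inl ⟨A₁, h₁⟩)
      · obtain ⟨Al₂, A₂, h₂, hc₂⟩ := hQ
        exact ⟨Al₂, A₂, h₂, by omega⟩
      · rintro u hu p hp m₂ (⟨A₂, h₂⟩ | h₂)
        · rcases run_tryMerge hadd hn hW hinp h₂ ⟨u, hu⟩ ⟨p, hp⟩ i with ⟨h', -⟩ | ⟨A', h', hmem⟩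
          · exact .inl ⟨A₂, h'⟩
          · exact .inr ⟨_, A', h', (Finset.card_erase_of_mem hmem).le⟩
        · exact .inr (hP _ i u hu p hp m₂ h₂)
      · exact fun u hu p hp m₂ _ h₂ => hP _ i u hu p hp m₂ h₂
      · rintro m₂ (⟨A₂, h₂⟩ | h₂)
        · rcases run_tryMerge hadd hn hW hinp h₂ u₀ p₀ i with ⟨-, h'⟩ | ⟨A', h', hmem⟩
          · exact absurd ⟨hu₀, hp₀, hadj, hleaf⟩ h'
          · exact ⟨_, A', h', (Finset.card_erase_of_mem hmem).le⟩
        · exact hP _ i u₀ u₀.2 p₀ p₀.2 m₂ h₂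

theorem val_deleteVertices (H : GraphMeasure) (T : SimpleGraph (Fin n)) (S : Finset (Fin n)) :
    H.val (deleteVertices T S) = H.on T (Finset.univ \ S) := by
  apply H.val_eq_of_iso
  have he : ((S : Set (Fin n))ᶜ : Set (Fin n)) = ((Finset.univ \ S : Finset (Fin n)) : Set (Fin n)) := by
    ext; simp
  exact ⟨⟨Equiv.setCongr he, Iff.rfl⟩⟩

/-- The remaining piece is the whole tree. A yes is justified by soundness, with any set of `k`
vertices as a witness; a yes-instance is recognized by completeness, applied to the trimming witness
that balance provides. -/
theorem run_answer (hadd : H.Additive) (hT : T.IsTree)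
    (hbal : H.IsYesInstance T k τ → ∃ S, H.IsWitness T k τ S ∧ IsTrimming T (L : ℝ) S)
    (h : DPState H T L W τ m Al A) (hcard : Al.card ≤ 1) :
    (H.IsYesInstance T k τ → (answer.run s inp [n, k, L, W] m).scal 4 = 1) ∧
      (¬ H.IsYesInstance T k τ → (answer.run s inp [n, k, L, W] m).scal 4 = 0) := by
  classical
  obtain ⟨x₀⟩ := hT.1.nonempty
  obtain ⟨v, hv, -⟩ := h.pieces.cover x₀
  have hAl : ∀ w ∈ Al, w = v := fun w hw => Finset.card_le_one.1 hcard w hw v hv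
  have hAv : A v = Finset.univ := by
    ext x
    obtain ⟨w, hw, hx⟩ := h.pieces.cover x
    rw [hAl w hw] at hx
    simp [hx]
  have hok := h.ok v hv
  rw [hAv] at hok
  let f : ℕ → ℕ → Heap → Heap := fun v R m =>
    if 1 ≤ m.valid (m.table v) R k then
      if m.entry (m.table v) R k + m.val R ≤ m.target then m.setN (loc 0 4) 1 else m else m
  have hrun : answer.run s inp [n, k, L, W] m =
      iter n (fun v m => if m.dead v ≤ 0 then iter W (f v) m else m) m := by
    simp [answer, Cmd.run, NExpr.value, RExpr.value, f]
  let J : Heap → Prop := fun m' => (∃ x, m' = m.setN (loc 0 4) x ∧ (x = 0 ∨ x = 1)) ∧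
    (¬ H.IsYesInstance T k τ → m'.scal 4 = 0)
  let Q : Heap → Prop := fun m' => m'.scal 4 = 1
  have hf : ∀ m', J m' → ∀ R, f v R m' =
      if 1 ≤ m.valid (m.table v) R k then
        if m.entry (m.table v) R k + m.val R ≤ τ then m'.setN (loc 0 4) 1 else m' else m' := by
    rintro _ ⟨⟨x, rfl, -⟩, -⟩ R
    simp [f, ← h.target]
  have hJ : ∀ R < W, ∀ m', J m' → J (f v R m') := by
    intro R hR m' hm'
    rw [hf m' hm']
    split_ifs with h1 h2
    · obtain ⟨⟨x, rfl, hx⟩, -⟩ := hm'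
      refine ⟨⟨1, Heap.setN_setN _ _ _ _, .inr rfl⟩, fun hno => absurd ?_ hno⟩
      obtain ⟨S, g, hS, hk⟩ := hok.sound R k h1
      refine ⟨S, hk, ?_⟩
      rw [val_deleteVertices, hS.on_sdiff hadd, ← h.val R hR]
      exact h2
    · exact hm'
    · exact hm'
  have hQ : ∀ R < W, ∀ m', J m' → Q m' → Q (f v R m') := by
    intro R hR m' hm' hq
    rw [hf m' hm']
    split_ifs
    · simp [Q]
    · exact hq
    · exact hq
  have hdead : ∀ w < n, ∀ m', J m' → m'.dead w ≤ 0 → w = v := by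
    rintro w hw _ ⟨⟨x, rfl, -⟩, -⟩ hd
    have : m.dead w = 0 := by simpa using hd
    exact congrArg Fin.val (hAl ⟨w, hw⟩ ((h.dead ⟨w, hw⟩).1 this))
  have hJ' : ∀ w < n, ∀ m', J m' → J (if m'.dead w ≤ 0 then iter W (f w) m' else m') := by
    intro w hw m' hm'
    split_ifs with hd
    · obtain rfl := hdead w hw m' hm' hd
      exact iter_inv (fun _ => J) hm' hJ
    · exact hm'
  have hQ' : ∀ w < n, ∀ m', J m' → Q m' → Q (if m'.dead w ≤ 0 then iter W (f w) m' else m') := by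
    intro w hw m' hm' hq
    split_ifs with hd
    · obtain rfl := hdead w hw m' hm' hd
      exact (iter_inv (fun _ m => J m ∧ Q m) ⟨hm', hq⟩
        fun R hR m h => ⟨hJ R hR m h.1, hQ R hR m h.1 h.2⟩).2
    · exact hq
  have hJm : J m := ⟨⟨0, (Heap.setN_eq_self h.ans).symm, .inl rfl⟩, fun _ => h.ans⟩
  rw [hrun]
  refine ⟨fun hyes => ?_, fun hno => (iter_inv (fun _ => J) hJm hJ').2 hno⟩
  obtain ⟨S, ⟨hSk, hSτ⟩, hS⟩ := hbal hyes
  obtain ⟨R, x, g, hR, hpart, hvalid, hentry⟩ := hok.complete S hS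
  rw [Finset.inter_univ] at hpart hvalid hentry
  rw [hSk] at hvalid hentry
  refine (iter_establish J Q v.2 hJ' hQ' (fun m' hm' => ?_) hJm).2
  have hd : m'.dead v ≤ 0 := by
    obtain ⟨⟨x, rfl, -⟩, -⟩ := hm'
    have := (h.dead v).2 hv
    simpa using this
  rw [if_pos hd]
  refine (iter_establish J Q hR hJ hQ (fun m' hm' => ?_) hm').2
  rw [hf m' hm', if_pos hvalid, if_pos]
  · simp [Q]
  · rw [h.val R hR]
    rw [val_deleteVertices, hpart.on_sdiff hadd] at hSτ
    linarith

end Cmd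

/-! ### Assembling the solver and bounding its running time -/

namespace RealRAM

variable {K : Set ℝ}

theorem Runs.seq_pow {P P' : Program K} {σ : Store} {B c e c' e' : ℕ} {R Q : Store → Prop}
    (h : Runs P σ (c * (B + 1) ^ e) R) (h' : ∀ σ', R σ' → Runs P' σ' (c' * (B + 1) ^ e') Q) :
    Runs (.seq P P') σ ((c + c') * (B + 1) ^ (e + e')) Q := by
  refine (Runs.seq h h').mono ?_ fun _ h => h
  rw [add_mul]
  gcongr <;> omega

theorem Runs.const_pow {P : Program K} {σ : Store} {c : ℕ} {Q : Store → Prop} (B : ℕ)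
    (h : Runs P σ c Q) : Runs P σ (c * (B + 1) ^ 0) Q :=
  h.mono (by simp) fun _ h => h

/-- The power of the parameter. -/
def powExpr : ℕ → NExpr
  | 0 => .lit 1
  | t + 1 => .mul (powExpr t) (.get (Cmd.at₁ 0 (.lit 0)))

theorem value_powExpr (s : ℕ) (inp : ℕ → ℕ) (env : List ℕ) (m : Heap) (t : ℕ) :
    (powExpr t).value s inp env m = m.scal 0 ^ t := by
  induction t with
  | zero => rfl
  | succ t ih => simp [powExpr, NExpr.value, ih, pow_succ]

/-- The size bound for components. -/
def levelExpr (C t : ℕ) : NExpr := .mul (.lit C) (powExpr t)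

/-- The bound for all loops. -/
def widthExpr : NExpr := .add (.add (.get (Cmd.at₁ 0 (.lit 1))) (.var 0)) (.lit 2)

/-- Decide an instance with `k ≤ n`; the variables are `n` and `k`. -/
def solve (q C t : ℕ) (P : Program K) : Program K :=
  .seq (compile q .ceilDiv 2) (.seq (letVar q 2 (levelExpr C t)) (.seq (compile q .bound 3)
    (.seq (letVar q 3 widthExpr) (.seq (compile q .trees 4) (.seq (compile q .matrices 4)
      (.seq (callAll q P) (compile q (.seq .initTables (.seq .mergeAll .answer)) 4)))))))

theorem eq_ceil_div {n k x : ℕ} (hk : 1 ≤ k) (hkn : k ≤ n) (h : n ≤ x * k) (h' : x * k < n + k) :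
    ⌈(n : ℚ) / k⌉₊ = x := by
  have hk' : (0 : ℚ) < k := by exact_mod_cast hk
  have hx : x ≠ 0 := by rintro rfl; omega
  rw [Nat.ceil_eq_iff hx, lt_div_iff₀ hk', div_le_iff₀ hk']
  refine ⟨?_, by exact_mod_cast h⟩
  obtain ⟨x, rfl⟩ := Nat.exists_eq_succ_of_ne_zero hx
  have : x * k < n := by rw [Nat.succ_mul] at h'; omega
  rw [Nat.succ_sub_one]
  exact_mod_cast this

/-- The single bound `W` exceeds all relevant codes, vertex numbers and numbers of deletions, and
also bounds the variables `n`, `k` and `L`. Hence every phase costs a power of `W + 1`. -/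
theorem runs_solve {q C t₀ d : ℕ} {P : Program K} {H : GraphMeasure} (hadd : H.Additive)
    (hP : Computes P H d) (hq : 1 ≤ q) (hPq : P.regBound ≤ q) :
    ∃ c e, ∀ (n : ℕ) (T : SimpleGraph (Fin n)) (k : ℕ) (τ : ℝ) (s : ℕ) (inp : ℕ → ℕ) (x L W : ℕ)
      (m : Heap) (σ : Store), T.IsTree → 1 ≤ k → k ≤ n → InputOK T s inp →
      x = ⌈(n : ℚ) / k⌉₊ → L = C * x ^ t₀ → W = codeBound L + n + 2 →
      (H.IsYesInstance T k τ → ∃ S, H.IsWitness T k τ S ∧ IsTrimming T (L : ℝ) S) →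
      (∀ a, m.nat a = 0) → (∀ a, m.real a = if a = loc 3 0 then τ else 0) →
      Rep q s inp [n, k] m σ →
      Runs (solve q C t₀ P) σ (c * (W + 1) ^ e) fun σ' => ∃ m', Rep q s inp [n, k, L, W] m' σ' ∧
        (H.IsYesInstance T k τ → m'.scal 4 = 1) ∧ (¬ H.IsYesInstance T k τ → m'.scal 4 = 0) := by
  obtain ⟨c₁, e₁, h₁⟩ := runs_compile (K := K) q .ceilDiv 2
  obtain ⟨c₂, h₂⟩ := runs_letVar (K := K) q 2 (levelExpr C t₀)
  obtain ⟨c₃, e₃, h₃⟩ := runs_compile (K := K) q .bound 3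
  obtain ⟨c₄, h₄⟩ := runs_letVar (K := K) q 3 widthExpr
  obtain ⟨c₅, e₅, h₅⟩ := runs_compile (K := K) q .trees 4
  obtain ⟨c₆, e₆, h₆⟩ := runs_compile (K := K) q .matrices 4
  obtain ⟨c₇, h₇⟩ := runs_callAll hP hq hPq
  obtain ⟨c₈, e₈, h₈⟩ := runs_compile (K := K) q (.seq .initTables (.seq .mergeAll .answer)) 4
  refine ⟨c₁ + (c₂ + (c₃ + (c₄ + (c₅ + (c₆ + (c₇ + c₈)))))),
    e₁ + (0 + (e₃ + (0 + (e₅ + (e₆ + ((d + 1) + e₈)))))),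
    fun n T k τ s inp x L W m σ hT hk hkn hinp hx hL hW hbal hnat hreal hrep => ?_⟩
  have hLW : L ≤ W := (self_le_codeBound L).trans (by omega)
  refine Runs.seq_pow (h₁ W s inp _ m σ rfl ?_ hrep) fun σ₁ r₁ => ?_
  · simp only [List.mem_cons, List.not_mem_nil, or_false]; rintro _ (rfl | rfl) <;> omega
  obtain ⟨y, hy, hy1, hy2⟩ := Cmd.run_ceilDiv (s := s) (inp := inp) hk hkn (hnat (loc 0 0))
  obtain rfl : x = y := hx.trans (eq_ceil_div hk hkn hy1 hy2)
  rw [hy] at r₁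
  set m₁ := m.setN (loc 0 0) x with hm₁
  refine Runs.seq_pow ((h₂ s inp _ m₁ σ₁ rfl r₁).const_pow W) fun σ₂ r₂ => ?_
  have hlev : (levelExpr C t₀).value s inp [n, k] m₁ = L := by
    simp [levelExpr, NExpr.value, value_powExpr, hm₁, hL]
  rw [hlev] at r₂
  refine Runs.seq_pow (h₃ W s inp [n, k, L] m₁ σ₂ rfl ?_ r₂) fun σ₃ r₃ => ?_
  · simp only [List.mem_cons, List.not_mem_nil, or_false]; rintro _ (rfl | rfl | rfl) <;> omega
  rw [Cmd.run_bound (by simp [hm₁, hnat])] at r₃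
  set m₃ := m₁.setN (loc 0 1) (codeBound L) with hm₃
  refine Runs.seq_pow ((h₄ s inp _ m₃ σ₃ rfl r₃).const_pow W) fun σ₄ r₄ => ?_
  have hwid : widthExpr.value s inp [n, k, L] m₃ = W := by
    simp [widthExpr, NExpr.value, hm₃, hW]
  rw [hwid] at r₄
  have hB : ∀ z ∈ [n, k, L, W], z ≤ W := by
    simp only [List.mem_cons, List.not_mem_nil, or_false]
    rintro _ (rfl | rfl | rfl | rfl) <;> omega
  refine Runs.seq_pow (h₅ W s inp [n, k, L, W] m₃ σ₄ rfl hB r₄) fun σ₅ r₅ => ?_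
  have hT₅ := Cmd.run_trees (s := s) (inp := inp) (n := n) (k := k) (L := L) (W := W) (m := m₃)
    (fun a => by simp [hm₃, hm₁, hnat])
  generalize Cmd.trees.run s inp [n, k, L, W] m₃ = m₅ at r₅ hT₅
  refine Runs.seq_pow (h₆ W s inp [n, k, L, W] m₅ σ₅ rfl hB r₅) fun σ₆ r₆ => ?_
  have hreal₅ : m₅.real = m.real := hT₅.real
  obtain ⟨hnat₆, hreal₆, hwork₆⟩ := Cmd.run_matrices (s := s) (inp := inp) (n := n) (k := k) (L := L)
    (W := W) (m := m₅) (fun R hR => hT₅.size R (by omega)) (fun R hR => hT₅.adj R (by omega))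
    (fun R a => by simp [Heap.work, loc₂, hreal₅, hreal])
  generalize Cmd.matrices.run s inp [n, k, L, W] m₅ = m₆ at r₆ hnat₆ hreal₆ hwork₆
  refine Runs.seq_pow (h₇ s inp n k L W m₆ σ₆ r₆ (fun R hR => ?_) hwork₆) fun σ₇ r₇ => ?_
  · rw [Heap.size, hnat₆]; exact hT₅.size R (by omega)
  obtain ⟨m₇, r₇, hnat₇, hval₇, hval0₇, hreal₇⟩ := r₇
  refine (h₈ W s inp [n, k, L, W] m₇ σ₇ rfl hB r₇).mono le_rfl fun σ₈ r₈ => ⟨_, r₈, ?_⟩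
  -- The phases so far wrote only scalars, sizes and matrices, so the tables and the marks for dead
  -- vertices are still zero.
  have hn7 : ∀ id a, id ≠ 0 → id ≠ 1 → id ≠ 2 → m₇.nat (loc id a) = 0 := by
    intro id a h0 h1 h2
    rw [hnat₇, hnat₆, hT₅.other id a h1 h2]
    simp [hm₃, hm₁, hnat, h0]
  have hr7 : ∀ id a, id ≠ 0 → id ≠ 1 → m₇.real (loc id a) = if loc id a = loc 3 0 then τ else 0 := by
    intro id a h0 h1
    rw [hreal₇ id a h0 h1, hreal₆ id a h0, hreal₅, hreal]
  have hdp := Cmd.run_initTables (s := s) (inp := inp) (n := n) (k := k) (L := L) (W := W) (m := m₇)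
    (T := T) (τ := τ) hadd (by omega) (fun t R j => hn7 _ _ (by simp) (by simp) (by simp))
    (fun t R j => by rw [Heap.entry, hr7 _ _ (by simp) (by simp)]; simp)
    (fun v => hn7 _ _ (by simp) (by simp) (by simp)) ?_ (fun R hR => ?_)
    (by rw [Heap.target, hr7 _ _ (by simp) (by simp)]; simp)
  · obtain ⟨Al, A, hdp', hcard⟩ := Cmd.run_mergeAll (k := k) (L := L) hadd (by omega) (by omega) hinp
      hT hdp
    exact Cmd.run_answer hadd hT hbal hdp' hcard
  · rw [Heap.scal, hnat₇, hnat₆, hT₅.other 0 4 (by simp) (by simp)]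
    simp [hm₃, hm₁, hnat]
  · by_cases hR0 : R = 0
    · rw [hR0, hval0₇, hadd.codeVal_zero, Heap.val, hreal₆ 1 0 (by simp), hreal₅, hreal]
      simp
    · exact hval₇ R hR hR0

/-- Initialize the representation of the heap. -/
def setup (q : ℕ) : Program K :=
  .seq (.arith .mul q 0 0) (.seq (compileN q 0 (Cmd.at₁ 3 (.lit 0)) 0) (.seq (realAddr q 0)
    (.seq (.store (tReg q 0) 2) (.seq (copyVar q 0 0) (copyVar q 1 1)))))

/-- The program that solves MinH on trees, where `P` computes the measure. -/
def solver (q C t : ℕ) (P : Program K) : Program K :=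
  .ite 1 0
    (.seq (setup q) (.seq (solve q C t P) (.seq (compileN q 4 (.get (Cmd.at₁ 0 (.lit 4))) 0)
      (.seq (.int 0 0) (.arith .add 0 0 (tReg q 0))))))
    (.int 0 0)

/-- With `s = n * n` the heap starts behind the adjacency matrix, where memory is zero, so the zero
heap needs no initialization. The condition `3 ≤ q` protects the registers that hold `n`, `k` and
`τ`. -/
theorem runs_setup {q : ℕ} (hq : 3 ≤ q) : ∃ c, ∀ (n k : ℕ) (τ : ℝ) (inp : ℕ → ℕ) (σ : Store),
    σ.reg 0 = n → σ.reg 1 = k → σ.reg 2 = τ → (∀ a < n * n, σ.mem a = inp a) →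
    (∀ a, n * n ≤ a → σ.mem a = 0) →
    Runs (setup q : Program K) σ c fun σ' => ∃ m : Heap, (∀ a, m.nat a = 0) ∧
      (∀ a, m.real a = if a = loc 3 0 then τ else 0) ∧ Rep q (n * n) inp [n, k] m σ' := by
  obtain ⟨c, hc⟩ := runs_compileN (K := K) q 0 (Cmd.at₁ 3 (.lit 0)) 0
  refine ⟨1 + (c + (4 + (1 + (4 + 4)))), fun n k τ inp σ h0 h1 h2 hin hz => ?_⟩
  refine Runs.seq (Runs.arith (by simp) rfl) ?_
  rintro _ rfl
  let m₀ : Heap := ⟨fun _ => 0, fun _ => 0⟩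
  set σ₁ := σ.setReg q (Op.mul.eval (σ.reg 0) (σ.reg 0)) with hσ₁
  have hlow : ∀ r < q, σ₁.reg r = σ.reg r := fun r hr => by
    rw [hσ₁, Store.setReg_reg, if_neg (by omega)]
  have hrep : Rep q (n * n) inp [] m₀ σ₁ := by
    refine ⟨?_, fun i hi => absurd hi (Nat.not_lt_zero i), fun i hi => absurd hi (Nat.not_lt_zero i),
      hin, fun a => ?_, fun a => ?_⟩
    · rw [hσ₁, Store.setReg_reg, if_pos rfl, h0]
      simp [Op.eval]
    · exact (hz _ (by omega)).trans (by simp [m₀])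
    · exact hz _ (by omega)
  refine Runs.seq (hc (n * n) inp [] m₀ σ₁ rfl hrep) ?_
  rintro σ₂ ⟨hf₂, hv₂⟩
  have hval : (Cmd.at₁ 3 (.lit 0)).value (n * n) inp [] m₀ = loc 3 0 := by simp [NExpr.value]
  rw [hval] at hv₂
  refine Runs.seq (runs_realAddr (hrep.frame hf₂).base hv₂) ?_
  rintro σ₃ ⟨hf₃, hv₃⟩
  refine Runs.seq (Runs.store _ hv₃ rfl) ?_
  rintro _ rfl
  have hlow₃ : ∀ r < q, σ₃.reg r = σ.reg r := fun r hr =>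
    (hf₃.low hr).trans ((hf₂.low hr).trans (hlow r hr))
  have hrep₄ := ((hrep.frame hf₂).frame hf₃).setR (loc 3 0) (σ₃.reg 2)
  refine Runs.seq (runs_copyVar (env := []) (r := 0) (x := n) hrep₄ ?_ (by unfold vReg; omega)
    (by unfold wReg; omega)) ?_
  · exact (hlow₃ 0 (by omega)).trans h0
  rintro σ₅ ⟨hrep₅, -, hlow₅⟩
  refine (runs_copyVar (env := [n]) (r := 1) (x := k) hrep₅ ?_ (by unfold vReg; omega)
    (by unfold wReg; omega)).mono le_rfl ?_
  · exact (hlow₅ 1 (by omega)).trans ((hlow₃ 1 (by omega)).trans h1)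
  · rintro σ₆ ⟨hrep₆, -⟩
    refine ⟨_, fun a => rfl, fun a => ?_, hrep₆⟩
    rw [Heap.setR_real, hlow₃ 2 (by omega), h2]

/-- The case `k > n` is answered at once, since no set of `k` vertices exists. Trimming witnesses
are therefore demanded only for `k ≤ n`, where the integral bound on components is available. -/
theorem runs_solver {q C t₀ d : ℕ} {P : Program K} {H : GraphMeasure} (hadd : H.Additive)
    (hP : Computes P H d) (hq : 3 ≤ q) (hPq : P.regBound ≤ q) :
    ∃ c e, ∀ (n : ℕ) (T : SimpleGraph (Fin n)) (k : ℕ) (τ : ℝ) (σ : Store), T.IsTree → 1 ≤ k →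
      (k ≤ n → H.IsYesInstance T k τ →
        ∃ S, H.IsWitness T k τ S ∧ IsTrimming T ((C * ⌈(n : ℚ) / k⌉₊ ^ t₀ : ℕ) : ℝ) S) →
      σ.reg 0 = n → σ.reg 1 = k → σ.reg 2 = τ → σ.mem = adjacencyMemory T →
      Runs (solver q C t₀ P) σ
        (c * (codeBound (C * ⌈(n : ℚ) / k⌉₊ ^ t₀) + n + 2 + 1) ^ e) fun σ' =>
        (H.IsYesInstance T k τ → σ'.reg 0 = 1) ∧ (¬ H.IsYesInstance T k τ → σ'.reg 0 = 0) := by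
  classical
  obtain ⟨c₁, h₁⟩ := runs_setup (K := K) hq
  obtain ⟨c₂, e₂, h₂⟩ := runs_solve (t₀ := t₀) (C := C) hadd hP (by omega) hPq
  obtain ⟨c₃, h₃⟩ := runs_compileN (K := K) q 4 (.get (Cmd.at₁ 0 (.lit 4))) 0
  refine ⟨c₁ + (c₂ + (c₃ + 2)) + 2, 0 + (e₂ + 0), fun n T k τ σ hT hk hbal r0 r1 r2 hmem => ?_⟩
  set W := codeBound (C * ⌈(n : ℚ) / k⌉₊ ^ t₀) + n + 2 with hW
  have hpow : 1 ≤ (W + 1) ^ (0 + (e₂ + 0)) := Nat.one_le_pow _ _ (by omega)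
  refine (Runs.ite (c := (c₁ + (c₂ + (c₃ + 2))) * (W + 1) ^ (0 + (e₂ + 0))) (c' := 1)
    (fun hkn => ?_) fun hkn => ?_).mono ?_ fun _ h => h
  · rw [r0, r1, Nat.cast_le] at hkn
    let inp : ℕ → ℕ := fun a =>
      if ∃ i j : Fin n, T.Adj i j ∧ a = (i : ℕ) * n + (j : ℕ) then 1 else 0
    have hin : ∀ a, adjacencyMemory T a = inp a := by
      intro a
      simp only [adjacencyMemory, inp]
      split_ifs <;> simp
    have hlt : ∀ i j : Fin n, (i : ℕ) * n + j < n * n := by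
      intro i j
      have : ((i : ℕ) + 1) * n ≤ n * n := Nat.mul_le_mul_right n i.2
      have := j.2
      rw [Nat.succ_mul] at *
      omega
    have hinp : InputOK T (n * n) inp := by
      intro u v
      rw [if_pos (hlt u v)]
      have := adjacencyMemory_apply T u v
      rw [hin] at this
      by_cases huv : T.Adj u v
      · rw [if_pos huv, Nat.cast_eq_one] at this
        simp [this, huv]
      · rw [if_neg huv, Nat.cast_eq_zero] at this
        simp [this, huv]
    refine Runs.seq_pow ((h₁ n k τ inp σ r0 r1 r2 (fun a _ => by rw [hmem, hin])
      fun a ha => ?_).const_pow W) ?_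
    · rw [hmem, adjacencyMemory, if_neg]
      rintro ⟨i, j, -, rfl⟩
      exact absurd (hlt i j) (by omega)
    rintro σ₁ ⟨m₁, hnat, hreal, hrep⟩
    refine Runs.seq_pow (h₂ n T k τ (n * n) inp _ _ W m₁ σ₁ hT hk hkn hinp rfl rfl hW (hbal hkn)
      hnat hreal hrep) ?_
    rintro σ₂ ⟨m₂, hrep₂, hyes, hno⟩
    refine Runs.const_pow W (Runs.seq (h₃ (n * n) inp _ m₂ σ₂ rfl hrep₂) ?_)
    rintro σ₃ ⟨-, hv₃⟩
    refine Runs.seq (c := 1) (c' := 1) (Runs.int rfl) ?_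
    rintro _ rfl
    have hne : tReg q 0 ≠ 0 := by unfold tReg; omega
    have hv : σ₃.reg (tReg q 0) = (m₂.scal 4 : ℕ) := by
      rw [hv₃]; simp [NExpr.value]
    refine Runs.arith (by simp) ⟨fun hy => ?_, fun hn => ?_⟩
    · simp [Store.setReg_reg, Op.eval, hne, hv, hyes hy]
    · simp [Store.setReg_reg, Op.eval, hne, hv, hno hn]
  · rw [r0, r1, Nat.cast_lt] at hkn
    refine Runs.int ⟨?_, fun _ => by simp [Store.setReg_reg]⟩
    rintro ⟨S, hS, -⟩
    have := S.card_le_univ.trans_eq (Fintype.card_fin n)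
    omega
  · rw [add_mul _ 2]
    omega

end RealRAM

/-! ### The computable time bound and the theorem -/

theorem primrec_codeBound : Primrec codeBound :=
  Primrec.nat_rec₁ 0 (Primrec.nat_mul.comp (Primrec.succ.comp Primrec.snd)
    (Primrec.succ.comp Primrec.snd))

theorem Primrec.nat_pow_const {f : ℕ → ℕ} (hf : Primrec f) (t : ℕ) : Primrec fun x => f x ^ t := by
  induction t with
  | zero => exact (Primrec.const 1).of_eq fun x => (pow_zero _).symm
  | succ t ih => exact (Primrec.nat_mul.comp ih hf).of_eq fun x => (pow_succ _ _).symm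

/-- The program needs an integral bound that depends on `⌈n / k⌉₊` only. Rounding the exponent up is
legitimate because the base `n / k` is at least `1`. -/
theorem rpow_div_le {c t : ℝ} {n k : ℕ} (hc : 0 < c) (hk : 1 ≤ k) (hkn : k ≤ n) :
    c * ((n : ℝ) / k) ^ t ≤ ((⌈c⌉₊ * ⌈(n : ℚ) / k⌉₊ ^ ⌈t⌉₊ : ℕ) : ℝ) := by
  have hk' : (0 : ℝ) < k := by exact_mod_cast hk
  have h1 : (1 : ℝ) ≤ (n : ℝ) / k := by
    rw [le_div_iff₀ hk', one_mul]; exact_mod_cast hkn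
  have h2 : (n : ℝ) / k ≤ (⌈(n : ℚ) / k⌉₊ : ℝ) := by
    have := Nat.le_ceil ((n : ℚ) / k)
    have h3 : (((n : ℚ) / k : ℚ) : ℝ) ≤ ((⌈(n : ℚ) / k⌉₊ : ℚ) : ℝ) := by exact_mod_cast this
    simpa using h3
  push_cast
  refine mul_le_mul (Nat.le_ceil c) ?_ (by positivity) (by positivity)
  calc ((n : ℝ) / k) ^ t ≤ ((n : ℝ) / k) ^ (⌈t⌉₊ : ℝ) :=
        Real.rpow_le_rpow_of_exponent_le h1 (Nat.le_ceil t)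
    _ = ((n : ℝ) / k) ^ ⌈t⌉₊ := Real.rpow_natCast _ _
    _ ≤ (⌈(n : ℚ) / k⌉₊ : ℝ) ^ ⌈t⌉₊ := by gcongr

theorem mainTheorem7 (K : Set ℝ) (H : GraphMeasure) (hadd : H.Additive)
    (hbal : H.BalancedOnTrees) (hpoly : H.PolyTimeOnTrees K) :
    H.minOnTrees.IsFPT K := by
  obtain ⟨P, d, hP⟩ := hpoly
  obtain ⟨c, t, hc, -, hbal⟩ := hbal
  -- The working registers start above those of `P` and above the three input registers.
  obtain ⟨c₁, e, hrun⟩ := RealRAM.runs_solver (q := P.regBound + 3) (C := ⌈c⌉₊) (t₀ := ⌈t⌉₊) hadd hP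
    (by omega) (by omega)
  refine ⟨RealRAM.solver (P.regBound + 3) ⌈c⌉₊ ⌈t⌉₊ P, fun x => c₁ * (codeBound (⌈c⌉₊ * x ^ ⌈t⌉₊) + 3) ^ e, e, ?_, fun I => ?_⟩
  · refine Primrec.to_comp (Primrec.nat_mul.comp (Primrec.const c₁) (Primrec.nat_pow_const ?_ e))
    exact Primrec.nat_add.comp (primrec_codeBound.comp (Primrec.nat_mul.comp (Primrec.const _)
      (Primrec.nat_pow_const Primrec.id _))) (Primrec.const 3)
  · have htrim : I.k ≤ I.n → H.IsYesInstance I.T I.k I.τ → ∃ S, H.IsWitness I.T I.k I.τ S ∧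
        IsTrimming I.T ((⌈c⌉₊ * ⌈(I.n : ℚ) / I.k⌉₊ ^ ⌈t⌉₊ : ℕ) : ℝ) S := by
      intro hkn hI
      obtain ⟨S, hS, hS'⟩ := hbal (Fin I.n) I.T I.k I.τ I.isTree I.one_le_k hI
      refine ⟨S, hS, fun C => (hS' C).trans ?_⟩
      rw [Nat.card_fin]
      exact rpow_div_le hc I.one_le_k hkn
    obtain ⟨τ, σ, hexec, hle, hyes, hno⟩ := hrun I.n I.T I.k I.τ (H.minOnTrees.input I) I.isTree
      I.one_le_k htrim rfl rfl rfl rfl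
    refine ⟨τ, σ, hexec, hle.trans ?_, hyes, hno⟩
    change _ ≤ c₁ * (codeBound (⌈c⌉₊ * ⌈(I.n : ℚ) / I.k⌉₊ ^ ⌈t⌉₊) + 3) ^ e * (I.n + 1) ^ e
    rw [mul_assoc, ← mul_pow]
    gcongr
    -- With `b` for the code bound, `b + n + 3 ≤ (b + 3) * (n + 1)` splits the time into a factor of
    -- the parameter and a power of `n + 1`.
    nlinarith [Nat.zero_le (codeBound (⌈c⌉₊ * ⌈(I.n : ℚ) / I.k⌉₊ ^ ⌈t⌉₊) * I.n)]
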